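/- **Lemma (LQG length equals graph length).** Let $p,q$ be integers with $pq>2(p+q)$ and consider the regular $(p,q)$ tiling of the Poincaré disc ($p$-gons, $q$ of them at each vertex). Every leg of a tensor carries $(\mathbb C^2)^{\otimes k}$, with $u\in SU(2)$ acting by $u^{\otimes k}$. Let $(A,B)$ be a hyperinvariant $SU(2)$-invariant tensor pair (HIT): $A$ has $q$ legs and is invariant under cyclic permutation of the legs, $B$ has two legs and is symmetric, both are $SU(2)$-intertwiners, both are (up to a positive constant) isometries from any single leg to the remaining legs, and $\sum_{i_q,j_2}A_{i_1\dots i_q}B_{i_qj_2}A_{j_1j_2\dots j_q}$ is (up to a positive constant) an isometry from the legs $i_1,j_1$ to the remaining legs. Assume that $A$ is a tensor product of two-qubit singlets (Bell pairs) and that the Bell pairs are non-crossing: drawn as chords between the cyclically ordered legs of $A$, no two of them interleave. Take a finite non-empty set of vertices of the tiling, and let $\Gamma$ be the graph formed by all edges with at least one end in this set. Put $A$ on each chosen vertex, a holonomy $g_e\in SU(2)$ (acting as $g_e^{\otimes k}$) on each edge $e$ of $\Gamma$, and $B$ on each edge with both ends in the set; contract, leaving the outer ends free. This defines a state $\psi\in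 L^2(SU(2)^{E(\Gamma)})\otimes\mathcal H_{\rm boundary}$ (normalised Haar measure), and $\psi\neq0$. For an edge $e$ and $j\in\frac12\mathbb N_0$ let $P_e^j$ be the orthogonal projection onto the closed subspace of functions depending on $g_e$ through matrix elements of the spin-$j$ representation, and for a point $x\in\Gamma$ which is not a vertex let $P_x^j=P_e^j$ with $e\ni x$. Let $\gamma$ be a curve in the disc (the image of an injective continuous map on a real interval) which meets $\Gamma$ in finitely many points, none of them a vertex of the tiling, and let $$L_\gamma=\sum_{j}\sqrt{j(j+1)}\sum_{x\in\Gamma\cap\gamma}P_x^j .$$ Then $\psi$ lies in the domain of $L_\gamma$ (the series $L_\gamma\psi$ converges) and $$\frac{\langle\psi|L_\gamma|\psi\rangle}{\langle\psi|\psi\rangle}=c_A\,|\Gamma\cap\gamma| ,\qquad c_A=\sum_j\ell_j,\qquad \ell_j=\sqrt{j(j+1)}\,\frac{\langle A|P^j|A\rangle}{\langle A|A\rangle},$$ where the series $\sum_j\ell_j$ converges, $|A\rangle$ is the state of a single tensor $A$ with a holonomy on each of its legs and $P^j$ acts on any one fixed leg. In particular $c_A$ depends only on $A$. -/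

import Mathlib

open MeasureTheory
open scoped Complex.UnitDisc ComplexConjugate ENNReal

/-! ## The group `SU(2)` with its normalised Haar measure -/

/-- The group `SU(2)`. -/
abbrev SU2 : Type := ↥(Matrix.specialUnitaryGroup (Fin 2) ℂ)

namespace SU2

noncomputable instance instMeasurableSpace : MeasurableSpace SU2 := borel SU2

instance instBorelSpace : BorelSpace SU2 := ⟨rfl⟩

theorem continuous_entry (i j : Fin 2) : Continuous fun u : SU2 => u.1 i j :=
  (continuous_subtype_val (p := fun M => M ∈ Matrix.specialUnitaryGroup (Fin 2) ℂ)).matrix_elem i j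

instance instSecondCountable : SecondCountableTopology SU2 :=
  haveI : SecondCountableTopology (Matrix (Fin 2) (Fin 2) ℂ) :=
    inferInstanceAs (SecondCountableTopology (Fin 2 → Fin 2 → ℂ))
  TopologicalSpace.Subtype.secondCountableTopology
    (Matrix.specialUnitaryGroup (Fin 2) ℂ : Set (Matrix (Fin 2) (Fin 2) ℂ))

instance instContinuousInv : ContinuousInv SU2 := by
  constructor
  refine Continuous.subtype_mk (f := fun u : SU2 => star u.1) ?_ _
  exact Continuous.star continuous_subtype_val

instance instIsTopologicalGroup : IsTopologicalGroup SU2 where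

theorem isCompact_coe : IsCompact (Matrix.specialUnitaryGroup (Fin 2) ℂ : Set (Matrix (Fin 2) (Fin 2) ℂ)) := by
  have hsub : (Matrix.specialUnitaryGroup (Fin 2) ℂ : Set (Matrix (Fin 2) (Fin 2) ℂ)) ⊆
      Set.pi Set.univ (fun _ : Fin 2 => Set.pi Set.univ
        (fun _ : Fin 2 => Metric.closedBall (0 : ℂ) 1)) := by
    intro M hM i _ j _
    simpa using entry_norm_bound_of_unitary
      (Matrix.specialUnitaryGroup_le_unitaryGroup hM) i j
  have hcl : IsClosed
      (Matrix.specialUnitaryGroup (Fin 2) ℂ : Set (Matrix (Fin 2) (Fin 2) ℂ)) := by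
    have : (Matrix.specialUnitaryGroup (Fin 2) ℂ : Set (Matrix (Fin 2) (Fin 2) ℂ)) =
        {M | M * star M = 1} ∩ {M | M.det = 1} := by
      ext M
      simp [Matrix.mem_specialUnitaryGroup_iff, Matrix.mem_unitaryGroup_iff]
    rw [this]
    refine IsClosed.inter (isClosed_eq ?_ continuous_const) (isClosed_eq ?_ continuous_const)
    · exact continuous_id.mul continuous_star
    · exact continuous_id.matrix_det
  exact (isCompact_univ_pi fun _ => isCompact_univ_pi fun _ =>
    isCompact_closedBall (0 : ℂ) 1).of_isClosed_subset hcl hsub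

instance instCompactSpace : CompactSpace SU2 := isCompact_iff_compactSpace.mp isCompact_coe

/-- The Haar probability measure on `SU(2)`. -/
noncomputable def haar : Measure SU2 := Measure.haarMeasure ⊤

instance instIsProbabilityMeasure : IsProbabilityMeasure haar :=
  ⟨by simpa [haar] using Measure.haarMeasure_self (K₀ := (⊤ : TopologicalSpace.PositiveCompacts SU2))⟩

end SU2

/-! ## Tensors whose legs carry `k` qubits -/

/-- Basis labels of one leg: the leg carries the reducible representation `(ℂ²)^{⊗k}` of `SU(2)`,
i.e. `k` spin-1/2 strands. -/
abbrev Qudit (k : ℕ) : Type := Fin k → Fin 2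

/-- A tensor with legs indexed by `ι`, each leg carrying `k` qubits (its components in the
computational basis). -/
abbrev LegTensor (ι : Type) (k : ℕ) : Type := (ι → Qudit k) → ℂ

/-- The matrix of `u^{⊗k}` on `(ℂ²)^{⊗k}`. -/
def strandRep {k : ℕ} (u : SU2) (a b : Qudit k) : ℂ := ∏ s, u.1 (a s) (b s)

theorem continuous_strandRep {k : ℕ} (a b : Qudit k) :
    Continuous fun u : SU2 => strandRep u a b :=
  continuous_finsetProd _ fun s _ => SU2.continuous_entry (a s) (b s)

namespace LegTensor

variable {ι : Type} [Fintype ι] [DecidableEq ι] {k : ℕ}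

/-- The action of `u` on every leg of the tensor. -/
def act (u : SU2) (T : LegTensor ι k) : LegTensor ι k :=
  fun x => ∑ y : ι → Qudit k, (∏ l, strandRep u (x l) (y l)) * T y

/-- `T` is an `SU(2)`-intertwiner: `R(u)|T⟩⟨T|R(u)† = |T⟩⟨T|` for all `u`. -/
def IsIntertwiner (T : LegTensor ι k) : Prop :=
  ∀ (u : SU2) (x x' : ι → Qudit k), act u T x * conj (act u T x') = T x * conj (T x')

/-- Combine indices on the legs in `I` with indices on the complementary legs. -/
def glue (I : Finset ι) (a : {l // l ∈ I} → Qudit k) (r : {l // l ∉ I} → Qudit k) :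
    ι → Qudit k :=
  fun l => if h : l ∈ I then a ⟨l, h⟩ else r ⟨l, h⟩

/-- Up to a positive normalisation constant, `T` is an isometry from the legs in `I` to the
remaining legs. -/
def IsIsometricFrom (I : Finset ι) (T : LegTensor ι k) : Prop :=
  ∃ c : ℝ, 0 < c ∧ ∀ a a' : {l // l ∈ I} → Qudit k,
    ∑ r : {l // l ∉ I} → Qudit k, conj (T (glue I a r)) * T (glue I a' r) =
      if a = a' then (c : ℂ) else 0

/-- `T` is 1-isometric: an isometry from any single leg to the rest. -/
def IsOneIsometric (T : LegTensor ι k) : Prop := ∀ l, IsIsometricFrom {l} T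

end LegTensor

/-- The contraction `∑ A_{i₁ … i_q} B_{i_q j₂} A_{j₁ j₂ … j_q}`. The legs are numbered cyclically by
`Fin q` starting from `0`, so that the leg of `i_q` is `-1` and that of `j₂` is `1`. -/
def doubleTensor {q k : ℕ} [NeZero q] (A : LegTensor (Fin q) k) (B : LegTensor (Fin 2) k) :
    LegTensor ({i : Fin q // i ≠ -1} ⊕ {j : Fin q // j ≠ 1}) k :=
  fun z => ∑ s : Qudit k, ∑ t : Qudit k,
    A (fun i => if h : i = -1 then s else z (Sum.inl ⟨i, h⟩)) * B ![s, t] *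
      A (fun j => if h : j = 1 then t else z (Sum.inr ⟨j, h⟩))

/-- `(A, B)` is a hyperinvariant, `SU(2)`-invariant tensor pair of valence `q`. -/
structure IsHIT {q k : ℕ} [NeZero q] (A : LegTensor (Fin q) k) (B : LegTensor (Fin 2) k) :
    Prop where
  cyclic : ∀ x : Fin q → Qudit k, A (fun i => x (i + 1)) = A x
  symmetric : ∀ s t : Qudit k, B ![s, t] = B ![t, s]
  intertwiner_A : A.IsIntertwiner
  intertwiner_B : B.IsIntertwiner
  isometric_A : A.IsOneIsometric
  isometric_B : B.IsOneIsometric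
  /-- The isometry condition from the legs `i₁, j₁` of the double tensor to the rest. -/
  isometric_double : (doubleTensor A B).IsIsometricFrom
    (Finset.univ.filter fun l => Sum.elim (fun i => i.1) (fun j => j.1) l = 0)

/-! ## Tensor products of Bell pairs -/

/-- The `SU(2)`-invariant Bell pair `(|01⟩ - |10⟩)/√2`. -/
noncomputable def bellPair (a b : Fin 2) : ℂ :=
  (1 / Real.sqrt 2 : ℝ) * (!![0, 1; -1, 0] : Matrix (Fin 2) (Fin 2) ℂ) a b

/-- The tensor product of `m` Bell pairs distributed over the `q * k` qubits of a `q`-valent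
tensor; the `r`-th pair lives on the qubits `e (r, 0)` and `e (r, 1)`, where the qubit `(i, s)` is
the `s`-th strand of leg `i`. -/
noncomputable def bellTensor {q k m : ℕ} (e : Fin m × Fin 2 ≃ Fin q × Fin k) :
    LegTensor (Fin q) k :=
  fun x => ∏ r : Fin m, bellPair (x (e (r, 0)).1 (e (r, 0)).2) (x (e (r, 1)).1 (e (r, 1)).2)

/-- The Bell pairs are non-crossing: drawn as chords between the legs, which are arranged
cyclically around the vertex, no two of them interleave. -/
def NonCrossing {q k m : ℕ} (e : Fin m × Fin 2 ≃ Fin q × Fin k) : Prop :=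
  ∀ (r r' : Fin m) (σ τ : Fin 2),
    ¬ ((e (r, σ)).1 < (e (r', τ)).1 ∧ (e (r', τ)).1 < (e (r, 1 - σ)).1 ∧
      (e (r, 1 - σ)).1 < (e (r', 1 - τ)).1)

/-! ## Tensor network states with holonomies -/

/-- A finite graph with `q`-valent vertices. Every edge `e` starts at a half-edge (a vertex together
with one of its `q` legs) and either ends at another half-edge, or has a free end (`none`). -/
structure SpinGraph (q : ℕ) where
  V : Type
  E : Type
  [fintypeV : Fintype V]
  [fintypeE : Fintype E]
  start : E → V × Fin q
  finish : E → Option (V × Fin q)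

namespace SpinGraph

variable {q : ℕ} (G : SpinGraph q)

instance : Fintype G.V := G.fintypeV

instance : Fintype G.E := G.fintypeE

noncomputable instance : DecidableEq G.V := Classical.decEq _

noncomputable instance : DecidableEq G.E := Classical.decEq _

/-- Edges with a free end. -/
abbrev Free : Type := {e : G.E // (G.finish e).isNone}

/-- The boundary Hilbert space: one copy of `(ℂ²)^{⊗k}` for each free end. -/
abbrev Boundary (k : ℕ) : Type := EuclideanSpace ℂ (G.Free → Qudit k)

/-- The Hilbert space `L²(SU(2)^E) ⊗ H_boundary` of the graph. -/
abbrev HilbertSpace (k : ℕ) : Type :=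
  Lp (G.Boundary k) 2 (Measure.pi fun _ : G.E => SU2.haar)

/-- The factor of an edge: the holonomy `g e` transports the index of the half-edge at which `e`
starts; at the other end it is contracted through `B` with the index there, or left free. -/
def edgeFactor {k : ℕ} (B : LegTensor (Fin 2) k) (g : G.E → SU2) (x : G.V × Fin q → Qudit k)
    (b : G.Free → Qudit k) (e : G.E) : ℂ :=
  match h : G.finish e with
  | some y => ∑ s : Qudit k, B ![s, x y] * strandRep (g e) s (x (G.start e))
  | none => strandRep (g e) (b ⟨e, by simp [h]⟩) (x (G.start e))

/-- Components of the tensor network with `A` on all vertices, `B` on all inner edges and holonomies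
on all edges. -/
noncomputable def amplitude {k : ℕ} (A : LegTensor (Fin q) k) (B : LegTensor (Fin 2) k)
    (g : G.E → SU2) (b : G.Free → Qudit k) : ℂ :=
  ∑ x : G.V × Fin q → Qudit k, (∏ v, A fun i => x (v, i)) * ∏ e, G.edgeFactor B g x b e

theorem continuous_amplitude {k : ℕ} (A : LegTensor (Fin q) k) (B : LegTensor (Fin 2) k)
    (b : G.Free → Qudit k) : Continuous fun g => G.amplitude A B g b := by
  unfold amplitude
  refine continuous_finsetSum _ fun x _ => continuous_const.mul (continuous_finsetProd _ fun e _ => ?_)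
  unfold edgeFactor
  split
  · exact continuous_finsetSum _ fun s _ => continuous_const.mul
      ((continuous_strandRep _ _).comp (continuous_apply e))
  · exact (continuous_strandRep _ _).comp (continuous_apply e)

/-- The tensor network as a continuous function of the holonomies with values in the boundary
Hilbert space. -/
noncomputable def wave {k : ℕ} (A : LegTensor (Fin q) k) (B : LegTensor (Fin 2) k) :
    C(G.E → SU2, G.Boundary k) where
  toFun g := WithLp.toLp 2 fun b => G.amplitude A B g b
  continuous_toFun := (PiLp.continuous_toLp 2 _).comp
    (continuous_pi fun b => G.continuous_amplitude A B b)

/-- Continuous functions of the holonomies as elements of the Hilbert space. -/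
noncomputable def embed (k : ℕ) : C(G.E → SU2, G.Boundary k) →L[ℂ] G.HilbertSpace k :=
  ContinuousMap.toLp 2 (Measure.pi fun _ : G.E => SU2.haar) ℂ

/-- The (unnormalised) tensor network state `|ψ⟩`. -/
noncomputable def state {k : ℕ} (A : LegTensor (Fin q) k) (B : LegTensor (Fin 2) k) :
    G.HilbertSpace k :=
  G.embed k (G.wave A B)

end SpinGraph

/-! ## Spin projectors -/

open Polynomial in
/-- The spin-`n/2` representation of `SU(2)` on homogeneous polynomials of degree `n` in two
variables, in the (dehomogenised) monomial basis: the coefficient of `X^a` in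
`(u₀₀ X + u₁₀)^b (u₀₁ X + u₁₁)^(n-b)`. -/
noncomputable def spinMatrix (n : ℕ) (u : SU2) (a b : Fin (n + 1)) : ℂ :=
  ((C (u.1 0 0) * X + C (u.1 1 0)) ^ (b : ℕ) *
    (C (u.1 0 1) * X + C (u.1 1 1)) ^ (n - b)).coeff a

/-- The span of the matrix elements of the spin-`n/2` representation. -/
noncomputable def matrixElements (n : ℕ) : Submodule ℂ (SU2 → ℂ) :=
  Submodule.span ℂ
    (Set.range fun ab : Fin (n + 1) × Fin (n + 1) => fun u => spinMatrix n u ab.1 ab.2)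

namespace SpinGraph

variable {q : ℕ} (G : SpinGraph q)

/-- Continuous functions that depend on the holonomy of the edge `e` through matrix elements of the
spin-`n/2` representation. -/
noncomputable def spinFunctions (k n : ℕ) (e : G.E) : Submodule ℂ C(G.E → SU2, G.Boundary k) where
  carrier := {f | ∀ g b, (fun u => f (Function.update g e u) b) ∈ matrixElements n}
  add_mem' hf hf' g b := (matrixElements n).add_mem (hf g b) (hf' g b)
  zero_mem' _ _ := (matrixElements n).zero_mem
  smul_mem' c _ hf g b := (matrixElements n).smul_mem c (hf g b)

/-- The closed subspace of states with spin `n/2` on the edge `e`. -/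
noncomputable def spinSubspace (k n : ℕ) (e : G.E) : Submodule ℂ (G.HilbertSpace k) :=
  ((G.spinFunctions k n e).map (G.embed k).toLinearMap).topologicalClosure

instance (k n : ℕ) (e : G.E) : CompleteSpace (G.spinSubspace k n e) :=
  inferInstanceAs (CompleteSpace
    ((G.spinFunctions k n e).map (G.embed k).toLinearMap).topologicalClosure)

/-- The orthogonal projection `P^j` onto spin `j = n/2` on the edge `e`. -/
noncomputable def spinProj (k n : ℕ) (e : G.E) : G.HilbertSpace k →L[ℂ] G.HilbertSpace k :=
  (G.spinSubspace k n e).starProjection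

end SpinGraph

/-- The length eigenvalue `√(j (j + 1))` for `j = n/2`. -/
noncomputable def lengthEigenvalue (n : ℕ) : ℝ := Real.sqrt ((n / 2 : ℝ) * (n / 2 + 1))

/-! ## The single-vertex state and the constant `c_A` -/

/-- A single vertex with `q` edges, all of them with a free end. -/
def starGraph (q : ℕ) : SpinGraph q where
  V := Unit
  E := Fin q
  start i := ((), i)
  finish _ := none

/-- The state `|A⟩` given by the single tensor `A` with holonomies on its legs. -/
noncomputable def vertexState {q k : ℕ} (A : LegTensor (Fin q) k) :
    (starGraph q).HilbertSpace k :=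
  (starGraph q).state A 0

/-- `ℓ_j = √(j (j + 1)) ⟨A|P^j|A⟩` for `j = n/2`, with the projector on the leg `i` and `|A⟩`
normalised. -/
noncomputable def spinLength {q k : ℕ} (A : LegTensor (Fin q) k) (i : Fin q) (n : ℕ) : ℝ :=
  lengthEigenvalue n *
    ((inner ℂ (vertexState A) ((starGraph q).spinProj k n i (vertexState A))).re /
      ‖vertexState A‖ ^ 2)

/-! ## The `(p, q)` tiling of the Poincaré disc -/

namespace HyperbolicTiling

theorem halfTurn_denom_ne_zero (t z : 𝔻) : 1 - conj (t : ℂ) * z ≠ 0 := by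
  intro h
  have h1 : conj (t : ℂ) * z = 1 := (sub_eq_zero.mp h).symm
  have h2 : ‖(t : ℂ)‖ * ‖(z : ℂ)‖ = 1 := by simpa using congrArg norm h1
  nlinarith [t.norm_lt_one, z.norm_lt_one, norm_nonneg (t : ℂ), norm_nonneg (z : ℂ)]

theorem halfTurn_norm_lt_one (t z : 𝔻) :
    ‖((t : ℂ) - z) / (1 - conj (t : ℂ) * z)‖ < 1 := by
  have hne := halfTurn_denom_ne_zero t z
  rw [norm_div, div_lt_one (norm_pos_iff.mpr hne)]
  refine lt_of_pow_lt_pow_left₀ 2 (norm_nonneg _) ?_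
  rw [← Complex.normSq_eq_norm_sq, ← Complex.normSq_eq_norm_sq]
  have ht := t.normSq_lt_one
  have hz := z.normSq_lt_one
  have key : Complex.normSq (1 - conj (t : ℂ) * z) - Complex.normSq ((t : ℂ) - z) =
      (1 - Complex.normSq t) * (1 - Complex.normSq z) := by
    simp only [Complex.normSq_apply, Complex.sub_re, Complex.sub_im, Complex.mul_re,
      Complex.mul_im, Complex.conj_re, Complex.conj_im, Complex.one_re, Complex.one_im]
    ring
  nlinarith [mul_pos (sub_pos.mpr ht) (sub_pos.mpr hz)]

/-- The disc automorphism `z ↦ (t - z) / (1 - t̄ z)`: the rotation by `π` about the hyperbolic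
midpoint of `0` and `t`, which exchanges `0` and `t`. -/
noncomputable def halfTurn (t : 𝔻) : Equiv.Perm 𝔻 :=
  Function.Involutive.toPerm
    (fun z => Complex.UnitDisc.mk (((t : ℂ) - z) / (1 - conj (t : ℂ) * z))
      (halfTurn_norm_lt_one t z)) <| by
    intro z
    apply Complex.UnitDisc.coe_injective
    have h1 := halfTurn_denom_ne_zero t z
    have h2 := halfTurn_denom_ne_zero t (Complex.UnitDisc.mk _ (halfTurn_norm_lt_one t z))
    simp only [Complex.UnitDisc.coe_mk] at h2 ⊢
    rw [div_eq_iff h2]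
    generalize conj (t : ℂ) = c at h1 h2 ⊢
    have h3 : ((t : ℂ) - z) / (1 - c * z) * (1 - c * z) = t - z := div_mul_cancel₀ _ h1
    generalize ((t : ℂ) - z) / (1 - c * z) = w at h3 ⊢
    linear_combination -h3

/-- The rotation by `2π/q` about the origin. -/
noncomputable def rotation (q : ℕ) : Equiv.Perm 𝔻 :=
  MulAction.toPerm (Circle.exp (2 * Real.pi / q))

/-- The Euclidean length of an edge from the origin, `tanh (ℓ/2)` where the hyperbolic side length
`ℓ` of a regular `p`-gon with angles `2π/q` satisfies `cosh (ℓ/2) = cos (π/p) / sin (π/q)`. -/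
noncomputable def edgeRadius (p q : ℕ) : ℝ :=
  Real.sqrt (1 - (Real.sin (Real.pi / q) / Real.cos (Real.pi / p)) ^ 2)

open Classical in
/-- The neighbour of the vertex `0` on the positive real axis (the point `edgeRadius p q`; the
alternative does not occur in the hyperbolic case). -/
noncomputable def baseNeighbor (p q : ℕ) : 𝔻 :=
  if h : ‖(edgeRadius p q : ℂ)‖ < 1 then Complex.UnitDisc.mk (edgeRadius p q : ℂ) h else 0

/-- The group of orientation-preserving symmetries of the `(p, q)` tiling that has a vertex at the
origin and an edge from there along the positive real axis. -/
noncomputable def symmetries (p q : ℕ) : Subgroup (Equiv.Perm 𝔻) :=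
  Subgroup.closure {rotation q, halfTurn (baseNeighbor p q)}

/-- The vertices of the tiling. -/
def vertices (p q : ℕ) : Set 𝔻 := {v | ∃ f ∈ symmetries p q, f 0 = v}

/-- The edge from `0` along the positive real axis. -/
def baseEdge (p q : ℕ) : Set 𝔻 :=
  {z | (z : ℂ).im = 0 ∧ 0 ≤ (z : ℂ).re ∧ (z : ℂ).re ≤ edgeRadius p q}

/-- A finite patch of the tiling. Besides its vertices it records choices that do not affect the
geometry: which leg of a vertex is called leg `0` (the legs being numbered counterclockwise from
there), and an orientation of the edges. -/
structure Patch (p q : ℕ) where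
  verts : Finset 𝔻
  frame : {v // v ∈ verts} → Equiv.Perm 𝔻
  frame_mem : ∀ v, frame v ∈ symmetries p q
  frame_zero : ∀ v, frame v 0 = v.1
  orient : Sym2 𝔻 → {v // v ∈ verts} × Fin q

namespace Patch

variable {p q : ℕ} (P : Patch p q)

/-- The symmetry of the tiling that moves the base edge to the `i`-th edge at `v`. -/
noncomputable def legFrame (y : {v // v ∈ P.verts} × Fin q) : Equiv.Perm 𝔻 :=
  P.frame y.1 * rotation q ^ (y.2 : ℕ)

/-- The edge containing a half-edge, as an unordered pair of vertices of the tiling. -/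
noncomputable def edgeOf (y : {v // v ∈ P.verts} × Fin q) : Sym2 𝔻 :=
  s(y.1.1, P.legFrame y (baseNeighbor p q))

/-- The edges of the patch: all edges of the tiling that have at least one end in the patch. -/
abbrev Edge : Type := {e : Sym2 𝔻 // ∃ y, P.edgeOf y = e}

instance : Finite P.Edge := Set.finite_range P.edgeOf

open Classical in
/-- The half-edge at which an edge starts. -/
noncomputable def start (e : P.Edge) : {v // v ∈ P.verts} × Fin q :=
  if P.edgeOf (P.orient e.1) = e.1 then P.orient e.1 else e.2.choose

open Classical in
/-- The other half-edge of an edge, if both ends of the edge are in the patch. -/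
noncomputable def finish (e : P.Edge) : Option ({v // v ∈ P.verts} × Fin q) :=
  if h : ∃ y, y ≠ P.start e ∧ P.edgeOf y = e.1 then some h.choose else none

/-- The graph `Γ` underlying the tensor network on the patch. -/
noncomputable def graph : SpinGraph q where
  V := {v // v ∈ P.verts}
  E := P.Edge
  fintypeE := Fintype.ofFinite P.Edge
  start := P.start
  finish := P.finish

/-- The geodesic segment in the disc that represents an edge. -/
noncomputable def arc (e : P.Edge) : Set 𝔻 := P.legFrame (P.start e) '' baseEdge p q

/-- The graph `Γ` as a subset of the disc. -/
noncomputable def support : Set 𝔻 := ⋃ e, P.arc e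

/-- The edge on which a point of `Γ` lies (it is unique unless the point is a vertex). -/
noncomputable def edgeAt (x : {z // z ∈ P.support}) : P.graph.E :=
  (Set.mem_iUnion.mp x.2).choose

/-- The term of spin `j = n/2` of the length operator of a curve with image `c`, namely
`√(j (j + 1)) ∑_{x ∈ Γ ∩ c} P_x^j`. -/
noncomputable def lengthTerm (k : ℕ) (c : Set 𝔻) (n : ℕ) (f : P.graph.HilbertSpace k) :
    P.graph.HilbertSpace k :=
  (lengthEigenvalue n : ℂ) •
    ∑ᶠ x : {z : {z // z ∈ P.support} // z.1 ∈ c}, P.graph.spinProj k n (P.edgeAt x.1) f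

/-- The domain of the length operator. -/
def InLengthDomain (k : ℕ) (c : Set 𝔻) (f : P.graph.HilbertSpace k) : Prop :=
  Summable fun n => P.lengthTerm k c n f

/-- The length operator `L = ∑_j √(j (j + 1)) ∑_{x ∈ Γ ∩ c} P_x^j`. -/
noncomputable def lengthOp (k : ℕ) (c : Set 𝔻) (f : P.graph.HilbertSpace k) :
    P.graph.HilbertSpace k :=
  ∑' n, P.lengthTerm k c n f

/-- The graph length `|Γ ∩ c|`. -/
noncomputable def graphLength (c : Set 𝔻) : ℕ := (P.support ∩ c).ncard

end Patch

end HyperbolicTiling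

/-!
On an edge `x` of the network every expectation value of a function of the holonomy `g x` can be
computed by cutting `x` and replacing the holonomy by an arbitrary matrix `X` on `(ℂ²)^{⊗k}`. The claim
reduces to one fact: the linear map from `X` to the boundary state is, for fixed holonomies on the other
edges, a multiple of an isometry (`SpinGraph.IsIsometricAt`). Granted this, `‖ψ‖²` and `⟨ψ|P_x^j|ψ⟩` are
the same multiple of `2^k` and of a number `SpinGraph.spinOverlap` depending on `k` and `j` only, so
that their quotient does not depend on the edge or on the graph. The graph consisting of a single vertex
gives the value `ℓ_j`, so every intersection point contributes `∑ ℓ_j`; since `(ℂ²)^{⊗k}` contains no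
spin above `k/2`, all series are finite sums.

The isometry comes from the structure of the tensors. A Bell pair between non-adjacent legs would cross
its image under a rotation by one leg, and a Bell pair within a leg contradicts 1-isometry; hence the
Bell pairs connect adjacent legs (`BellTensor.partner_adjacent`). So each leg has a left and a right
half, and `A` is a product of wires from the left half of each leg to the right half of the next one
(`BellTensor.isWired_bellTensor`). In these terms the three isometry conditions on `(A, B)` say
that `B` is dual-unitary: it is isometric between its two ends and also from its left to its right side
(`exists_isDual`). A holonomy acts on the two halves separately and keeps this property.

A dual-unitary edge can be contracted without changing the norm, up to a factor, as soon as on each of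
its two sides one of the two adjacent wires leads to an index which is still free
(`WireNet.sum_norm_sq_contractLegs`). Starting from the disconnected vertices and the cut edge, the
edges are contracted in the order of increasing distance of their midpoints from that of the cut edge
(`WireNet.exists_contraction`). At every step the needed free wires exist: on one side of an edge, the
midpoints of the two neighbouring edges are exchanged by the half-turn about the midpoint of that edge,
and a point and its image under a half-turn cannot both be at most as far from a given point as the
centre of the half-turn (`HyperbolicTiling.coshSq_lt_of_halfTurn`), by convexity of the hyperbolic
distance.
-/

/-! ### Harmonic analysis on `SU(2)` -/

namespace SU2

instance instIsHaarMeasure : haar.IsHaarMeasure := by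
  unfold haar; infer_instance

theorem mul_entry (u v : SU2) (i j : Fin 2) :
    (u * v).1 i j = u.1 i 0 * v.1 0 j + u.1 i 1 * v.1 1 j := by
  simp [Matrix.mul_apply, Fin.sum_univ_two]

theorem sum_conj_entry (u : SU2) (b b' : Fin 2) :
    ∑ a, conj (u.1 a b) * u.1 a b' = if b = b' then 1 else 0 := by
  have h := (Matrix.mem_unitaryGroup_iff').1 (Matrix.specialUnitaryGroup_le_unitaryGroup u.2)
  have := congrFun (congrFun h b) b'
  simpa [Matrix.mul_apply, Matrix.one_apply, Matrix.star_apply] using this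

/-- The element `diag(e^{iθ}, e^{-iθ})` of the maximal torus. -/
noncomputable def torus (θ : ℝ) : SU2 :=
  ⟨Matrix.diagonal ![Complex.exp (θ * Complex.I), Complex.exp (-(θ * Complex.I))], by
    rw [Matrix.mem_specialUnitaryGroup_iff, Matrix.mem_unitaryGroup_iff]
    constructor
    · ext i j
      fin_cases i <;> fin_cases j <;>
        simp [Matrix.mul_apply, Fin.sum_univ_two, ← Complex.exp_conj, ← Complex.exp_add]
    · simp [Matrix.det_diagonal, Fin.prod_univ_two, ← Complex.exp_add]⟩

theorem torus_mul_entry (θ : ℝ) (u : SU2) (i j : Fin 2) :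
    (torus θ * u).1 i j = Complex.exp ((if i = 0 then 1 else -1 : ℝ) * θ * Complex.I) * u.1 i j := by
  rw [mul_entry]
  fin_cases i <;> simp [torus]

/-- An element of `SU(2)` whose second row is proportional to `(w, 1)`. -/
noncomputable def ofRatio (w : ℂ) : SU2 :=
  ⟨((Real.sqrt (1 + Complex.normSq w) : ℝ) : ℂ)⁻¹ • !![1, -conj w; w, 1], by
    have hs : ((Real.sqrt (1 + Complex.normSq w) : ℝ) : ℂ) ^ 2 = 1 + w * conj w := by
      rw [← Complex.ofReal_pow, Real.sq_sqrt (by positivity [Complex.normSq_nonneg w]),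
        Complex.mul_conj]
      simp
    have h0 : ((Real.sqrt (1 + Complex.normSq w) : ℝ) : ℂ) ≠ 0 := by
      rw [Complex.ofReal_ne_zero]
      have := Complex.normSq_nonneg w
      positivity
    rw [Matrix.mem_specialUnitaryGroup_iff, Matrix.mem_unitaryGroup_iff]
    constructor
    · ext i j
      fin_cases i <;> fin_cases j <;>
        simp [Matrix.mul_apply, Fin.sum_univ_two] <;> field_simp <;> rw [hs] <;> ring
    · simp [Matrix.det_fin_two]
      field_simp
      rw [hs]; ring⟩

end SU2

section StrandRep

variable {k : ℕ}

theorem strandRep_mul (u v : SU2) (a b : Qudit k) :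
    strandRep (u * v) a b = ∑ c, strandRep u a c * strandRep v c b := by
  simp only [strandRep, ← Finset.prod_mul_distrib]
  rw [← Fintype.prod_sum (fun s (c : Fin 2) => u.1 (a s) c * v.1 c (b s))]
  exact Finset.prod_congr rfl fun s _ => by rw [SU2.mul_entry, Fin.sum_univ_two]

theorem prod_ite_eq_funext {ι α : Type*} [Fintype ι] [DecidableEq α] [DecidableEq ι] (f g : ι → α) :
    (∏ i, if f i = g i then (1 : ℂ) else 0) = if f = g then 1 else 0 := by
  rw [Finset.prod_ite_zero]
  simp [funext_iff]

/-- The matrix `u^{⊗k}` is unitary. -/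
theorem sum_conj_strandRep (u : SU2) (b b' : Qudit k) :
    ∑ a, conj (strandRep u a b) * strandRep u a b' = if b = b' then 1 else 0 := by
  simp only [strandRep, map_prod, ← Finset.prod_mul_distrib]
  rw [← Fintype.prod_sum (fun s (c : Fin 2) => conj (u.1 c (b s)) * u.1 c (b' s))]
  simp only [SU2.sum_conj_entry]
  exact prod_ite_eq_funext b b'

theorem integrable_of_continuous {f : SU2 → ℂ} (hf : Continuous f) : Integrable f SU2.haar :=
  hf.integrable_of_hasCompactSupport (HasCompactSupport.of_compactSpace f)

/-- Under the left action of the torus, `u ↦ u₁₀^b u₁₁^(n-b)` has weight `-n`, while the weights of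
`u^{⊗k}` are at least `-k`. -/
theorem integral_strandRep_row_one {n : ℕ} (hkn : k < n) (c d : Qudit k) {b : ℕ} (hb : b ≤ n) :
    ∫ u : SU2, conj (strandRep u c d) * (u.1 1 0 ^ b * u.1 1 1 ^ (n - b)) ∂SU2.haar = 0 := by
  set σ : Fin 2 → ℝ := fun i => if i = 0 then 1 else -1 with hσ
  set N : ℝ := n + ∑ s, σ (c s) with hN
  have hNpos : 0 < N := by
    have h1 : -(k : ℝ) ≤ ∑ s, σ (c s) := by
      have : ∑ _s : Fin k, (-1 : ℝ) ≤ ∑ s, σ (c s) :=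
        Finset.sum_le_sum fun s _ => by simp only [hσ]; split_ifs <;> norm_num
      simpa using this
    have h2 : (k : ℝ) < n := by exact_mod_cast hkn
    linarith
  -- with this angle the integrand changes its sign
  set θ : ℝ := Real.pi / N with hθ
  have key : ∀ u : SU2, conj (strandRep (SU2.torus θ * u) c d) *
      ((SU2.torus θ * u).1 1 0 ^ b * (SU2.torus θ * u).1 1 1 ^ (n - b)) =
      -(conj (strandRep u c d) * (u.1 1 0 ^ b * u.1 1 1 ^ (n - b))) := by
    intro u
    have h1 : strandRep (SU2.torus θ * u) c d =
        Complex.exp ((∑ s, σ (c s) : ℝ) * θ * Complex.I) * strandRep u c d := by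
      simp only [strandRep, SU2.torus_mul_entry, Finset.prod_mul_distrib, ← Complex.exp_sum]
      push_cast
      rw [Finset.sum_mul, Finset.sum_mul]
    rw [h1, SU2.torus_mul_entry, SU2.torus_mul_entry, mul_pow, mul_pow, map_mul, ← Complex.exp_conj,
      ← Complex.exp_nat_mul, ← Complex.exp_nat_mul]
    have hexp : Complex.exp (conj (((∑ s, σ (c s) : ℝ) : ℂ) * θ * Complex.I)) *
        (Complex.exp (b * (((if (1 : Fin 2) = 0 then 1 else -1 : ℝ) : ℂ) * θ * Complex.I)) *
        Complex.exp ((n - b : ℕ) * (((if (1 : Fin 2) = 0 then 1 else -1 : ℝ) : ℂ) * θ * Complex.I)))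
        = -1 := by
      rw [← Complex.exp_add, ← Complex.exp_add, ← Complex.exp_neg_pi_mul_I]
      congr 1
      have h2 : (N : ℂ) * θ = Real.pi := by
        rw [← Complex.ofReal_mul, hθ, mul_div_cancel₀ _ hNpos.ne']
      have h3 : (N : ℂ) = n + ((∑ s, σ (c s) : ℝ) : ℂ) := by rw [hN]; push_cast; rfl
      rw [← h2, h3, Nat.cast_sub hb]
      simp only [map_mul, Complex.conj_ofReal, Complex.conj_I]
      simp
      ring
    linear_combination (conj (strandRep u c d) * (u.1 1 0 ^ b * u.1 1 1 ^ (n - b))) * hexp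
  have h := integral_mul_left_eq_self (μ := SU2.haar)
    (fun u : SU2 => conj (strandRep u c d) * (u.1 1 0 ^ b * u.1 1 1 ^ (n - b))) (SU2.torus θ)
  simp only [key, integral_neg] at h
  exact self_eq_neg.1 h.symm

open Polynomial in
theorem natDegree_spinPoly_le {n b : ℕ} (hb : b ≤ n) (u : SU2) :
    ((C (u.1 0 0) * X + C (u.1 1 0)) ^ b * (C (u.1 0 1) * X + C (u.1 1 1)) ^ (n - b)).natDegree
      < n + 1 := by
  have h : ∀ x y : ℂ, (C x * X + C y).natDegree ≤ 1 := fun x y => natDegree_linear_le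
  calc _ ≤ b * 1 + (n - b) * 1 :=
        natDegree_mul_le.trans (add_le_add (natDegree_pow_le_of_le b (h _ _))
          (natDegree_pow_le_of_le _ (h _ _)))
    _ < n + 1 := by omega

theorem continuous_spinMatrix (n : ℕ) (a b : Fin (n + 1)) :
    Continuous fun u : SU2 => spinMatrix n u a b := by
  unfold spinMatrix
  have hlin : ∀ (i j l m : Fin 2) (s t : ℕ), Continuous fun u : SU2 =>
      ((Polynomial.C (u.1 i j) * Polynomial.X + Polynomial.C (u.1 l m)) ^ s).coeff t := by
    intro i j l m s
    induction s with
    | zero => intro t; simpa using continuous_const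
    | succ s ih =>
      intro t
      simp only [pow_succ, Polynomial.coeff_mul]
      refine continuous_finsetSum _ fun x _ => (ih _).mul ?_
      simp only [Polynomial.coeff_add, Polynomial.coeff_C_mul, Polynomial.coeff_C]
      refine ((SU2.continuous_entry _ _).mul continuous_const).add ?_
      split_ifs
      · exact SU2.continuous_entry _ _
      · exact continuous_const
  simp only [Polynomial.coeff_mul]
  exact continuous_finsetSum _ fun x _ => (hlin _ _ _ _ _ _).mul (hlin _ _ _ _ _ _)

theorem continuous_of_mem_matrixElements {n : ℕ} {f : SU2 → ℂ} (hf : f ∈ matrixElements n) :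
    Continuous f := by
  induction hf using Submodule.span_induction with
  | mem x h => obtain ⟨ab, rfl⟩ := h; exact continuous_spinMatrix n _ _
  | zero => exact continuous_const
  | add x y _ _ hx hy => exact hx.add hy
  | smul c x _ hx => exact continuous_const.smul hx

theorem integral_strandRep_spinMatrix {n : ℕ} (hkn : k < n) (c d : Qudit k) (a b : Fin (n + 1)) :
    ∫ u : SU2, conj (strandRep u c d) * spinMatrix n u a b ∂SU2.haar = 0 := by
  have hb : (b : ℕ) ≤ n := Nat.lt_succ_iff.1 b.2
  set J : Fin (n + 1) → ℂ := fun a =>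
    ∫ u : SU2, conj (strandRep u c d) * spinMatrix n u a b ∂SU2.haar with hJ
  have hint : ∀ (a : Fin (n + 1)) (x : ℂ),
      Integrable (fun u : SU2 => x * (conj (strandRep u c d) * spinMatrix n u a b)) SU2.haar :=
    fun a x => integrable_of_continuous (continuous_const.mul
      ((Complex.continuous_conj.comp (continuous_strandRep c d)).mul (continuous_spinMatrix n a b)))
  -- the translates of the weight vector are generating functions of a column of the matrix
  have hzero : ∀ w : ℂ, ∑ a : Fin (n + 1), w ^ (a : ℕ) * J a = 0 := by
    intro w
    set h := SU2.ofRatio w with hh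
    set r : ℂ := ((Real.sqrt (1 + Complex.normSq w) : ℝ) : ℂ)⁻¹ with hr
    have hr0 : r ≠ 0 := by
      rw [hr]
      refine inv_ne_zero ?_
      rw [Complex.ofReal_ne_zero]
      have := Complex.normSq_nonneg w
      positivity
    have e0 : h.1 1 0 = r * w := by simp [hh, SU2.ofRatio, hr]
    have e1 : h.1 1 1 = r := by simp [hh, SU2.ofRatio, hr]
    have hrow : ∀ u : SU2, (h * u).1 1 0 ^ (b : ℕ) * (h * u).1 1 1 ^ (n - b) =
        r ^ n * ∑ a : Fin (n + 1), w ^ (a : ℕ) * spinMatrix n u a b := by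
      intro u
      rw [SU2.mul_entry, SU2.mul_entry, e0, e1]
      have hev := Polynomial.eval_eq_sum_range' (natDegree_spinPoly_le hb u) w
      rw [Finset.sum_range] at hev
      have : ∑ a : Fin (n + 1), w ^ (a : ℕ) * spinMatrix n u a b =
          (u.1 0 0 * w + u.1 1 0) ^ (b : ℕ) * (u.1 0 1 * w + u.1 1 1) ^ (n - b) := by
        simp only [Polynomial.eval_mul, Polynomial.eval_pow, Polynomial.eval_add,
          Polynomial.eval_C, Polynomial.eval_X] at hev
        rw [hev]
        exact Finset.sum_congr rfl fun a _ => mul_comm _ _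
      rw [this]
      have hrn : r ^ n = r ^ (b : ℕ) * r ^ (n - b) := by rw [← pow_add, Nat.add_sub_cancel' hb]
      rw [hrn]
      rw [show r * w * u.1 0 0 + r * u.1 1 0 = r * (u.1 0 0 * w + u.1 1 0) by ring,
        show r * w * u.1 0 1 + r * u.1 1 1 = r * (u.1 0 1 * w + u.1 1 1) by ring, mul_pow, mul_pow]
      ring
    have h1 : ∫ u : SU2, conj (strandRep u c d) *
        ((h * u).1 1 0 ^ (b : ℕ) * (h * u).1 1 1 ^ (n - b)) ∂SU2.haar = 0 := by
      have hinv := integral_mul_left_eq_self (μ := SU2.haar)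
        (fun u : SU2 => conj (strandRep (h⁻¹ * u) c d) * (u.1 1 0 ^ (b : ℕ) * u.1 1 1 ^ (n - b))) h
      simp only [inv_mul_cancel_left] at hinv
      rw [hinv]
      simp only [strandRep_mul, map_sum, map_mul, Finset.sum_mul, mul_assoc]
      rw [integral_finsetSum]
      · refine Finset.sum_eq_zero fun x _ => ?_
        rw [integral_const_mul, integral_strandRep_row_one hkn x d hb, mul_zero]
      · intro x _
        exact integrable_of_continuous (continuous_const.mul
          ((Complex.continuous_conj.comp (continuous_strandRep x d)).mul
            (((SU2.continuous_entry _ _).pow _).mul ((SU2.continuous_entry _ _).pow _))))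
    simp only [hrow] at h1
    have h2 : r ^ n * ∑ a : Fin (n + 1), w ^ (a : ℕ) * J a = 0 := by
      rw [← h1, hJ]
      simp only [← integral_const_mul]
      rw [← integral_finsetSum _ fun a _ => hint a _, ← integral_const_mul]
      refine integral_congr_ae (Filter.Eventually.of_forall fun u => ?_)
      simp only [Finset.mul_sum]
      exact Finset.sum_congr rfl fun a _ => by ring
    exact (mul_eq_zero.1 h2).resolve_left (pow_ne_zero _ hr0)
  have hpoly : (∑ a : Fin (n + 1), Polynomial.C (J a) * Polynomial.X ^ (a : ℕ)) = 0 := by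
    refine Polynomial.funext fun w => ?_
    simp only [Polynomial.eval_finsetSum, Polynomial.eval_mul, Polynomial.eval_C,
      Polynomial.eval_pow, Polynomial.eval_X, Polynomial.eval_zero]
    rw [← hzero w]
    exact Finset.sum_congr rfl fun a _ => mul_comm _ _
  have := congrArg (fun P => Polynomial.coeff P (a : ℕ)) hpoly
  simp only [Polynomial.finsetSum_coeff, Polynomial.coeff_C_mul, Polynomial.coeff_X_pow,
    Polynomial.coeff_zero] at this
  rw [Finset.sum_eq_single a] at this
  · simpa using this
  · intro x _ hx
    rw [if_neg (fun h => hx (Fin.ext h.symm)), mul_zero]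
  · simp

/-- The matrix elements of `u^{⊗k}` only contain spins up to `k/2`. -/
theorem integral_conj_matrixElement_strandRep {n : ℕ} (hkn : k < n) (c d : Qudit k) {f : SU2 → ℂ}
    (hf : f ∈ matrixElements n) : ∫ u : SU2, conj (f u) * strandRep u c d ∂SU2.haar = 0 := by
  have hstr : Continuous fun u : SU2 => conj (strandRep u c d) :=
    Complex.continuous_conj.comp (continuous_strandRep c d)
  have h : ∫ u : SU2, conj (strandRep u c d) * f u ∂SU2.haar = 0 := by
    induction hf using Submodule.span_induction with
    | mem x h => obtain ⟨ab, rfl⟩ := h; exact integral_strandRep_spinMatrix hkn c d _ _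
    | zero => simp
    | add x y hx hy ihx ihy =>
      simp only [Pi.add_apply, mul_add]
      rw [integral_add, ihx, ihy, add_zero]
      · exact integrable_of_continuous (hstr.mul (continuous_of_mem_matrixElements hx))
      · exact integrable_of_continuous (hstr.mul (continuous_of_mem_matrixElements hy))
    | smul c x hx ihx =>
      simp only [Pi.smul_apply, smul_eq_mul, mul_left_comm _ c]
      rw [integral_const_mul, ihx, mul_zero]
  have h2 := congrArg conj h
  rw [← integral_conj, map_zero] at h2
  rw [← h2]
  refine integral_congr_ae (Filter.Eventually.of_forall fun u => ?_)
  simp [mul_comm]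

/-- The component of a matrix element of `u^{⊗k}` of spin `n/2`, as a function on `SU(2)`. -/
theorem exists_spinComponent (n : ℕ) (a b : Qudit k) :
    ∃ p ∈ matrixElements n, (k < n → p = 0) ∧
      ∀ f ∈ matrixElements n, ∫ u : SU2, conj (f u) * (strandRep u a b - p u) ∂SU2.haar = 0 := by
  by_cases hkn : k < n
  · refine ⟨0, Submodule.zero_mem _, fun _ => rfl, fun f hf => ?_⟩
    simpa using integral_conj_matrixElement_strandRep hkn a b hf
  let M : Submodule ℂ C(SU2, ℂ) :=
    (matrixElements n).comap (ContinuousMap.coeFnLinearMap ℂ (M := ℂ))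
  let ι : C(SU2, ℂ) →L[ℂ] Lp ℂ 2 SU2.haar := ContinuousMap.toLp 2 SU2.haar ℂ
  have hfinM : FiniteDimensional ℂ M := by
    have : FiniteDimensional ℂ (matrixElements n) :=
      FiniteDimensional.span_of_finite ℂ (Set.finite_range _)
    have hinj : Function.Injective ((ContinuousMap.coeFnLinearMap ℂ (α := SU2) (M := ℂ)).restrict
        (p := M) (q := matrixElements n) fun x hx => hx) := by
      intro x y hxy
      apply Subtype.ext
      have := congrArg Subtype.val hxy
      exact DFunLike.coe_injective this
    exact FiniteDimensional.of_injective _ hinj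
  let K : Submodule ℂ (Lp ℂ 2 SU2.haar) := M.map ι.toLinearMap
  have : FiniteDimensional ℂ K := inferInstanceAs (FiniteDimensional ℂ (M.map ι.toLinearMap))
  let D : C(SU2, ℂ) := ⟨fun u => strandRep u a b, continuous_strandRep a b⟩
  obtain ⟨p, hpM, hp⟩ : ∃ p ∈ M, ι p = K.starProjection (ι D) := by
    have := K.starProjection_apply_mem (ι D)
    obtain ⟨p, hp, h⟩ := this
    exact ⟨p, hp, h⟩
  refine ⟨p, hpM, fun h => absurd h hkn, fun f hf => ?_⟩
  let F : C(SU2, ℂ) := ⟨f, continuous_of_mem_matrixElements hf⟩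
  have horth : inner ℂ (ι F) (ι (D - p)) = 0 := by
    rw [map_sub, hp]
    have h1 := K.sub_starProjection_mem_orthogonal (ι D)
    exact (Submodule.mem_orthogonal _ _).1 h1 (ι F) ⟨F, hf, rfl⟩
  have h2 := ContinuousMap.inner_toLp (𝕜 := ℂ) SU2.haar F (D - p)
  rw [show inner ℂ (ContinuousMap.toLp 2 SU2.haar ℂ F) (ContinuousMap.toLp 2 SU2.haar ℂ (D - p)) = 0
    from horth] at h2
  rw [h2]
  refine integral_congr_ae (Filter.Eventually.of_forall fun u => ?_)
  simp [F, D, mul_comm]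

/-- The spin-`n/2` component of the matrix element `a b` of `u^{⊗k}`. -/
noncomputable def spinComponent (n : ℕ) (u : SU2) (a b : Qudit k) : ℂ :=
  (exists_spinComponent n a b).choose u

theorem spinComponent_mem (n : ℕ) (a b : Qudit k) :
    (fun u => spinComponent n u a b) ∈ matrixElements n :=
  (exists_spinComponent n a b).choose_spec.1

theorem continuous_spinComponent (n : ℕ) (a b : Qudit k) :
    Continuous fun u => spinComponent n u a b :=
  continuous_of_mem_matrixElements (spinComponent_mem n a b)

theorem spinComponent_eq_zero {n : ℕ} (hkn : k < n) (u : SU2) (a b : Qudit k) :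
    spinComponent n u a b = 0 :=
  congrFun ((exists_spinComponent n a b).choose_spec.2.1 hkn) u

theorem integral_conj_mul_strandRep_sub_spinComponent {n : ℕ} (a b : Qudit k) {f : SU2 → ℂ}
    (hf : f ∈ matrixElements n) :
    ∫ u : SU2, conj (f u) * (strandRep u a b - spinComponent n u a b) ∂SU2.haar = 0 :=
  (exists_spinComponent n a b).choose_spec.2.2 f hf

end StrandRep

/-! ### Spin projections of a tensor network state -/

section Resampling

variable {E : Type} [Fintype E] [DecidableEq E]

theorem measurePreserving_update (e : E) :
    MeasurePreserving (fun q : (E → SU2) × SU2 => Function.update q.1 e q.2)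
      ((Measure.pi fun _ : E => SU2.haar).prod SU2.haar) (Measure.pi fun _ : E => SU2.haar) := by
  have hm : Measurable (fun q : (E → SU2) × SU2 => Function.update q.1 e q.2) := by
    refine measurable_pi_iff.2 fun i => ?_
    by_cases h : i = e
    · subst h; simpa using measurable_snd
    · simpa [Function.update_of_ne h, Function.comp_def] using
        (measurable_pi_apply i).comp measurable_fst
  refine ⟨hm, (Measure.pi_eq fun s hs => ?_).symm⟩
  rw [Measure.map_apply hm (MeasurableSet.univ_pi hs)]
  have hset : (fun q : (E → SU2) × SU2 => Function.update q.1 e q.2) ⁻¹' Set.univ.pi s =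
      (Set.univ.pi (Function.update s e Set.univ)) ×ˢ s e := by
    ext ⟨g, u⟩
    simp only [Set.mem_preimage, Set.mem_pi, Set.mem_univ, true_imp_iff, Set.mem_prod]
    constructor
    · intro h
      refine ⟨fun i => ?_, by simpa using h e⟩
      by_cases hi : i = e
      · subst hi; simp
      · simpa [Function.update_of_ne hi] using h i
    · rintro ⟨h, hu⟩ i
      by_cases hi : i = e
      · subst hi; simpa using hu
      · simpa [Function.update_of_ne hi] using h i
  rw [hset, Measure.prod_prod, Measure.pi_pi, ← Finset.mul_prod_erase _ _ (Finset.mem_univ e),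
    ← Finset.mul_prod_erase (a := e) Finset.univ (fun i => SU2.haar (s i)) (Finset.mem_univ e)]
  simp only [Function.update_self, measure_univ, one_mul]
  rw [mul_comm]
  congr 1
  refine Finset.prod_congr rfl fun i hi => ?_
  rw [Function.update_of_ne (Finset.ne_of_mem_erase hi)]

theorem integral_eq_integral_update (e : E) {f : (E → SU2) → ℂ} (hf : Continuous f) :
    ∫ g, f g ∂(Measure.pi fun _ : E => SU2.haar) =
      ∫ g, ∫ u, f (Function.update g e u) ∂SU2.haar ∂(Measure.pi fun _ : E => SU2.haar) := by
  have h := measurePreserving_update e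
  conv_lhs => rw [← h.map_eq]
  rw [integral_map h.measurable.aemeasurable hf.aestronglyMeasurable]
  refine integral_prod (fun q : (E → SU2) × SU2 => f (Function.update q.1 e q.2)) ?_
  have hc : Continuous fun q : (E → SU2) × SU2 => f (Function.update q.1 e q.2) :=
    hf.comp (continuous_fst.update e continuous_snd)
  exact hc.integrable_of_hasCompactSupport (HasCompactSupport.of_compactSpace _)

end Resampling

namespace SpinGraph

variable {q : ℕ} (G : SpinGraph q) {k : ℕ}

/-- The factor of an edge that carries the matrix `R` instead of a holonomy. -/
def matFactor (B : LegTensor (Fin 2) k) (R : Qudit k → Qudit k → ℂ) (x : G.V × Fin q → Qudit k)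
    (b : G.Free → Qudit k) (e : G.E) : ℂ :=
  match h : G.finish e with
  | some y => ∑ s : Qudit k, B ![s, x y] * R s (x (G.start e))
  | none => R (b ⟨e, by simp [h]⟩) (x (G.start e))

/-- The tensor network with arbitrary matrices in place of the holonomies. -/
noncomputable def netAmp (A : LegTensor (Fin q) k) (B : LegTensor (Fin 2) k)
    (R : G.E → Qudit k → Qudit k → ℂ) (b : G.Free → Qudit k) : ℂ :=
  ∑ x : G.V × Fin q → Qudit k, (∏ v, A fun i => x (v, i)) * ∏ e, G.matFactor B (R e) x b e

variable {G}

theorem matFactor_some {B : LegTensor (Fin 2) k} {R : Qudit k → Qudit k → ℂ}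
    {x : G.V × Fin q → Qudit k} {b : G.Free → Qudit k} {e : G.E} {y : G.V × Fin q}
    (h : G.finish e = some y) :
    G.matFactor B R x b e = ∑ s : Qudit k, B ![s, x y] * R s (x (G.start e)) := by
  unfold matFactor
  split
  · next h' => rw [h] at h'; cases h'; rfl
  · next h' => rw [h] at h'; cases h'

theorem matFactor_none {B : LegTensor (Fin 2) k} {R : Qudit k → Qudit k → ℂ}
    {x : G.V × Fin q → Qudit k} {b : G.Free → Qudit k} {e : G.E} (h : G.finish e = none) :
    G.matFactor B R x b e = R (b ⟨e, by simp [h]⟩) (x (G.start e)) := by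
  unfold matFactor
  split
  · next h' => rw [h] at h'; cases h'
  · rfl

theorem amplitude_eq_netAmp (A : LegTensor (Fin q) k) (B : LegTensor (Fin 2) k) (g : G.E → SU2)
    (b : G.Free → Qudit k) :
    G.amplitude A B g b = G.netAmp A B (fun e => strandRep (g e)) b := by
  unfold amplitude netAmp
  refine Finset.sum_congr rfl fun x _ => congrArg _ (Finset.prod_congr rfl fun e _ => ?_)
  unfold edgeFactor
  split
  · next h => rw [matFactor_some h]
  · next h => rw [matFactor_none h]

theorem netAmp_update (A : LegTensor (Fin q) k) (B : LegTensor (Fin 2) k)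
    (R : G.E → Qudit k → Qudit k → ℂ) (e : G.E) (X : Qudit k → Qudit k → ℂ)
    (b : G.Free → Qudit k) :
    G.netAmp A B (Function.update R e X) b = ∑ x : G.V × Fin q → Qudit k,
      ((∏ v, A fun i => x (v, i)) * ∏ e' ∈ Finset.univ.erase e, G.matFactor B (R e') x b e') *
        G.matFactor B X x b e := by
  unfold netAmp
  refine Finset.sum_congr rfl fun x _ => ?_
  rw [← Finset.mul_prod_erase _ _ (Finset.mem_univ e), Function.update_self, mul_assoc,
    mul_comm (G.matFactor B X x b e)]
  congr 2
  refine Finset.prod_congr rfl fun i hi => ?_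
  rw [Function.update_of_ne (Finset.ne_of_mem_erase hi)]

/-- The boundary state of the tensor network as a function of the matrix inserted on the edge `e`,
the other edges carrying the holonomies `g`. -/
noncomputable def insertion (A : LegTensor (Fin q) k) (B : LegTensor (Fin 2) k)
    (e : G.E) (g : G.E → SU2) :
    EuclideanSpace ℂ (Qudit k × Qudit k) →ₗ[ℂ] G.Boundary k where
  toFun X := WithLp.toLp 2 fun b =>
    G.netAmp A B (Function.update (fun e => strandRep (g e)) e fun s t => X (s, t)) b
  map_add' X Y := by
    ext b
    simp only [netAmp_update, PiLp.add_apply, ← Finset.sum_add_distrib, ← mul_add]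
    refine Finset.sum_congr rfl fun x _ => congrArg _ ?_
    cases h : G.finish e with
    | none => simp [matFactor_none h]
    | some y => simp [matFactor_some h, mul_add, Finset.sum_add_distrib]
  map_smul' c X := by
    ext b
    simp only [netAmp_update, PiLp.smul_apply, smul_eq_mul, Finset.mul_sum, RingHom.id_apply]
    refine Finset.sum_congr rfl fun x _ => ?_
    rw [mul_left_comm]
    refine congrArg _ ?_
    cases h : G.finish e with
    | none => simp [matFactor_none h]
    | some y => simp [matFactor_some h, Finset.mul_sum, mul_left_comm]

theorem insertion_apply (A : LegTensor (Fin q) k) (B : LegTensor (Fin 2) k)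
    (e : G.E) (g : G.E → SU2) (X : EuclideanSpace ℂ (Qudit k × Qudit k)) (b : G.Free → Qudit k) :
    insertion A B e g X b =
      G.netAmp A B (Function.update (fun e => strandRep (g e)) e fun s t => X (s, t)) b := rfl

theorem insertion_update (A : LegTensor (Fin q) k) (B : LegTensor (Fin 2) k)
    (e : G.E) (g : G.E → SU2) (u : SU2) :
    insertion A B e (Function.update g e u) = insertion A B e g := by
  refine LinearMap.ext fun X => ?_
  ext b
  rw [insertion_apply, insertion_apply]
  congr 1
  funext e'
  by_cases h : e' = e
  · subst h; simp
  · simp [Function.update_of_ne h]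

/-- The boundary state is, up to the positive factor `c`, an isometric function of the matrix
inserted on the edge `e`. In other words, the two ends of the cut edge `e` are maximally entangled
with the boundary. -/
def IsIsometricAt (A : LegTensor (Fin q) k) (B : LegTensor (Fin 2) k) (e : G.E) (c : ℝ) : Prop :=
  0 < c ∧ ∀ (g : G.E → SU2) (X : EuclideanSpace ℂ (Qudit k × Qudit k)),
    ‖insertion A B e g X‖ ^ 2 = c * ‖X‖ ^ 2

theorem IsIsometricAt.inner_insertion {A : LegTensor (Fin q) k} {B : LegTensor (Fin 2) k} {e : G.E}
    {c : ℝ} (h : IsIsometricAt A B e c) (g : G.E → SU2)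
    (X Y : EuclideanSpace ℂ (Qudit k × Qudit k)) :
    inner ℂ (insertion A B e g X) (insertion A B e g Y) = c * inner ℂ X Y := by
  have hs : 0 < Real.sqrt c := Real.sqrt_pos.2 h.1
  let T : EuclideanSpace ℂ (Qudit k × Qudit k) →ₗᵢ[ℂ] G.Boundary k :=
    { toLinearMap := ((Real.sqrt c : ℂ)⁻¹) • insertion A B e g
      norm_map' := fun X => by
        rw [LinearMap.smul_apply, norm_smul, norm_inv, Complex.norm_real, Real.norm_of_nonneg hs.le,
          inv_mul_eq_iff_eq_mul₀ hs.ne', ← sq_eq_sq₀ (norm_nonneg _) (by positivity), mul_pow,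
          Real.sq_sqrt h.1.le, h.2 g X] }
  have h1 := T.inner_map_map X Y
  change inner ℂ (((Real.sqrt c : ℂ)⁻¹) • insertion A B e g X)
    (((Real.sqrt c : ℂ)⁻¹) • insertion A B e g Y) = _ at h1
  have hc : (c : ℂ) = (Real.sqrt c : ℂ) * Real.sqrt c := by
    rw [← Complex.ofReal_mul, Real.mul_self_sqrt h.1.le]
  have hs' : (Real.sqrt c : ℂ) ≠ 0 := Complex.ofReal_ne_zero.2 hs.ne'
  rw [inner_smul_left, inner_smul_right, map_inv₀, Complex.conj_ofReal] at h1
  rw [← h1, hc]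
  field_simp

theorem continuous_insertion (A : LegTensor (Fin q) k) (B : LegTensor (Fin 2) k) (e : G.E)
    {p : SU2 → Qudit k → Qudit k → ℂ} (hp : ∀ a b, Continuous fun u => p u a b) :
    Continuous fun g : G.E → SU2 => insertion A B e g (WithLp.toLp 2 fun ab => p (g e) ab.1 ab.2) := by
  refine (PiLp.continuous_toLp 2 _).comp (continuous_pi fun b => ?_)
  unfold netAmp
  refine continuous_finsetSum _ fun x _ => continuous_const.mul
    (continuous_finsetProd _ fun e' _ => ?_)
  have hR : ∀ a b, Continuous fun g : G.E → SU2 =>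
      Function.update (fun e => strandRep (g e)) e (fun s t => p (g e) s t) e' a b := by
    intro a b
    by_cases h : e' = e
    · subst h; simpa [Function.comp_def] using (hp a b).comp (continuous_apply e')
    · simpa [Function.update_of_ne h, Function.comp_def] using
        (continuous_strandRep a b).comp (continuous_apply e')
  cases h : G.finish e' with
  | none => simpa only [matFactor_none h] using hR _ _
  | some y =>
    simp only [matFactor_some h]
    exact continuous_finsetSum _ fun s _ => continuous_const.mul (hR _ _)

theorem inner_embed (f f' : C(G.E → SU2, G.Boundary k)) :
    inner ℂ (G.embed k f) (G.embed k f') =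
      ∫ g, inner ℂ (f g) (f' g) ∂(Measure.pi fun _ : G.E => SU2.haar) := by
  rw [L2.inner_def]
  apply integral_congr_ae
  filter_upwards [ContinuousMap.coeFn_toLp (p := 2) (𝕜 := ℂ) (Measure.pi fun _ : G.E => SU2.haar) f,
    ContinuousMap.coeFn_toLp (p := 2) (𝕜 := ℂ) (Measure.pi fun _ : G.E => SU2.haar) f']
    with g h h'
  rw [embed, h, h']

theorem integral_comp_eval (e : G.E) {f : SU2 → ℂ} (hf : Continuous f) :
    ∫ g, f (g e) ∂(Measure.pi fun _ : G.E => SU2.haar) = ∫ u, f u ∂SU2.haar := by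
  have h := measurePreserving_eval (fun _ : G.E => SU2.haar) e
  rw [← integral_map (φ := fun g : G.E → SU2 => g e) h.measurable.aemeasurable
    hf.aestronglyMeasurable]
  rw [show Measure.map (fun g : G.E → SU2 => g e) (Measure.pi fun _ : G.E => SU2.haar) = SU2.haar
    from h.map_eq]

/-- The network with its spin-`n/2` component on the edge `e`. -/
noncomputable def spinWave (A : LegTensor (Fin q) k) (B : LegTensor (Fin 2) k) (e : G.E) (n : ℕ) :
    C(G.E → SU2, G.Boundary k) :=
  ⟨fun g => insertion A B e g (WithLp.toLp 2 fun ab => spinComponent n (g e) ab.1 ab.2),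
    continuous_insertion A B e (continuous_spinComponent n)⟩

theorem wave_apply (A : LegTensor (Fin q) k) (B : LegTensor (Fin 2) k) (e : G.E) (g : G.E → SU2) :
    G.wave A B g = insertion A B e g (WithLp.toLp 2 fun ab => strandRep (g e) ab.1 ab.2) := by
  ext b
  rw [insertion_apply]
  refine (amplitude_eq_netAmp A B g b).trans ?_
  congr 1
  exact (Function.update_eq_self e (fun e => strandRep (g e))).symm

theorem insertion_eq_sum (A : LegTensor (Fin q) k) (B : LegTensor (Fin 2) k) (e : G.E)
    (g : G.E → SU2) (X : EuclideanSpace ℂ (Qudit k × Qudit k)) (b : G.Free → Qudit k) :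
    insertion A B e g X b = ∑ ab, X ab * insertion A B e g (EuclideanSpace.single ab 1) b := by
  conv_lhs => rw [← (EuclideanSpace.basisFun (Qudit k × Qudit k) ℂ).sum_repr X]
  simp [map_sum, EuclideanSpace.basisFun_apply]

theorem spinWave_mem (A : LegTensor (Fin q) k) (B : LegTensor (Fin 2) k) (e : G.E) (n : ℕ) :
    spinWave A B e n ∈ G.spinFunctions k n e := by
  intro g b
  have : (fun u => spinWave A B e n (Function.update g e u) b) =
      ∑ ab : Qudit k × Qudit k, insertion A B e g (EuclideanSpace.single ab 1) b •
        fun u => spinComponent n u ab.1 ab.2 := by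
    funext u
    change insertion A B e (Function.update g e u) _ b = _
    rw [insertion_update, insertion_eq_sum, Finset.sum_apply]
    refine Finset.sum_congr rfl fun ab _ => ?_
    simp [mul_comm]
  rw [this]
  exact Submodule.sum_mem _ fun ab _ => Submodule.smul_mem _ _ (spinComponent_mem n _ _)

/-- The projection of the state onto spin `n/2` on the edge `e` replaces the holonomy of this edge
by its spin component. -/
theorem spinProj_state (A : LegTensor (Fin q) k) (B : LegTensor (Fin 2) k) (e : G.E) (n : ℕ) :
    G.spinProj k n e (G.state A B) = G.embed k (spinWave A B e n) := by
  refine (Submodule.eq_starProjection_of_mem_orthogonal ?_ ?_)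
  · exact Submodule.le_topologicalClosure _ ⟨_, spinWave_mem A B e n, rfl⟩
  · unfold spinSubspace
    rw [Submodule.orthogonal_closure, Submodule.mem_orthogonal]
    rintro _ ⟨f, hf, rfl⟩
    rw [state, ← map_sub]
    refine (inner_embed f (G.wave A B - spinWave A B e n)).trans ?_
    rw [integral_eq_integral_update e]
    swap
    · exact f.continuous.inner (G.wave A B - spinWave A B e n).continuous
    refine integral_eq_zero_of_ae (Filter.Eventually.of_forall fun g => ?_)
    change ∫ u, _ ∂SU2.haar = 0
    have hval : ∀ u, inner ℂ (f (Function.update g e u))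
        ((G.wave A B - spinWave A B e n) (Function.update g e u)) =
        ∑ b, ∑ ab : Qudit k × Qudit k, insertion A B e g (EuclideanSpace.single ab 1) b *
          (conj (f (Function.update g e u) b) *
            (strandRep u ab.1 ab.2 - spinComponent n u ab.1 ab.2)) := by
      intro u
      rw [ContinuousMap.sub_apply, wave_apply A B e, show spinWave A B e n (Function.update g e u) =
        insertion A B e (Function.update g e u) (WithLp.toLp 2 fun ab =>
          spinComponent n (Function.update g e u e) ab.1 ab.2) from rfl, ← map_sub,
        insertion_update, PiLp.inner_apply]
      refine Finset.sum_congr rfl fun b _ => ?_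
      rw [RCLike.inner_apply, insertion_eq_sum, Finset.sum_mul]
      refine Finset.sum_congr rfl fun ab _ => ?_
      simp only [Function.update_self, PiLp.sub_apply]
      ring
    simp only [hval]
    have hfc : ∀ b, Continuous fun u => f (Function.update g e u) b := fun b =>
      continuous_of_mem_matrixElements (hf g b)
    have hcont : ∀ b (ab : Qudit k × Qudit k), Continuous fun u =>
        insertion A B e g (EuclideanSpace.single ab 1) b * (conj (f (Function.update g e u) b) *
            (strandRep u ab.1 ab.2 - spinComponent n u ab.1 ab.2)) := fun b ab =>
      continuous_const.mul ((Complex.continuous_conj.comp (hfc b)).mul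
        ((continuous_strandRep _ _).sub (continuous_spinComponent _ _ _)))
    rw [integral_finsetSum _ fun b _ => integrable_of_continuous
      (continuous_finsetSum _ fun ab _ => hcont b ab)]
    refine Finset.sum_eq_zero fun b _ => ?_
    rw [integral_finsetSum _ fun ab _ => integrable_of_continuous (hcont b ab)]
    refine Finset.sum_eq_zero fun ab _ => ?_
    rw [integral_const_mul, integral_conj_mul_strandRep_sub_spinComponent ab.1 ab.2 (hf g b),
      mul_zero]

theorem spinProj_state_eq_zero (A : LegTensor (Fin q) k) (B : LegTensor (Fin 2) k) (e : G.E) {n : ℕ}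
    (hkn : k < n) : G.spinProj k n e (G.state A B) = 0 := by
  rw [spinProj_state]
  have : spinWave A B e n = 0 := by
    ext g : 1
    change insertion A B e g _ = 0
    simp only [spinComponent_eq_zero hkn]
    exact map_zero (insertion A B e g)
  rw [this, map_zero]

/-- The overlap of `u^{⊗k}` with its spin-`n/2` component, i.e. the dimension of the spin-`n/2` part
of `(ℂ²)^{⊗k}`. -/
noncomputable def spinOverlap (k n : ℕ) : ℂ :=
  ∑ ab : Qudit k × Qudit k,
    ∫ u : SU2, conj (strandRep u ab.1 ab.2) * spinComponent n u ab.1 ab.2 ∂SU2.haar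

theorem IsIsometricAt.inner_spinProj {A : LegTensor (Fin q) k} {B : LegTensor (Fin 2) k} {e : G.E}
    {c : ℝ} (h : IsIsometricAt A B e c) (n : ℕ) :
    inner ℂ (G.state A B) (G.spinProj k n e (G.state A B)) = c * spinOverlap k n := by
  rw [spinProj_state, state, inner_embed]
  have hval : ∀ g, inner ℂ (G.wave A B g) (spinWave A B e n g) =
      (fun u : SU2 => (c : ℂ) * ∑ ab : Qudit k × Qudit k,
        conj (strandRep u ab.1 ab.2) * spinComponent n u ab.1 ab.2) (g e) := by
    intro g
    rw [wave_apply A B e, spinWave, ContinuousMap.coe_mk, h.inner_insertion, PiLp.inner_apply]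
    simp [mul_comm]
  have hcont : ∀ ab : Qudit k × Qudit k, Continuous fun u : SU2 =>
      conj (strandRep u ab.1 ab.2) * spinComponent n u ab.1 ab.2 := fun ab =>
    (Complex.continuous_conj.comp (continuous_strandRep _ _)).mul (continuous_spinComponent _ _ _)
  simp only [hval]
  rw [integral_comp_eval e (f := fun u : SU2 => (c : ℂ) * ∑ ab : Qudit k × Qudit k,
    conj (strandRep u ab.1 ab.2) * spinComponent n u ab.1 ab.2)
    (continuous_const.mul (continuous_finsetSum _ fun ab _ => hcont ab)), integral_const_mul, integral_finsetSum _ fun ab _ => integrable_of_continuous (hcont ab)]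
  rfl

theorem IsIsometricAt.norm_state_sq {A : LegTensor (Fin q) k} {B : LegTensor (Fin 2) k} {e : G.E}
    {c : ℝ} (h : IsIsometricAt A B e c) : ‖G.state A B‖ ^ 2 = c * 2 ^ k := by
  have h1 : inner ℂ (G.state A B) (G.state A B) = ((c * 2 ^ k : ℝ) : ℂ) := by
    rw [state, inner_embed]
    have hval : ∀ g, inner ℂ (G.wave A B g) (G.wave A B g) = ((c * 2 ^ k : ℝ) : ℂ) := by
      intro g
      rw [wave_apply A B e, h.inner_insertion, PiLp.inner_apply]
      simp only [RCLike.inner_apply, Fintype.sum_prod_type]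
      rw [Finset.sum_comm]
      have := fun b => sum_conj_strandRep (g e) (k := k) b b
      simp only [if_true, mul_comm (conj _)] at this
      simp [this]
    simp only [hval]
    simp
  rw [@norm_sq_eq_re_inner ℂ, h1]
  exact Complex.ofReal_re _

end SpinGraph

/-! ### Contractions of functions of finitely many indices -/

namespace WireNet

section Basic

variable {W Y M : Type*}

/-- The value of `F` does not depend on the indices at the places in `S`. -/
def IndepOf (S : Set W) (F : (W → Y) → M) : Prop :=
  ∀ z z' : W → Y, (∀ w, w ∉ S → z w = z' w) → F z = F z'

theorem IndepOf.mono {S T : Set W} {F : (W → Y) → M} (h : IndepOf T F) (hST : S ⊆ T) :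
    IndepOf S F := fun z z' hz => h z z' fun w hw => hz w fun hS => hw (hST hS)

variable [DecidableEq W]

theorem IndepOf.update {S : Set W} {F : (W → Y) → M} (h : IndepOf S F) {w : W} (hw : w ∈ S)
    (z : W → Y) (y : Y) : F (Function.update z w y) = F z :=
  h _ _ fun w' hw' => Function.update_of_ne (fun h' => hw' (by rw [h']; exact hw)) _ _

/-- Replace the indices at four places. -/
def put (z : W → Y) (w₁ w₂ w₃ w₄ : W) (a b c d : Y) : W → Y :=
  Function.update (Function.update (Function.update (Function.update z w₁ a) w₂ b) w₃ c) w₄ d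

theorem put_swap₁₃ (z : W → Y) {w₁ w₂ w₃ w₄ : W} (h₁₂ : w₁ ≠ w₂) (h₁₃ : w₁ ≠ w₃) (h₂₃ : w₂ ≠ w₃)
    (a b c d : Y) : put z w₁ w₂ w₃ w₄ a b c d = put z w₃ w₂ w₁ w₄ c b a d := by
  unfold put
  rw [Function.update_comm h₂₃, Function.update_comm h₁₃, Function.update_comm h₁₂]

theorem put_swap₂₄ (z : W → Y) {w₁ w₂ w₃ w₄ : W} (h₂₃ : w₂ ≠ w₃) (h₂₄ : w₂ ≠ w₄) (h₃₄ : w₃ ≠ w₄)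
    (a b c d : Y) : put z w₁ w₂ w₃ w₄ a b c d = put z w₁ w₄ w₃ w₂ a d c b := by
  unfold put
  rw [Function.update_comm h₃₄, Function.update_comm h₂₄, Function.update_comm h₂₃]

theorem put_apply_of_ne (z : W → Y) {w₁ w₂ w₃ w₄ w : W} (h₁ : w ≠ w₁) (h₂ : w ≠ w₂) (h₃ : w ≠ w₃)
    (h₄ : w ≠ w₄) (a b c d : Y) : put z w₁ w₂ w₃ w₄ a b c d w = z w := by
  simp [put, Function.update_of_ne h₁, Function.update_of_ne h₂, Function.update_of_ne h₃,
    Function.update_of_ne h₄]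

variable [Fintype Y]

/-- Contract the indices of `F` at four places with `β`; the result is regarded as a function of all
indices which does not depend on the contracted ones. -/
def contract (w₁ w₂ w₃ w₄ : W) (β : Y → Y → Y → Y → ℂ) (F : (W → Y) → ℂ) (z : W → Y) : ℂ :=
  ∑ a, ∑ b, ∑ c, ∑ d, β a b c d * F (put z w₁ w₂ w₃ w₄ a b c d)

theorem contract_swap₁₃ {w₁ w₂ w₃ w₄ : W} (h₁₂ : w₁ ≠ w₂) (h₁₃ : w₁ ≠ w₃) (h₂₃ : w₂ ≠ w₃)
    (β : Y → Y → Y → Y → ℂ) (F : (W → Y) → ℂ) :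
    contract w₁ w₂ w₃ w₄ β F = contract w₃ w₂ w₁ w₄ (fun c b a d => β a b c d) F := by
  funext z
  unfold contract
  simp only [put_swap₁₃ z h₁₂ h₁₃ h₂₃]
  rw [Finset.sum_comm]
  conv_rhs => rw [Finset.sum_comm]
  refine Finset.sum_congr rfl fun b _ => ?_
  rw [Finset.sum_comm]

theorem contract_swap₂₄ {w₁ w₂ w₃ w₄ : W} (h₂₃ : w₂ ≠ w₃) (h₂₄ : w₂ ≠ w₄) (h₃₄ : w₃ ≠ w₄)
    (β : Y → Y → Y → Y → ℂ) (F : (W → Y) → ℂ) :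
    contract w₁ w₂ w₃ w₄ β F = contract w₁ w₄ w₃ w₂ (fun a d c b => β a b c d) F := by
  funext z
  unfold contract
  simp only [put_swap₂₄ z h₂₃ h₂₄ h₃₄]
  refine Finset.sum_congr rfl fun a _ => ?_
  rw [Finset.sum_comm]
  conv_rhs => rw [Finset.sum_comm]
  refine Finset.sum_congr rfl fun c _ => ?_
  rw [Finset.sum_comm]

theorem indepOf_contract {S : Set W} {w₁ w₂ w₃ w₄ : W} {β : Y → Y → Y → Y → ℂ} {F : (W → Y) → ℂ}
    (hF : IndepOf S F) : IndepOf (S ∪ {w₁, w₂, w₃, w₄}) (contract w₁ w₂ w₃ w₄ β F) := by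
  intro z z' hz
  unfold contract
  refine Finset.sum_congr rfl fun a _ => Finset.sum_congr rfl fun b _ =>
    Finset.sum_congr rfl fun c _ => Finset.sum_congr rfl fun d _ => congrArg _ (hF _ _ fun w hw => ?_)
  simp only [put, Function.update_apply]
  split_ifs with h4 h3 h2 h1 <;> try rfl
  exact hz w (by simp [hw, h1, h2, h3, h4])

variable [Fintype W]

theorem sum_update [AddCommMonoid M] (w : W) (f : (W → Y) → M) :
    ∑ z, ∑ y, f (Function.update z w y) = Fintype.card Y • ∑ z, f z := by
  rw [← Fintype.sum_prod_type']
  have hinv : Function.Involutive fun p : (W → Y) × Y => (Function.update p.1 w p.2, p.1 w) := by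
    rintro ⟨z, y⟩
    simp
  rw [Fintype.sum_equiv hinv.toPerm (fun p : (W → Y) × Y => f (Function.update p.1 w p.2))
    (fun p => f p.1) fun p => rfl, Fintype.sum_prod_type]
  simp [Finset.smul_sum]

theorem sum_update_real (w : W) (f : (W → Y) → ℝ) :
    ∑ z, ∑ y, f (Function.update z w y) = Fintype.card Y * ∑ z, f z := by
  rw [sum_update, nsmul_eq_mul]

theorem sum_update_complex (w : W) (f : (W → Y) → ℂ) :
    ∑ z, ∑ y, f (Function.update z w y) = Fintype.card Y * ∑ z, f z := by
  rw [sum_update, nsmul_eq_mul]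

/-- `E` is `√c` times an isometry from its first to its second index. -/
def IsIso (c : ℝ) (E : Y → Y → ℂ) : Prop :=
  ∀ v : Y → ℂ, ∑ p, ‖∑ o, E o p * v o‖ ^ 2 = c * ∑ o, ‖v o‖ ^ 2

/-- `β` is `√c` times an isometry from its first two to its last two indices. -/
def IsIso₂ (c : ℝ) (β : Y → Y → Y → Y → ℂ) : Prop :=
  ∀ v : Y → Y → ℂ, ∑ o₁, ∑ o₂, ‖∑ i₁, ∑ i₂, β i₁ i₂ o₁ o₂ * v i₁ i₂‖ ^ 2 =
    c * ∑ i₁, ∑ i₂, ‖v i₁ i₂‖ ^ 2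

/-- Summing over the free far end `p` of a wire makes the sum over its near end incoherent. -/
theorem sum_norm_sq_wire {c : ℝ} {E : Y → Y → ℂ} (hE : IsIso c E) {p : W} {H : Y → (W → Y) → ℂ}
    (hH : ∀ o, IndepOf {p} (H o)) :
    Fintype.card Y * ∑ z, ‖∑ o, E o (z p) * H o z‖ ^ 2 = c * ∑ z, ∑ o, ‖H o z‖ ^ 2 := by
  rw [← sum_update_real p, Finset.mul_sum]
  refine Finset.sum_congr rfl fun z _ => ?_
  simp only [Function.update_self, fun o y => (hH o).update (Set.mem_singleton p) z y]
  exact hE _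

theorem sum_norm_sq_two_wires {c₁ c₂ : ℝ} {E₁ E₂ : Y → Y → ℂ} (h₁ : IsIso c₁ E₁) (h₂ : IsIso c₂ E₂)
    {p₁ p₂ : W} (hp : p₁ ≠ p₂) {H : Y → Y → (W → Y) → ℂ}
    (hH : ∀ o₁ o₂, IndepOf {p₁, p₂} (H o₁ o₂)) :
    Fintype.card Y ^ 2 * ∑ z, ‖∑ o₁, ∑ o₂, E₁ o₁ (z p₁) * E₂ o₂ (z p₂) * H o₁ o₂ z‖ ^ 2 =
      c₁ * c₂ * ∑ z, ∑ o₁, ∑ o₂, ‖H o₁ o₂ z‖ ^ 2 := by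
  simp only [mul_assoc, ← Finset.mul_sum]
  rw [pow_two, mul_assoc, sum_norm_sq_wire h₁ (p := p₁)
    (H := fun o₁ z => ∑ o₂, E₂ o₂ (z p₂) * H o₁ o₂ z)]
  · rw [Finset.sum_comm, mul_left_comm, Finset.mul_sum]
    rw [Finset.sum_congr rfl fun o₁ _ => sum_norm_sq_wire h₂ (p := p₂) (H := H o₁)
      fun o => (hH o₁ o).mono (by simp)]
    rw [← Finset.mul_sum, Finset.sum_comm]
  · intro o₁ z z' hz
    refine Finset.sum_congr rfl fun o₂ _ => ?_
    rw [hz p₂ (by simpa using hp.symm), (hH o₁ o₂).mono (by simp) z z' hz]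

/-- Two wires whose near ends are not contracted. -/
theorem sum_norm_sq_two_free_wires {c₁ c₂ : ℝ} {E₁ E₂ : Y → Y → ℂ} (h₁ : IsIso c₁ E₁)
    (h₂ : IsIso c₂ E₂) {o₁ o₂ p₁ p₂ : W} (hp : p₁ ≠ p₂) (h11 : o₁ ≠ p₁) (h12 : o₁ ≠ p₂)
    (h21 : o₂ ≠ p₁) (h22 : o₂ ≠ p₂) {F : (W → Y) → ℂ} (hF : IndepOf {p₁, p₂} F) :
    Fintype.card Y ^ 2 * ∑ z, ‖E₁ (z o₁) (z p₁) * E₂ (z o₂) (z p₂) * F z‖ ^ 2 =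
      c₁ * c₂ * ∑ z, ‖F z‖ ^ 2 := by
  classical
  have h := sum_norm_sq_two_wires h₁ h₂ hp
    (H := fun a b z => if a = z o₁ then if b = z o₂ then F z else 0 else 0) ?_
  · simp only [mul_ite, mul_zero] at h
    rw [← Finset.sum_congr rfl fun z _ => ?_] at h
    · rw [h]
      congr 1
      refine Finset.sum_congr rfl fun z _ => ?_
      rw [Finset.sum_eq_single (z o₁) (by intro b _ hb; simp [hb]) (by simp),
        Finset.sum_eq_single (z o₂) (by intro b _ hb; simp [hb]) (by simp)]
      simp
    · rw [Finset.sum_eq_single (z o₁) (by intro b _ hb; simp [hb]) (by simp),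
        Finset.sum_eq_single (z o₂) (by intro b _ hb; simp [hb]) (by simp)]
      simp
  · intro a b z z' hz
    have e1 : z o₁ = z' o₁ := hz _ (by simp [h11, h12])
    have e2 : z o₂ = z' o₂ := hz _ (by simp [h21, h22])
    simp only [e1, e2, hF z z' hz]

theorem sum_put (w₁ w₂ w₃ w₄ : W) (f : (W → Y) → ℂ) :
    ∑ z, ∑ a, ∑ b, ∑ c, ∑ d, f (put z w₁ w₂ w₃ w₄ a b c d) = Fintype.card Y ^ 4 * ∑ z, f z := by
  unfold put
  rw [sum_update_complex w₁ fun z => ∑ b, ∑ c, ∑ d,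
    f (Function.update (Function.update (Function.update z w₂ b) w₃ c) w₄ d),
    sum_update_complex w₂ fun z => ∑ c, ∑ d, f (Function.update (Function.update z w₃ c) w₄ d),
    sum_update_complex w₃ fun z => ∑ d, f (Function.update z w₄ d), sum_update_complex w₄]
  ring

theorem sum_contract_mul {w₁ w₂ w₃ w₄ : W} (h₁₂ : w₁ ≠ w₂) (h₁₃ : w₁ ≠ w₃) (h₁₄ : w₁ ≠ w₄)
    (h₂₃ : w₂ ≠ w₃) (h₂₄ : w₂ ≠ w₄) (h₃₄ : w₃ ≠ w₄) (β : Y → Y → Y → Y → ℂ) (F : (W → Y) → ℂ)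
    {G : (W → Y) → ℂ} (hG : IndepOf {w₁, w₂, w₃, w₄} G) :
    ∑ z, contract w₁ w₂ w₃ w₄ β F z * G z =
      Fintype.card Y ^ 4 * ∑ z, β (z w₁) (z w₂) (z w₃) (z w₄) * F z * G z := by
  rw [← sum_put w₁ w₂ w₃ w₄]
  refine Finset.sum_congr rfl fun z _ => ?_
  unfold contract
  simp only [Finset.sum_mul]
  refine Finset.sum_congr rfl fun a _ => Finset.sum_congr rfl fun b _ =>
    Finset.sum_congr rfl fun c _ => Finset.sum_congr rfl fun d _ => ?_
  have hG' : G (put z w₁ w₂ w₃ w₄ a b c d) = G z := by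
    refine hG _ _ fun w hw => ?_
    simp only [Set.mem_insert_iff, Set.mem_singleton_iff, not_or] at hw
    exact put_apply_of_ne z hw.1 hw.2.1 hw.2.2.1 hw.2.2.2 _ _ _ _
  rw [hG']
  simp [put, Function.update_of_ne h₁₂, Function.update_of_ne h₁₃, Function.update_of_ne h₁₄,
    Function.update_of_ne h₂₃, Function.update_of_ne h₂₄, Function.update_of_ne h₃₄]

/-- Contracting with a tensor `β` that is isometric from the places `i₁, i₂` to the places `o₁, o₂`
does not change the norm, up to a factor, if wires connect `o₁, o₂` with the free places `p₁, p₂`. -/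
theorem sum_norm_sq_contract {c c₁ c₂ : ℝ} {E₁ E₂ : Y → Y → ℂ} (h₁ : IsIso c₁ E₁)
    (h₂ : IsIso c₂ E₂) {i₁ i₂ o₁ o₂ p₁ p₂ : W}
    (hp : p₁ ≠ p₂) (ho : o₁ ≠ o₂) (h11 : o₁ ≠ p₁) (h12 : o₁ ≠ p₂) (h21 : o₂ ≠ p₁) (h22 : o₂ ≠ p₂)
    (hi1 : i₁ ≠ p₁) (hi1' : i₁ ≠ p₂) (hi2 : i₂ ≠ p₁) (hi2' : i₂ ≠ p₂)
    {β : Y → Y → Y → Y → ℂ} (hβ : IsIso₂ c β) {F F' : (W → Y) → ℂ}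
    (hF : ∀ z, F z = E₁ (z o₁) (z p₁) * E₂ (z o₂) (z p₂) * F' z)
    (hF' : IndepOf {o₁, p₁, o₂, p₂} F') :
    ∑ z, ‖contract i₁ i₂ o₁ o₂ β F z‖ ^ 2 = c * Fintype.card Y ^ 2 * ∑ z, ‖F z‖ ^ 2 := by
  by_cases hY : Fintype.card Y = 0
  · have hempty : IsEmpty Y := Fintype.card_eq_zero_iff.1 hY
    simp [contract]
  let G : Y → Y → (W → Y) → ℂ := fun a b z =>
    F' (Function.update (Function.update z i₁ a) i₂ b)
  have hctr : ∀ z, contract i₁ i₂ o₁ o₂ β F z =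
      ∑ o, ∑ o', E₁ o (z p₁) * E₂ o' (z p₂) * ∑ a, ∑ b, β a b o o' * G a b z := by
    intro z
    unfold contract
    have h : ∀ a b o o', β a b o o' * F (put z i₁ i₂ o₁ o₂ a b o o') =
        E₁ o (z p₁) * E₂ o' (z p₂) * (β a b o o' * G a b z) := by
      intro a b o o'
      rw [hF, put_apply_of_ne z hi1.symm hi2.symm h11.symm h21.symm,
        put_apply_of_ne z hi1'.symm hi2'.symm h12.symm h22.symm,
        show F' (put z i₁ i₂ o₁ o₂ a b o o') = G a b z from hF' _ _ fun w hw => by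
          simp only [Set.mem_insert_iff, Set.mem_singleton_iff, not_or] at hw
          simp [put, Function.update_of_ne hw.1, Function.update_of_ne hw.2.2.1]]
      simp only [put, Function.update_self, Function.update_of_ne ho]
      ring
    simp only [h, Finset.mul_sum]
    rw [Finset.sum_congr rfl fun a _ => Finset.sum_comm]
    rw [Finset.sum_comm]
    refine Finset.sum_congr rfl fun o _ => ?_
    rw [Finset.sum_congr rfl fun a _ => Finset.sum_comm]
    rw [Finset.sum_comm]
  have hA := sum_norm_sq_two_wires h₁ h₂ hp
    (H := fun o o' z => ∑ a, ∑ b, β a b o o' * G a b z) fun o o' z z' hz => by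
      refine Finset.sum_congr rfl fun a _ => Finset.sum_congr rfl fun b _ =>
        congrArg _ (hF' _ _ fun w hw => ?_)
      simp only [Set.mem_insert_iff, Set.mem_singleton_iff, not_or] at hw
      simp only [Function.update_apply]
      split_ifs <;> try rfl
      exact hz w (by simp [hw.2.1, hw.2.2.2])
  simp only [← hctr, hβ _] at hA
  have hB : ∑ z, c * ∑ a, ∑ b, ‖G a b z‖ ^ 2 = c * Fintype.card Y ^ 2 * ∑ z, ‖F' z‖ ^ 2 := by
    rw [← Finset.mul_sum, sum_update_real i₁ fun z => ∑ b, ‖F' (Function.update z i₂ b)‖ ^ 2,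
      sum_update_real i₂ fun z => ‖F' z‖ ^ 2]
    ring
  have hC := sum_norm_sq_two_free_wires h₁ h₂ hp h11 h12 h21 h22
    (hF'.mono (S := {p₁, p₂}) (by intro w hw; simp at hw ⊢; tauto))
  simp only [← hF] at hC
  rw [hB] at hA
  have hY' : (Fintype.card Y : ℝ) ^ 2 ≠ 0 := by positivity
  apply mul_left_cancel₀ hY'
  rw [hA]
  linear_combination -(c * Fintype.card Y ^ 2) * hC

/-- Contraction with an arbitrary tensor `v` whose four places are joined by wires to free places
multiplies the norm by that of `v`. -/
theorem sum_norm_sq_contract_four {c₁ c₂ c₃ c₄ : ℝ} {E₁ E₂ E₃ E₄ : Y → Y → ℂ} (h₁ : IsIso c₁ E₁)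
    (h₂ : IsIso c₂ E₂) (h₃ : IsIso c₃ E₃) (h₄ : IsIso c₄ E₄) {o₁ o₂ o₃ o₄ p₁ p₂ p₃ p₄ : W}
    (ho : [o₁, o₂, o₃, o₄, p₁, p₂, p₃, p₄].Nodup)
    (v : Y → Y → Y → Y → ℂ) {F F' : (W → Y) → ℂ}
    (hF : ∀ z, F z = E₁ (z o₁) (z p₁) * E₂ (z o₂) (z p₂) *
      (E₃ (z o₃) (z p₃) * E₄ (z o₄) (z p₄) * F' z))
    (hF' : IndepOf {o₁, p₁, o₂, p₂, o₃, p₃, o₄, p₄} F') :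
    ∑ z, ‖contract o₁ o₂ o₃ o₄ v F z‖ ^ 2 =
      (∑ a, ∑ b, ∑ c, ∑ d, ‖v a b c d‖ ^ 2) * ∑ z, ‖F z‖ ^ 2 := by
  by_cases hY : Fintype.card Y = 0
  · have hempty : IsEmpty Y := Fintype.card_eq_zero_iff.1 hY
    simp [contract]
  simp only [List.nodup_cons, List.mem_cons, List.not_mem_nil, or_false, not_or, List.nodup_nil,
    and_true] at ho
  obtain ⟨⟨n12, n13, n14, m11, m12, m13, m14⟩, ⟨n23, n24, m21, m22, m23, m24⟩,
    ⟨n34, m31, m32, m33, m34⟩, ⟨m41, m42, m43, m44⟩, ⟨k12, k13, k14⟩, ⟨k23, k24⟩, k34, -⟩ := ho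
  have hctr : ∀ z, contract o₁ o₂ o₃ o₄ v F z =
      ∑ a, ∑ b, E₁ a (z p₁) * E₂ b (z p₂) *
        ∑ c, ∑ d, E₃ c (z p₃) * E₄ d (z p₄) * (v a b c d * F' z) := by
    intro z
    unfold contract
    refine Finset.sum_congr rfl fun a _ => Finset.sum_congr rfl fun b _ => ?_
    simp only [Finset.mul_sum]
    refine Finset.sum_congr rfl fun c _ => Finset.sum_congr rfl fun d _ => ?_
    rw [hF, show F' (put z o₁ o₂ o₃ o₄ a b c d) = F' z from hF' _ _ fun w hw => by
      simp only [Set.mem_insert_iff, Set.mem_singleton_iff, not_or] at hw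
      exact put_apply_of_ne z (by tauto) (by tauto) (by tauto) (by tauto) _ _ _ _,
      put_apply_of_ne z (w := p₁) (Ne.symm m11) (Ne.symm m21) (Ne.symm m31) (Ne.symm m41),
      put_apply_of_ne z (w := p₂) (Ne.symm m12) (Ne.symm m22) (Ne.symm m32) (Ne.symm m42),
      put_apply_of_ne z (w := p₃) (Ne.symm m13) (Ne.symm m23) (Ne.symm m33) (Ne.symm m43),
      put_apply_of_ne z (w := p₄) (Ne.symm m14) (Ne.symm m24) (Ne.symm m34) (Ne.symm m44)]
    simp only [put, Function.update_self, Function.update_of_ne n12, Function.update_of_ne n13,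
      Function.update_of_ne n14, Function.update_of_ne n23, Function.update_of_ne n24,
      Function.update_of_ne n34]
    ring
  have hA := sum_norm_sq_two_wires h₁ h₂ k12
    (H := fun a b z => ∑ c, ∑ d, E₃ c (z p₃) * E₄ d (z p₄) * (v a b c d * F' z))
    fun a b z z' hz => by
      refine Finset.sum_congr rfl fun c _ => Finset.sum_congr rfl fun d _ => ?_
      rw [hz p₃ (by simp [Ne.symm k13, Ne.symm k23]), hz p₄ (by simp [Ne.symm k14, Ne.symm k24]),
        hF'.mono (S := {p₁, p₂}) (by intro w hw; simp at hw ⊢; tauto) z z' hz]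
  simp only [← hctr] at hA
  have hB : ∀ a b, Fintype.card Y ^ 2 *
      ∑ z, ‖∑ c, ∑ d, E₃ c (z p₃) * E₄ d (z p₄) * (v a b c d * F' z)‖ ^ 2 =
      c₃ * c₄ * ((∑ c, ∑ d, ‖v a b c d‖ ^ 2) * ∑ z, ‖F' z‖ ^ 2) := by
    intro a b
    rw [sum_norm_sq_two_wires h₃ h₄ k34 (H := fun c d z => v a b c d * F' z)
      fun c d z z' hz => by
        beta_reduce
        rw [hF'.mono (S := {p₃, p₄}) (by intro w hw; simp at hw ⊢; tauto) z z' hz]]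
    simp only [norm_mul, mul_pow, Finset.mul_sum, Finset.sum_mul]
  have hB' : Fintype.card Y ^ 2 *
      ∑ z, ∑ a, ∑ b, ‖∑ c, ∑ d, E₃ c (z p₃) * E₄ d (z p₄) * (v a b c d * F' z)‖ ^ 2 =
      c₃ * c₄ * ((∑ a, ∑ b, ∑ c, ∑ d, ‖v a b c d‖ ^ 2) * ∑ z, ‖F' z‖ ^ 2) := by
    rw [Finset.sum_comm, Finset.mul_sum, Finset.sum_mul, Finset.mul_sum]
    refine Finset.sum_congr rfl fun a _ => ?_
    rw [Finset.sum_comm, Finset.mul_sum, Finset.sum_mul, Finset.mul_sum]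
    exact Finset.sum_congr rfl fun b _ => hB a b
  have hC := sum_norm_sq_two_free_wires h₁ h₂ k12 m11 m12 m21 m22
    (F := fun z => E₃ (z o₃) (z p₃) * E₄ (z o₄) (z p₄) * F' z) fun z z' hz => by
      beta_reduce
      rw [hz p₃ (by simp [Ne.symm k13, Ne.symm k23]), hz p₄ (by simp [Ne.symm k14, Ne.symm k24]),
        hz o₃ (by simp [m31, m32]), hz o₄ (by simp [m41, m42]),
        hF'.mono (S := {p₁, p₂}) (by intro w hw; simp at hw ⊢; tauto) z z' hz]
  have hD := sum_norm_sq_two_free_wires h₃ h₄ k34 m33 m34 m43 m44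
    (hF'.mono (S := {p₃, p₄}) (by intro w hw; simp at hw ⊢; tauto))
  simp only [← hF] at hC
  have hY' : (Fintype.card Y : ℝ) ^ 4 ≠ 0 := by positivity
  apply mul_left_cancel₀ hY'
  linear_combination (Fintype.card Y : ℝ) ^ 2 * hA + c₁ * c₂ * hB' -
    (∑ a, ∑ b, ∑ c, ∑ d, ‖v a b c d‖ ^ 2) * ((Fintype.card Y : ℝ) ^ 2 * hC + c₁ * c₂ * hD)

/-- A matrix applied to two places that are joined by wires to free places multiplies the norm by
that of the matrix. -/
theorem sum_norm_sq_apply_matrix {c₁ c₂ : ℝ} {E₁ E₂ : Y → Y → ℂ} (h₁ : IsIso c₁ E₁)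
    (h₂ : IsIso c₂ E₂) {o₁ o₂ p₁ p₂ : W} (hp : p₁ ≠ p₂) (ho : o₁ ≠ o₂) (h11 : o₁ ≠ p₁)
    (h12 : o₁ ≠ p₂) (h21 : o₂ ≠ p₁) (h22 : o₂ ≠ p₂) (v : Y → Y → Y → Y → ℂ) {F F' : (W → Y) → ℂ}
    (hF : ∀ z, F z = E₁ (z o₁) (z p₁) * E₂ (z o₂) (z p₂) * F' z)
    (hF' : IndepOf {o₁, p₁, o₂, p₂} F') :
    Fintype.card Y ^ 2 * ∑ z, ‖∑ a, ∑ b, v (z o₁) (z o₂) a b *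
        F (Function.update (Function.update z o₁ a) o₂ b)‖ ^ 2 =
      (∑ a, ∑ b, ∑ c, ∑ d, ‖v a b c d‖ ^ 2) * ∑ z, ‖F z‖ ^ 2 := by
  by_cases hY : Fintype.card Y = 0
  · have hempty : IsEmpty Y := Fintype.card_eq_zero_iff.1 hY
    simp
  have hctr : ∀ z, (∑ a, ∑ b, v (z o₁) (z o₂) a b *
        F (Function.update (Function.update z o₁ a) o₂ b)) =
      ∑ a, ∑ b, E₁ a (z p₁) * E₂ b (z p₂) * (v (z o₁) (z o₂) a b * F' z) := by
    intro z
    refine Finset.sum_congr rfl fun a _ => Finset.sum_congr rfl fun b _ => ?_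
    rw [hF, show F' (Function.update (Function.update z o₁ a) o₂ b) = F' z from
      hF' _ _ fun w hw => by
        simp only [Set.mem_insert_iff, Set.mem_singleton_iff, not_or] at hw
        simp [Function.update_of_ne hw.1, Function.update_of_ne hw.2.2.1]]
    simp only [Function.update_self, Function.update_of_ne ho, Function.update_of_ne h11.symm,
      Function.update_of_ne h12.symm, Function.update_of_ne h21.symm, Function.update_of_ne h22.symm]
    ring
  have hA := sum_norm_sq_two_wires h₁ h₂ hp
    (H := fun a b z => v (z o₁) (z o₂) a b * F' z) fun a b z z' hz => by
      beta_reduce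
      rw [hz o₁ (by simp [h11, h12]), hz o₂ (by simp [h21, h22]),
        hF'.mono (S := {p₁, p₂}) (by intro w hw; simp at hw ⊢; tauto) z z' hz]
  simp only [← hctr] at hA
  have hB : Fintype.card Y ^ 2 * ∑ z, ∑ a, ∑ b, ‖v (z o₁) (z o₂) a b * F' z‖ ^ 2 =
      (∑ a, ∑ b, ∑ c, ∑ d, ‖v a b c d‖ ^ 2) * ∑ z, ‖F' z‖ ^ 2 := by
    have h3 : ∀ z : W → Y, ∑ x, ∑ y, (∑ a, ∑ b, ‖v x y a b * F' z‖ ^ 2) =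
        (∑ a, ∑ b, ∑ c, ∑ d, ‖v a b c d‖ ^ 2) * ‖F' z‖ ^ 2 := by
      intro z
      simp only [norm_mul, mul_pow, Finset.sum_mul]
    rw [Finset.mul_sum Finset.univ (fun z => ‖F' z‖ ^ 2), ← Finset.sum_congr rfl fun z _ => h3 z]
    have h4 := sum_update_real o₁ fun z => ∑ y, (∑ a, ∑ b,
      ‖v (z o₁) y a b * F' z‖ ^ 2)
    have h5 := sum_update_real o₂ fun z => (∑ a, ∑ b,
      ‖v (z o₁) (z o₂) a b * F' z‖ ^ 2)
    have h6 : ∀ z y, F' (Function.update z o₁ y) = F' z := fun z y => hF'.update (by simp) z y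
    have h7 : ∀ z y, F' (Function.update z o₂ y) = F' z := fun z y => hF'.update (by simp) z y
    simp only [Function.update_self, Function.update_of_ne ho, h6, h7] at h4 h5
    rw [h4, h5]
    ring
  have hC := sum_norm_sq_two_free_wires h₁ h₂ hp h11 h12 h21 h22
    (hF'.mono (S := {p₁, p₂}) (by intro w hw; simp at hw ⊢; tauto))
  simp only [← hF] at hC
  have hY' : (Fintype.card Y : ℝ) ^ 2 ≠ 0 := by positivity
  apply mul_left_cancel₀ hY'
  linear_combination (Fintype.card Y : ℝ) ^ 2 * hA + c₁ * c₂ * hB -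
    (∑ a, ∑ b, ∑ c, ∑ d, ‖v a b c d‖ ^ 2) * hC

end Basic

end WireNet

/-! ### Peeling off the edges of a network of wires -/

namespace WireNet

variable {H Y : Type*}

/-- `β`, with indices `bl br` at one end and `tl tr` at the other end of an edge, is dual-unitary: up
to the factor `√c` it is an isometry from either end to the other one, and also from the two places on
either side of the edge (the left one seen from one end and the right one seen from the other) to the
two places on the other side. -/
structure IsDual [Fintype Y] (c : ℝ) (β : Y → Y → Y → Y → ℂ) : Prop where
  start_finish : IsIso₂ c β
  right_left : IsIso₂ c fun tl br bl tr => β bl br tl tr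
  left_right : IsIso₂ c fun bl tr tl br => β bl br tl tr
  finish_start : IsIso₂ c fun tl tr bl br => β bl br tl tr

/-- The places at the half-edges in `S`; every half-edge `h` has a left place `(h, true)` and a right
place `(h, false)`. -/
def legs (S : Set H) : Set (H × Bool) := {w | w.1 ∈ S}

/-- The ends of the wires starting to the left of the half-edges in `K`. -/
def wireEnds (nxt : Equiv.Perm H) (K : Finset H) : Set (H × Bool) :=
  {w | ∃ h ∈ K, w = (h, true) ∨ w = (nxt h, false)}

/-- `F` is the product of the wires starting to the left of the half-edges in `K` and of a function
of the other indices. -/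
def HasWires (nxt : Equiv.Perm H) (E : H → Y → Y → ℂ) (K : Finset H) (F : (H × Bool → Y) → ℂ) :
    Prop :=
  ∃ F' : (H × Bool → Y) → ℂ, IndepOf (wireEnds nxt K) F' ∧
    ∀ z, F z = (∏ h ∈ K, E h (z (h, true)) (z (nxt h, false))) * F' z

theorem hasWires_prod [Fintype H] (nxt : Equiv.Perm H) (E : H → Y → Y → ℂ) (K : Finset H) :
    HasWires nxt E K fun z => ∏ h, E h (z (h, true)) (z (nxt h, false)) := by
  classical
  refine ⟨fun z => ∏ h ∈ Finset.univ \ K, E h (z (h, true)) (z (nxt h, false)), fun z z' hz => ?_,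
    fun z => ?_⟩
  · refine Finset.prod_congr rfl fun h hh => ?_
    have hK : h ∉ K := (Finset.mem_sdiff.1 hh).2
    rw [hz (h, true), hz (nxt h, false)]
    · rintro ⟨h', hK', h2 | h2⟩
      · simp at h2
      · have : nxt h = nxt h' := congrArg Prod.fst h2
        exact hK (by rwa [nxt.injective this])
    · rintro ⟨h', hK', h2 | h2⟩
      · have : h = h' := congrArg Prod.fst h2
        exact hK (by rwa [this])
      · simp at h2
  · rw [mul_comm]
    exact (Finset.prod_sdiff (Finset.subset_univ K)).symm

section Contract

variable [DecidableEq H] [Fintype Y]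

/-- Contract the half-edges `y` and `y'` with `β`. -/
def contractLegs (y y' : H) (β : Y → Y → Y → Y → ℂ) (F : (H × Bool → Y) → ℂ) :
    (H × Bool → Y) → ℂ :=
  contract (y, true) (y, false) (y', true) (y', false) β F

theorem HasWires.contractLegs {nxt : Equiv.Perm H} {E : H → Y → Y → ℂ} {K : Finset H}
    {F : (H × Bool → Y) → ℂ} (hF : HasWires nxt E K F) {y y' : H}
    (hK : Disjoint (wireEnds nxt K) (legs {y, y'})) (β : Y → Y → Y → Y → ℂ) :
    HasWires nxt E K (contractLegs y y' β F) := by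
  obtain ⟨F', hF', h⟩ := hF
  refine ⟨WireNet.contractLegs y y' β F',
    (indepOf_contract hF').mono Set.subset_union_left, fun z => ?_⟩
  have hne : ∀ w ∈ wireEnds nxt K, ∀ a b c d,
      put z (y, true) (y, false) (y', true) (y', false) a b c d w = z w := by
    intro w hw a b c d
    have h1 : w.1 ∉ ({y, y'} : Set H) := Set.disjoint_left.1 hK hw
    simp only [Set.mem_insert_iff, Set.mem_singleton_iff, not_or] at h1
    exact put_apply_of_ne z (fun h => h1.1 (by rw [h])) (fun h => h1.1 (by rw [h]))
      (fun h => h1.2 (by rw [h])) (fun h => h1.2 (by rw [h])) _ _ _ _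
  unfold WireNet.contractLegs contract
  simp only [h, Finset.mul_sum]
  refine Finset.sum_congr rfl fun a _ => Finset.sum_congr rfl fun b _ =>
    Finset.sum_congr rfl fun c _ => Finset.sum_congr rfl fun d _ => ?_
  rw [Finset.prod_congr rfl fun x hx => by
    rw [hne (x, true) ⟨x, hx, Or.inl rfl⟩, hne (nxt x, false) ⟨x, hx, Or.inr rfl⟩]]
  ring

variable [Fintype H]

/-- An edge can be removed if, on either side of it, one of the two wires leaving it leads to a free
half-edge. -/
theorem sum_norm_sq_contractLegs {nxt : Equiv.Perm H} {E : H → Y → Y → ℂ}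
    (hE : ∀ h, ∃ c, IsIso c (E h)) (hE' : ∀ h, ∃ c, IsIso c fun a b => E h b a) {c : ℝ}
    {β : Y → Y → Y → Y → ℂ} (hβ : IsDual c β) {y y' : H} (hyy : y ≠ y') {T : Set H}
    (hy : y ∉ T) (hy' : y' ∉ T) {F : (H × Bool → Y) → ℂ}
    (hF : ∀ K, Disjoint (wireEnds nxt K) (legs T) → HasWires nxt E K F)
    (hnext : nxt y ∉ insert y (insert y' T) ∨ nxt y' ∉ insert y (insert y' T))
    (hprev : nxt.symm y ∉ insert y (insert y' T) ∨ nxt.symm y' ∉ insert y (insert y' T)) :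
    ∑ z, ‖contractLegs y y' β F z‖ ^ 2 = c * Fintype.card Y ^ 2 * ∑ z, ‖F z‖ ^ 2 := by
  -- `a` and `b` are the half-edges from which the wires lead outwards, `a'` and `b'` the other ones
  have key : ∀ (a a' b b' : H) (β' : Y → Y → Y → Y → ℂ), (a = y ∧ a' = y' ∨ a = y' ∧ a' = y) →
      (b = y ∧ b' = y' ∨ b = y' ∧ b' = y) → nxt a ∉ insert y (insert y' T) →
      nxt.symm b ∉ insert y (insert y' T) → IsIso₂ c β' →
      ∑ z, ‖contract (a', true) (b', false) (a, true) (b, false) β' F z‖ ^ 2 =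
        c * Fintype.card Y ^ 2 * ∑ z, ‖F z‖ ^ 2 := by
    intro a a' b b' β' ha hb hna hpb hβ'
    simp only [Set.mem_insert_iff, not_or] at hna hpb
    have haT : a ∉ T := by rcases ha with h | h <;> rw [h.1] <;> assumption
    have hbT : b ∉ T := by rcases hb with h | h <;> rw [h.1] <;> assumption
    have hab : a ≠ nxt.symm b := by
      rcases ha with h | h <;> rw [h.1]
      · exact Ne.symm hpb.1
      · exact Ne.symm hpb.2.1
    obtain ⟨F', hF', hFF⟩ := hF {a, nxt.symm b} (by
      rw [Set.disjoint_left]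
      rintro w ⟨h, hh, hw⟩ hwT
      change w.1 ∈ T at hwT
      simp only [Finset.mem_insert, Finset.mem_singleton] at hh
      rcases hh with rfl | rfl <;> rcases hw with rfl | rfl
      · exact haT hwT
      · exact hna.2.2 hwT
      · exact hpb.2.2 hwT
      · exact hbT (by simpa using hwT))
    obtain ⟨c₁, h₁⟩ := hE a
    obtain ⟨c₂, h₂⟩ := hE' (nxt.symm b)
    have hab' : nxt a ≠ b := fun h => hab (by rw [← h]; simp)
    have haa : a ≠ a' := by
      rcases ha with h | h <;> rw [h.1, h.2]
      · exact hyy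
      · exact hyy.symm
    have hbb : b ≠ b' := by
      rcases hb with h | h <;> rw [h.1, h.2]
      · exact hyy
      · exact hyy.symm
    have h2 : b' ≠ nxt a := by
      rcases hb with h | h <;> rw [h.2]
      · exact Ne.symm hna.2.1
      · exact Ne.symm hna.1
    have h3 : a' ≠ nxt.symm b := by
      rcases ha with h | h <;> rw [h.2]
      · exact Ne.symm hpb.2.1
      · exact Ne.symm hpb.1
    refine sum_norm_sq_contract h₁ h₂ (p₁ := (nxt a, false)) (p₂ := (nxt.symm b, true)) (F' := F')
      (by simp) (by simp) (by simp) (by simpa using hab) (by simpa using Ne.symm hab') (by simp)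
      (by simp) (by simpa using h3) (by simpa using h2) (by simp) hβ' (fun z => ?_)
      (hF'.mono ?_)
    · rw [hFF, Finset.prod_pair hab]
      simp
    · intro w hw
      simp only [Set.mem_insert_iff, Set.mem_singleton_iff] at hw
      rcases hw with rfl | rfl | rfl | rfl
      · exact ⟨a, by simp, Or.inl rfl⟩
      · exact ⟨a, by simp, Or.inr rfl⟩
      · exact ⟨nxt.symm b, by simp, Or.inr (by simp)⟩
      · exact ⟨nxt.symm b, by simp, Or.inl rfl⟩
  have n1 : ((y, true) : H × Bool) ≠ (y, false) := by simp
  have n2 : ((y, true) : H × Bool) ≠ (y', true) := by simpa using hyy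
  have n3 : ((y, false) : H × Bool) ≠ (y', true) := by simp
  have n4 : ((y, false) : H × Bool) ≠ (y', false) := by simpa using hyy
  have n5 : ((y', true) : H × Bool) ≠ (y', false) := by simp
  have n6 : ((y, false) : H × Bool) ≠ (y, true) := by simp
  have n7 : ((y, true) : H × Bool) ≠ (y', false) := by simp
  unfold contractLegs
  rcases hnext with hn | hn <;> rcases hprev with hp | hp
  · rw [contract_swap₁₃ n1 n2 n3, contract_swap₂₄ n6 n4 n7]
    exact key y y' y y' _ (Or.inl ⟨rfl, rfl⟩) (Or.inl ⟨rfl, rfl⟩) hn hp hβ.finish_start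
  · rw [contract_swap₁₃ n1 n2 n3]
    exact key y y' y' y _ (Or.inl ⟨rfl, rfl⟩) (Or.inr ⟨rfl, rfl⟩) hn hp hβ.right_left
  · rw [contract_swap₂₄ n3 n4 n5]
    exact key y' y y y' _ (Or.inr ⟨rfl, rfl⟩) (Or.inl ⟨rfl, rfl⟩) hn hp hβ.left_right
  · exact key y' y y' y _ (Or.inr ⟨rfl, rfl⟩) (Or.inr ⟨rfl, rfl⟩) hn hp hβ.start_finish

variable {I : Type*}

/-- The half-edges belonging to a set of edges. -/
def ends (s t : I → H) (S : Finset I) : Set H := {h | ∃ x ∈ S, h = s x ∨ h = t x}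

/-- Let `r` measure the distance of the edges from a centre, in such a way that each of the two
strands through an edge leads away from the centre in at least one direction. Then all edges can be
contracted without changing the norm, up to a factor: the edges are contracted in the order of
increasing distance, so that the removal of the outermost edge is always possible. -/
theorem exists_contraction [DecidableEq I] {nxt : Equiv.Perm H} {E : H → Y → Y → ℂ}
    (hE : ∀ h, ∃ c, IsIso c (E h)) (hE' : ∀ h, ∃ c, IsIso c fun a b => E h b a) {c : ℝ}
    {β : I → Y → Y → Y → Y → ℂ} (hβ : ∀ x, IsDual c (β x)) {s t : I → H}
    (hs : Function.Injective s) (ht : Function.Injective t) (hst : ∀ x x', s x ≠ t x')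
    {r : H → ℝ} (hr : ∀ x, r (t x) = r (s x))
    (hnext : ∀ x, r (s x) < r (nxt (s x)) ∨ r (s x) < r (nxt (t x)))
    (hprev : ∀ x, r (s x) < r (nxt.symm (s x)) ∨ r (s x) < r (nxt.symm (t x)))
    {T T₀ : Set H} (hT : ∀ τ ∈ T, ∀ y, r τ ≤ r y) {F₀ : (H × Bool → Y) → ℂ}
    (hF₀ : IndepOf (legs T₀) F₀)
    (hW : ∀ K, Disjoint (wireEnds nxt K) (legs T) → HasWires nxt E K F₀)
    (S : Finset I) (hS : ∀ x ∈ S, s x ∉ T ∧ t x ∉ T) :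
    ∃ F : (H × Bool → Y) → ℂ, IndepOf (legs (T₀ ∪ ends s t S)) F ∧
      (∀ K, Disjoint (wireEnds nxt K) (legs (T ∪ ends s t S)) → HasWires nxt E K F) ∧
      (∀ G : (H × Bool → Y) → ℂ, IndepOf (legs (ends s t S)) G →
        ∑ z, F z * G z = Fintype.card Y ^ (4 * S.card) *
          ∑ z, (∏ x ∈ S, β x (z (s x, true)) (z (s x, false)) (z (t x, true)) (z (t x, false))) *
            F₀ z * G z) ∧
      ∑ z, ‖F z‖ ^ 2 = (c * Fintype.card Y ^ 2) ^ S.card * ∑ z, ‖F₀ z‖ ^ 2 := by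
  induction S using Finset.induction_on_max_value (fun x => r (s x)) with
  | empty =>
    refine ⟨F₀, ?_, ?_, ?_, ?_⟩
    · simpa [ends] using hF₀
    · simpa [ends] using hW
    · intro G _; simp
    · simp
  | insert a S haS hmax ih =>
    obtain ⟨F, hF1, hF2, hF3, hF4⟩ := ih fun x hx => hS x (Finset.mem_insert_of_mem hx)
    have hsa : s a ∉ T ∪ ends s t S := by
      rintro (h | ⟨x, hx, h | h⟩)
      · exact (hS a (Finset.mem_insert_self _ _)).1 h
      · exact haS (by rwa [hs h])
      · exact hst _ _ h
    have hta : t a ∉ T ∪ ends s t S := by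
      rintro (h | ⟨x, hx, h | h⟩)
      · exact (hS a (Finset.mem_insert_self _ _)).2 h
      · exact hst _ _ h.symm
      · exact haS (by rwa [ht h])
    have hout : ∀ h, r (s a) < r h → h ∉ insert (s a) (insert (t a) (T ∪ ends s t S)) := by
      rintro h hlt (rfl | rfl | hh | ⟨x, hx, rfl | rfl⟩)
      · exact lt_irrefl _ hlt
      · rw [hr] at hlt; exact lt_irrefl _ hlt
      · exact absurd (hT h hh (s a)) (not_le.2 hlt)
      · exact absurd (hmax x hx) (not_le.2 hlt)
      · rw [hr] at hlt; exact absurd (hmax x hx) (not_le.2 hlt)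
    have hends : ends s t (insert a S) = ends s t S ∪ {s a, t a} := by
      ext h
      constructor
      · rintro ⟨x, hx, hh⟩
        rcases Finset.mem_insert.1 hx with rfl | hx
        · exact Or.inr (by simpa using hh)
        · exact Or.inl ⟨x, hx, hh⟩
      · rintro (⟨x, hx, hh⟩ | hh)
        · exact ⟨x, Finset.mem_insert_of_mem hx, hh⟩
        · exact ⟨a, Finset.mem_insert_self _ _, by simpa using hh⟩
    refine ⟨contractLegs (s a) (t a) (β a) F, ?_, ?_, ?_, ?_⟩
    · refine (indepOf_contract hF1).mono ?_
      rintro ⟨h, i⟩ hw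
      change h ∈ T₀ ∪ ends s t (insert a S) at hw
      rw [hends, ← Set.union_assoc] at hw
      rcases hw with hw | hw
      · exact Or.inl hw
      · refine Or.inr ?_
        rcases hw with rfl | rfl <;> cases i <;> simp
    · intro K hK
      refine HasWires.contractLegs (hF2 K (hK.mono_right ?_)) (hK.mono_right ?_) _
      · rw [hends, ← Set.union_assoc]
        exact fun w hw => Or.inl hw
      · rw [hends, ← Set.union_assoc]
        exact fun w hw => Or.inr hw
    · intro G hG
      have hsub : ({(s a, true), (s a, false), (t a, true), (t a, false)} : Set (H × Bool)) ⊆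
          legs (ends s t (insert a S)) := by
        rw [hends]
        rintro w (rfl | rfl | rfl | rfl) <;> exact Or.inr (by simp)
      have hne : s a ≠ t a := hst _ _
      refine (sum_contract_mul (by simp) (by simpa using hne) (by simp) (by simp)
        (by simpa using hne) (by simp) (β a) F (hG.mono hsub)).trans ?_
      rw [show ∑ z, β a (z (s a, true)) (z (s a, false)) (z (t a, true)) (z (t a, false)) *
          F z * G z = ∑ z, F z * (β a (z (s a, true)) (z (s a, false)) (z (t a, true))
            (z (t a, false)) * G z) from Finset.sum_congr rfl fun z _ => by ring,
        hF3 _ fun z z' hz => ?_]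
      · rw [Finset.card_insert_of_notMem haS, mul_add, pow_add, mul_one, ← mul_assoc, mul_comm (_ ^ 4)]
        congr 1
        refine Finset.sum_congr rfl fun z _ => ?_
        rw [Finset.prod_insert haS]
        ring
      · have e1 : ∀ i, z (s a, i) = z' (s a, i) := fun i => hz _ fun h => hsa (Or.inr h)
        have e2 : ∀ i, z (t a, i) = z' (t a, i) := fun i => hz _ fun h => hta (Or.inr h)
        rw [e1, e1, e2, e2, hG.mono (fun w hw => ?_) z z' hz]
        change w.1 ∈ ends s t (insert a S)
        rw [hends]
        exact Or.inl hw
    · rw [sum_norm_sq_contractLegs hE hE' (hβ a) (hst a a) hsa hta hF2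
        ((hnext a).imp (hout _) (hout _)) ((hprev a).imp (hout _) (hout _)), hF4,
        Finset.card_insert_of_notMem haS]
      ring

end Contract

section Free

variable {H Φ Q : Type*} [Fintype H] [DecidableEq H] [Fintype Φ] [DecidableEq Φ] [Fintype Q]

theorem sum_comp_injective {ι : Φ → H} (hι : Function.Injective ι) {M : Type*} [AddCommMonoid M]
    (g : (Φ → Q) → M) :
    ∑ z : H → Q, g (z ∘ ι) = Fintype.card ({h // h ∉ Set.range ι} → Q) • ∑ u, g u := by
  classical
  let e₁ : (H → Q) ≃ ({h // h ∈ Set.range ι} → Q) × ({h // h ∉ Set.range ι} → Q) :=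
    Equiv.piEquivPiSubtypeProd (fun h => h ∈ Set.range ι) fun _ => Q
  let e₂ : ({h // h ∈ Set.range ι} → Q) ≃ (Φ → Q) :=
    Equiv.arrowCongr (Equiv.ofInjective ι hι).symm (Equiv.refl Q)
  rw [Fintype.sum_equiv (e₁.trans (e₂.prodCongr (Equiv.refl _))) (fun z => g (z ∘ ι))
    (fun p => g p.1) fun z => ?_, Fintype.sum_prod_type_right]
  · simp
  · congr 1

variable [DecidableEq Q]

/-- Applying unitary matrices to the free indices preserves the norm. -/
theorem sum_norm_sq_free {ι : Φ → H} (hι : Function.Injective ι) {F : (H → Q) → ℂ}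
    (hF : ∀ z z', z ∘ ι = z' ∘ ι → F z = F z') {D : Φ → Q → Q → ℂ}
    (hD : ∀ f b b', ∑ a, conj (D f a b) * D f a b' = if b = b' then 1 else 0) :
    ∑ b : Φ → Q, ‖∑ z, F z * ∏ f, D f (b f) (z (ι f))‖ ^ 2 =
      Fintype.card ({h // h ∉ Set.range ι} → Q) * ∑ z, ‖F z‖ ^ 2 := by
  set m := Fintype.card ({h // h ∉ Set.range ι} → Q) with hm
  obtain ⟨F', hF'⟩ : ∃ F' : (Φ → Q) → ℂ, ∀ z, F z = F' (z ∘ ι) := by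
    have : Function.FactorsThrough F (fun z : H → Q => z ∘ ι) := fun z z' h => hF z z' h
    exact ⟨Function.extend (fun z : H → Q => z ∘ ι) F 0, fun z => (this.extend_apply 0 z).symm⟩
  have h1 : ∀ b : Φ → Q, ∑ z, F z * ∏ f, D f (b f) (z (ι f)) =
      m * ∑ u : Φ → Q, F' u * ∏ f, D f (b f) (u f) := by
    intro b
    rw [← nsmul_eq_mul, hm, ← sum_comp_injective hι fun u : Φ → Q => F' u * ∏ f, D f (b f) (u f)]
    simp only [hF', Function.comp_apply]
  have h2 : ∑ z, ‖F z‖ ^ 2 = m * ∑ u, ‖F' u‖ ^ 2 := by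
    rw [← nsmul_eq_mul, hm, ← sum_comp_injective hι fun u => ‖F' u‖ ^ 2]
    simp only [hF']
  have h3 : ∑ b : Φ → Q, ‖∑ u : Φ → Q, F' u * ∏ f, D f (b f) (u f)‖ ^ 2 = ∑ u, ‖F' u‖ ^ 2 := by
    have horth : ∀ u u' : Φ → Q, ∑ b : Φ → Q,
        conj (∏ f, D f (b f) (u f)) * ∏ f, D f (b f) (u' f) = if u = u' then 1 else 0 := by
      intro u u'
      simp only [map_prod, ← Finset.prod_mul_distrib]
      rw [← Fintype.prod_sum (fun f a => conj (D f a (u f)) * D f a (u' f))]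
      simp only [hD]
      exact prod_ite_eq_funext u u'
    have hc : ((∑ b : Φ → Q, ‖∑ u : Φ → Q, F' u * ∏ f, D f (b f) (u f)‖ ^ 2 : ℝ) : ℂ) =
        ((∑ u, ‖F' u‖ ^ 2 : ℝ) : ℂ) := by
      push_cast
      simp only [← Complex.conj_mul', map_sum, map_mul, Finset.sum_mul_sum]
      rw [Finset.sum_comm]
      refine Finset.sum_congr rfl fun u _ => ?_
      rw [Finset.sum_comm]
      have : ∀ u', ∑ b : Φ → Q, conj (F' u) * conj (∏ f, D f (b f) (u f)) *
          (F' u' * ∏ f, D f (b f) (u' f)) = conj (F' u) * F' u' * if u = u' then 1 else 0 := by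
        intro u'
        rw [← horth, Finset.mul_sum]
        exact Finset.sum_congr rfl fun b _ => by ring
      rw [Finset.sum_congr rfl fun u' _ => this u']
      simp
    exact_mod_cast hc
  simp only [h1, norm_mul, mul_pow, ← Finset.mul_sum, h3, h2]
  simp
  ring

end Free

end WireNet

/-! ### Dual-unitary tensors with holonomies -/

namespace WireNet

section Dress

variable {Y : Type*} [Fintype Y]

theorem sum_norm_sq_of_orthogonal {α β : Type*} [Fintype α] [DecidableEq α] [Fintype β] {c : ℝ}
    {E : α → β → ℂ}
    (h : ∀ o o', ∑ p, conj (E o p) * E o' p = if o = o' then (c : ℂ) else 0) (v : α → ℂ) :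
    ∑ p, ‖∑ o, E o p * v o‖ ^ 2 = c * ∑ o, ‖v o‖ ^ 2 := by
  have hc : ((∑ p, ‖∑ o, E o p * v o‖ ^ 2 : ℝ) : ℂ) = ((c * ∑ o, ‖v o‖ ^ 2 : ℝ) : ℂ) := by
    push_cast
    simp only [← Complex.conj_mul', map_sum, map_mul, Finset.sum_mul_sum]
    rw [Finset.sum_comm, Finset.mul_sum]
    refine Finset.sum_congr rfl fun o _ => ?_
    rw [Finset.sum_comm]
    have : ∀ o', ∑ p, conj (E o p) * conj (v o) * (E o' p * v o') =
        conj (v o) * v o' * if o = o' then (c : ℂ) else 0 := by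
      intro o'
      rw [← h, Finset.mul_sum]
      exact Finset.sum_congr rfl fun p _ => by ring
    rw [Finset.sum_congr rfl fun o' _ => this o']
    simp
    ring
  exact_mod_cast hc

theorem isIso_of_orthogonal [DecidableEq Y] {c : ℝ} {E : Y → Y → ℂ}
    (h : ∀ o o', ∑ p, conj (E o p) * E o' p = if o = o' then (c : ℂ) else 0) : IsIso c E :=
  sum_norm_sq_of_orthogonal h

variable {c : ℝ} {β : Y → Y → Y → Y → ℂ} {U : Y → Y → ℂ}

theorem IsIso₂.dress_fst_in (h : IsIso₂ c β) (hU : IsIso 1 fun b a => U a b) :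
    IsIso₂ c fun i₁ i₂ o₁ o₂ => ∑ a, U a i₁ * β a i₂ o₁ o₂ := by
  intro v
  have h1 := h fun a i₂ => ∑ i₁, U a i₁ * v i₁ i₂
  have h2 : ∑ a, ∑ i₂, ‖∑ i₁, U a i₁ * v i₁ i₂‖ ^ 2 = ∑ i₁, ∑ i₂, ‖v i₁ i₂‖ ^ 2 := by
    rw [Finset.sum_comm, Finset.sum_comm (f := fun i₁ i₂ => ‖v i₁ i₂‖ ^ 2)]
    exact Finset.sum_congr rfl fun i₂ _ => by simpa using hU fun i₁ => v i₁ i₂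
  rw [← h2, ← h1]
  refine Finset.sum_congr rfl fun o₁ _ => Finset.sum_congr rfl fun o₂ _ => ?_
  congr 2
  simp only [Finset.mul_sum, Finset.sum_mul]
  rw [Finset.sum_comm, Finset.sum_comm (f := fun a i₂ => ∑ i₁, β a i₂ o₁ o₂ * (U a i₁ * v i₁ i₂))]
  refine Finset.sum_congr rfl fun i₂ _ => ?_
  rw [Finset.sum_comm]
  exact Finset.sum_congr rfl fun a _ => Finset.sum_congr rfl fun i₁ _ => by ring

theorem IsIso₂.swap_in (h : IsIso₂ c β) : IsIso₂ c fun i₁ i₂ o₁ o₂ => β i₂ i₁ o₁ o₂ := by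
  intro v
  rw [Finset.sum_comm (f := fun i₁ i₂ => ‖v i₁ i₂‖ ^ 2), ← h fun a b => v b a]
  refine Finset.sum_congr rfl fun o₁ _ => Finset.sum_congr rfl fun o₂ _ => ?_
  rw [Finset.sum_comm]

theorem IsIso₂.swap_out (h : IsIso₂ c β) : IsIso₂ c fun i₁ i₂ o₁ o₂ => β i₁ i₂ o₂ o₁ := by
  intro v
  rw [← h v, Finset.sum_comm]

theorem IsIso₂.dress_fst_out (h : IsIso₂ c β) (hU : IsIso 1 U) :
    IsIso₂ c fun i₁ i₂ o₁ o₂ => ∑ a, U a o₁ * β i₁ i₂ a o₂ := by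
  intro v
  rw [← h v, Finset.sum_comm, Finset.sum_comm (f := fun o₁ o₂ => ‖∑ i₁, ∑ i₂, β i₁ i₂ o₁ o₂ *
    v i₁ i₂‖ ^ 2)]
  refine Finset.sum_congr rfl fun o₂ _ => ?_
  have h1 := hU fun a => ∑ i₁, ∑ i₂, β i₁ i₂ a o₂ * v i₁ i₂
  rw [one_mul] at h1
  rw [← h1]
  refine Finset.sum_congr rfl fun o₁ _ => ?_
  congr 2
  simp only [Finset.mul_sum, Finset.sum_mul]
  conv_rhs => rw [Finset.sum_comm]
  refine Finset.sum_congr rfl fun i₁ _ => ?_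
  conv_rhs => rw [Finset.sum_comm]
  exact Finset.sum_congr rfl fun i₂ _ => Finset.sum_congr rfl fun a _ => by ring

theorem IsIso₂.dress_snd_in (h : IsIso₂ c β) (hU : IsIso 1 fun b a => U a b) :
    IsIso₂ c fun i₁ i₂ o₁ o₂ => ∑ a, U a i₂ * β i₁ a o₁ o₂ :=
  (h.swap_in.dress_fst_in hU).swap_in

theorem IsIso₂.dress_snd_out (h : IsIso₂ c β) (hU : IsIso 1 U) :
    IsIso₂ c fun i₁ i₂ o₁ o₂ => ∑ a, U a o₂ * β i₁ i₂ o₁ a :=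
  (h.swap_out.dress_fst_out hU).swap_out

theorem IsDual.dress_left (h : IsDual c β) (hU : IsIso 1 U) (hU' : IsIso 1 fun b a => U a b) :
    IsDual c fun bl br tl tr => ∑ a, U a bl * β a br tl tr where
  start_finish := h.start_finish.dress_fst_in hU'
  right_left := h.right_left.dress_fst_out hU
  left_right := h.left_right.dress_fst_in hU'
  finish_start := h.finish_start.dress_fst_out hU

theorem IsDual.dress_right (h : IsDual c β) (hU : IsIso 1 U) (hU' : IsIso 1 fun b a => U a b) :
    IsDual c fun bl br tl tr => ∑ a, U a br * β bl a tl tr where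
  start_finish := h.start_finish.dress_snd_in hU'
  right_left := h.right_left.dress_snd_in hU'
  left_right := h.left_right.dress_snd_out hU
  finish_start := h.finish_start.dress_snd_out hU

end Dress

section Legs

variable {k : ℕ} {Y H : Type*} (J : Qudit k ≃ Y × Y)

/-- The indices of the legs, each of which is composed of a left and a right part. -/
def legIndex (z : H × Bool → Y) (h : H) : Qudit k := J.symm (z (h, true), z (h, false))

/-- Indices of legs correspond to pairs of indices of their left and right parts. -/
def legEquiv : (H × Bool → Y) ≃ (H → Qudit k) where
  toFun := legIndex J
  invFun x w := if w.2 then (J (x w.1)).1 else (J (x w.1)).2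
  left_inv z := by
    funext ⟨h, i⟩
    cases i <;> simp [legIndex]
  right_inv x := by
    funext h
    simp [legIndex]

/-- The tensor of an edge carrying the matrix `R`, in terms of the left and right parts of its two
legs. -/
def edgeWeight (B : LegTensor (Fin 2) k) (R : Qudit k → Qudit k → ℂ) (bl br tl tr : Y) : ℂ :=
  ∑ s : Qudit k, B ![s, J.symm (tl, tr)] * R s (J.symm (bl, br))

/-- `R` acts on the left and right parts of a leg separately, and by unitaries. -/
def IsSplitUnitary [Fintype Y] (R : Qudit k → Qudit k → ℂ) : Prop :=
  ∃ U V : Y → Y → ℂ, IsIso 1 U ∧ (IsIso 1 fun b a => U a b) ∧ IsIso 1 V ∧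
    (IsIso 1 fun b a => V a b) ∧
    ∀ a b a' b', R (J.symm (a, b)) (J.symm (a', b')) = U a a' * V b b'

variable {J}

theorem isDual_edgeWeight [Fintype Y] {c : ℝ} {B : LegTensor (Fin 2) k}
    (hB : IsDual c fun bl br tl tr => B ![J.symm (bl, br), J.symm (tl, tr)])
    {R : Qudit k → Qudit k → ℂ} (hR : IsSplitUnitary J R) : IsDual c (edgeWeight J B R) := by
  obtain ⟨U, V, hU, hU', hV, hV', hUV⟩ := hR
  have h := (hB.dress_left hU hU').dress_right hV hV'
  have heq : edgeWeight J B R = fun bl br tl tr =>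
      ∑ b, V b br * ∑ a, U a bl * B ![J.symm (a, b), J.symm (tl, tr)] := by
    funext bl br tl tr
    unfold edgeWeight
    rw [← Equiv.sum_comp J.symm, Fintype.sum_prod_type, Finset.sum_comm]
    refine Finset.sum_congr rfl fun b _ => ?_
    rw [Finset.mul_sum]
    refine Finset.sum_congr rfl fun a _ => ?_
    rw [hUV]
    ring
  rw [heq]
  exact h

end Legs

end WireNet

/-! ### The boundary state is isometric in a cut edge -/

open WireNet

theorem sum_norm_sq_curry {α : Type*} [Fintype α] (X : EuclideanSpace ℂ (α × α)) :
    ‖X‖ ^ 2 = ∑ a, ∑ b, ‖X (a, b)‖ ^ 2 := by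
  rw [EuclideanSpace.norm_sq_eq, Fintype.sum_prod_type]

/-- A `q`-valent tensor which is a product of wires connecting the left part of each leg with the
right part of the next leg. -/
structure IsWired {q k : ℕ} [NeZero q] {Y : Type} [Fintype Y] (J : Qudit k ≃ Y × Y)
    (E : Fin q → Y → Y → ℂ) (A : LegTensor (Fin q) k) : Prop where
  eq_prod : ∀ x, A x = ∏ i, E i (J (x i)).1 (J (x (i + 1))).2
  isIso : ∀ i, ∃ c, IsIso c (E i)
  isIso_swap : ∀ i, ∃ c, IsIso c fun a b => E i b a
  ne_zero : A ≠ 0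

namespace SpinGraph

variable {q : ℕ}

variable {k : ℕ} {Y : Type} {G : SpinGraph q}

theorem matFactor_legIndex_some (J : Qudit k ≃ Y × Y) {B : LegTensor (Fin 2) k}
    {R : Qudit k → Qudit k → ℂ} {z : (G.V × Fin q) × Bool → Y} {b : G.Free → Qudit k} {e : G.E}
    {y : G.V × Fin q} (h : G.finish e = some y) :
    G.matFactor B R (legIndex J z) b e = edgeWeight J B R (z (G.start e, true))
      (z (G.start e, false)) (z (y, true)) (z (y, false)) := by
  rw [matFactor_some h]; rfl

/-- Every half-edge belongs to exactly one edge, and there are no loops. -/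
structure IsProper (G : SpinGraph q) : Prop where
  start_injective : Function.Injective G.start
  finish_injective : ∀ {e e' y}, G.finish e = some y → G.finish e' = some y → e = e'
  start_ne_finish : ∀ e {e' y}, G.finish e' = some y → G.start e ≠ y
  exists_edge : ∀ y, ∃ e, G.start e = y ∨ G.finish e = some y
  vertex_ne : ∀ {e y}, G.finish e = some y → (G.start e).1 ≠ y.1

/-- The half-edges of an edge. -/
def edgeLegs (e : G.E) : Set (G.V × Fin q) := {h | h = G.start e ∨ G.finish e = some h}

open Classical in
/-- The identity matrix between the free end of an edge and its other end, if it has a free end. -/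
noncomputable def freeDelta (J : Qudit k ≃ Y × Y) (e : G.E) (b : G.Free → Qudit k)
    (z : (G.V × Fin q) × Bool → Y) : ℂ :=
  if h : (G.finish e).isNone then
    if b ⟨e, h⟩ = legIndex J z (G.start e) then 1 else 0 else 1

theorem indepOf_matFactor (J : Qudit k ≃ Y × Y) (hG : G.IsProper) {B : LegTensor (Fin 2) k}
    {R : Qudit k → Qudit k → ℂ} {b : G.Free → Qudit k} {e e₀ : G.E} (he : e ≠ e₀) :
    IndepOf (legs (edgeLegs e₀)) fun z => G.matFactor B R (legIndex J z) b e := by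
  intro z z' hz
  have hstart : ∀ i, z (G.start e, i) = z' (G.start e, i) := fun i => hz _ fun h => by
    rcases h with h | h
    · exact he (hG.start_injective h)
    · exact hG.start_ne_finish e h rfl
  have hleg : legIndex J z (G.start e) = legIndex J z' (G.start e) := by
    unfold legIndex; rw [hstart, hstart]
  beta_reduce
  cases hf : G.finish e with
  | none => rw [matFactor_none hf, matFactor_none hf, hleg]
  | some y =>
    have hfin : ∀ i, z (y, i) = z' (y, i) := fun i => hz _ fun h => by
      rcases h with h | h
      · exact hG.start_ne_finish e₀ hf h.symm
      · exact he (hG.finish_injective hf h)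
    rw [matFactor_legIndex_some J hf, matFactor_legIndex_some J hf, hstart, hstart, hfin, hfin]

section Network

variable [NeZero q]

/-- The next leg of the same vertex. -/
def nextLeg (V : Type) : Equiv.Perm (V × Fin q) :=
  (Equiv.refl V).prodCongr (Equiv.addRight 1)

@[simp]
theorem nextLeg_apply {V : Type} (y : V × Fin q) : nextLeg V y = (y.1, y.2 + 1) := rfl

@[simp]
theorem nextLeg_symm_apply {V : Type} (y : V × Fin q) :
    (nextLeg V).symm y = (y.1, y.2 - 1) := by
  rw [Equiv.symm_apply_eq]
  simp

/-- `r` behaves like the distance of the midpoints of the edges from that of `e₀`: for every inner edge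
`e`, the next edge is farther away than `e` at one of the ends of `e`, and so is the previous edge at
one of the ends. -/
structure IsDistance (G : SpinGraph q) (e₀ : G.E) (r : G.V × Fin q → ℝ) : Prop where
  center_le : ∀ y, r (G.start e₀) ≤ r y
  finish_eq : ∀ {e y}, G.finish e = some y → r y = r (G.start e)
  next : ∀ {e y}, G.finish e = some y →
    r (G.start e) < r (nextLeg _ (G.start e)) ∨ r (G.start e) < r (nextLeg _ y)
  prev : ∀ {e y}, G.finish e = some y →
    r (G.start e) < r ((nextLeg _).symm (G.start e)) ∨ r (G.start e) < r ((nextLeg _).symm y)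

variable [Fintype Y]

variable (G) in
/-- The product of the tensors at the vertices. -/
def vertexProduct (E : Fin q → Y → Y → ℂ) (z : (G.V × Fin q) × Bool → Y) : ℂ :=
  ∏ h : G.V × Fin q, E h.2 (z (h, true)) (z (nextLeg _ h, false))

theorem prod_vertices {J : Qudit k ≃ Y × Y} {E : Fin q → Y → Y → ℂ} {A : LegTensor (Fin q) k}
    (hA : IsWired J E A) (z : (G.V × Fin q) × Bool → Y) :
    ∏ v, A (fun i => legIndex J z (v, i)) = G.vertexProduct E z := by
  unfold vertexProduct
  rw [Fintype.prod_prod_type]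
  refine Finset.prod_congr rfl fun v _ => ?_
  rw [hA.eq_prod]
  simp [legIndex]

/-- Reduction of the norm of the boundary state to that of a state `F₀` in which only the edge `e₀`
has been contracted. -/
theorem norm_insertion_of_base {J : Qudit k ≃ Y × Y} {E : Fin q → Y → Y → ℂ}
    {A : LegTensor (Fin q) k} (hA : IsWired J E A) {c : ℝ} {B : LegTensor (Fin 2) k}
    (hB : IsDual c fun bl br tl tr => B ![J.symm (bl, br), J.symm (tl, tr)])
    (hsplit : ∀ u, IsSplitUnitary J (strandRep (k := k) u))
    (hG : G.IsProper) {e₀ : G.E} {r : G.V × Fin q → ℝ} (hr : G.IsDistance e₀ r) (g : G.E → SU2)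
    (X : EuclideanSpace ℂ (Qudit k × Qudit k)) {T₀ : Set (G.V × Fin q)}
    (hT₀ : ∀ y, G.finish e₀ = some y → G.start e₀ ∈ T₀ ∧ y ∈ T₀)
    {F₀ : ((G.V × Fin q) × Bool → Y) → ℂ} (hF₀ : IndepOf (legs T₀) F₀)
    (hW : ∀ K, Disjoint (wireEnds (nextLeg _) K) (legs (edgeLegs e₀)) →
      HasWires (nextLeg _) (fun h : G.V × Fin q => E h.2) K F₀) {κ : ℝ}
    (hκ : ∀ (b : G.Free → Qudit k) (M : ((G.V × Fin q) × Bool → Y) → ℂ),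
      IndepOf (legs (edgeLegs e₀)) M → ∑ z, F₀ z * (M z * freeDelta J e₀ b z) =
        κ * ∑ z, G.vertexProduct E z * M z *
          G.matFactor B (fun s t => X (s, t)) (legIndex J z) b e₀) :
    ∃ m n : ℕ, m = Fintype.card ({h // h ∉ Set.range fun f : G.Free => G.start f.1} → Qudit k) ∧
      n = (Finset.univ.filter fun x : {e : G.E // ¬ (G.finish e).isNone} => x.1 ≠ e₀).card ∧
      (κ * Fintype.card Y ^ (4 * n)) ^ 2 * ‖insertion A B e₀ g X‖ ^ 2 =
        m * ((c * Fintype.card Y ^ 2) ^ n * ∑ z, ‖F₀ z‖ ^ 2) := by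
  classical
  let I := {e : G.E // ¬ (G.finish e).isNone}
  let s : I → G.V × Fin q := fun x => G.start x.1
  let t : I → G.V × Fin q := fun x => (G.finish x.1).get (by
    simpa [Option.isSome_iff_ne_none] using x.2)
  have ht : ∀ x : I, G.finish x.1 = some (t x) := fun x => by simp [t]
  let S : Finset I := Finset.univ.filter fun x => x.1 ≠ e₀
  let β : I → Y → Y → Y → Y → ℂ := fun x => edgeWeight J B (strandRep (g x.1))
  have hT : ∀ τ ∈ edgeLegs e₀, ∀ y, r τ ≤ r y := by
    rintro τ (rfl | h) y
    · exact hr.center_le y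
    · rw [hr.finish_eq h]; exact hr.center_le y
  obtain ⟨F, hF1, -, hF3, hF4⟩ := exists_contraction (nxt := nextLeg _)
    (E := fun h : G.V × Fin q => E h.2) (fun h => hA.isIso h.2) (fun h => hA.isIso_swap h.2)
    (β := β) (c := c) (fun x => isDual_edgeWeight hB (hsplit _)) (s := s) (t := t) (r := r)
    (fun x x' h => Subtype.ext (hG.start_injective h))
    (fun x x' h => Subtype.ext (hG.finish_injective (ht x) (by rw [h]; exact ht x')))
    (fun x x' => hG.start_ne_finish _ (ht x')) (fun x => hr.finish_eq (ht x))
    (fun x => hr.next (ht x)) (fun x => hr.prev (ht x)) hT hF₀ hW S fun x hx => by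
      have hx : x.1 ≠ e₀ := (Finset.mem_filter.1 hx).2
      constructor
      · rintro (h | h)
        · exact hx (hG.start_injective h)
        · exact hG.start_ne_finish _ h rfl
      · rintro (h | h)
        · exact hG.start_ne_finish e₀ (ht x) h.symm
        · exact hx (hG.finish_injective (ht x) h)
  refine ⟨_, _, rfl, rfl, ?_⟩
  let D : G.Free → Qudit k → Qudit k → ℂ := fun f a b =>
    if f.1 = e₀ then if a = b then 1 else 0 else strandRep (g f.1) a b
  have hD : ∀ f b b', ∑ a, conj (D f a b) * D f a b' = if b = b' then 1 else 0 := by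
    intro f b b'
    by_cases hf : f.1 = e₀
    · simp [D, hf, eq_comm]
    · simp only [D, hf, if_false]
      exact sum_conj_strandRep _ _ _
  have hfree : ∀ f : G.Free, G.finish f.1 = none := fun f => by simpa using f.2
  -- the product of the weights of all edges but `e₀`
  have hprod : ∀ (b : G.Free → Qudit k) (z : (G.V × Fin q) × Bool → Y),
      (∏ x ∈ S, β x (z (s x, true)) (z (s x, false)) (z (t x, true)) (z (t x, false))) *
        ∏ f, D f (b f) (legIndex J z (G.start f.1)) =
      (∏ e ∈ Finset.univ.erase e₀, G.matFactor B (strandRep (g e)) (legIndex J z) b e) *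
        freeDelta J e₀ b z := by
    intro b z
    let w : G.E → ℂ := fun e =>
      if e = e₀ then 1 else G.matFactor B (strandRep (g e)) (legIndex J z) b e
    have h1 : ∏ e ∈ Finset.univ.erase e₀, G.matFactor B (strandRep (g e)) (legIndex J z) b e =
        ∏ e, w e := by
      rw [← Finset.mul_prod_erase _ w (Finset.mem_univ e₀)]
      simp only [w, if_true, one_mul]
      exact Finset.prod_congr rfl fun e he => by rw [if_neg (Finset.ne_of_mem_erase he)]
    have h2 : ∏ x ∈ S, β x (z (s x, true)) (z (s x, false)) (z (t x, true)) (z (t x, false)) =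
        ∏ x : I, w x.1 := by
      rw [Finset.prod_filter]
      refine Finset.prod_congr rfl fun x _ => ?_
      by_cases hx : x.1 = e₀
      · simp [w, hx]
      · simp only [w, hx, if_false, ne_eq, not_false_eq_true, if_true]
        rw [matFactor_legIndex_some J (ht x)]
    have h3 : ∏ f, D f (b f) (legIndex J z (G.start f.1)) =
        (∏ f : G.Free, w f.1) * freeDelta J e₀ b z := by
      have h4 : ∀ f : G.Free, D f (b f) (legIndex J z (G.start f.1)) =
          w f.1 * if f.1 = e₀ then (if b f = legIndex J z (G.start f.1) then 1 else 0) else 1 := by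
        intro f
        by_cases hf : f.1 = e₀
        · simp [D, w, hf]
        · simp only [D, w, hf, if_false, mul_one]
          rw [matFactor_none (hfree f)]
      rw [Finset.prod_congr rfl fun f _ => h4 f, Finset.prod_mul_distrib]
      congr 1
      by_cases he : (G.finish e₀).isNone
      · rw [Finset.prod_eq_single (⟨e₀, he⟩ : G.Free)]
        · simp [freeDelta, he]
        · intro f _ hf
          rw [if_neg fun h => hf (Subtype.ext h)]
        · simp
      · rw [freeDelta, dif_neg he]
        refine Finset.prod_eq_one fun f _ => ?_
        rw [if_neg]
        rintro rfl
        exact he f.2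
    rw [h1, h2, h3, ← Fintype.prod_subtype_mul_prod_subtype (fun e => (G.finish e).isNone = true) w]
    ring
  have hamp : ∀ b : G.Free → Qudit k,
      ((κ * Fintype.card Y ^ (4 * S.card) : ℝ) : ℂ) * insertion A B e₀ g X b =
        ∑ z, F z * ∏ f, D f (b f) (legIndex J z (G.start f.1)) := by
    intro b
    rw [hF3 (fun z => ∏ f, D f (b f) (legIndex J z (G.start f.1))) fun z z' hz => ?_]
    · rw [insertion_apply, netAmp_update, ← Equiv.sum_comp (legEquiv J)]
      have h5 : ∀ z, (∏ x ∈ S, β x (z (s x, true)) (z (s x, false)) (z (t x, true))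
          (z (t x, false))) * F₀ z * ∏ f, D f (b f) (legIndex J z (G.start f.1)) =
          F₀ z * ((∏ e ∈ Finset.univ.erase e₀,
            G.matFactor B (strandRep (g e)) (legIndex J z) b e) * freeDelta J e₀ b z) := by
        intro z
        rw [← hprod]; ring
      simp only [h5]
      rw [hκ b (fun z => ∏ e ∈ Finset.univ.erase e₀,
        G.matFactor B (strandRep (g e)) (legIndex J z) b e) fun z z' hz => Finset.prod_congr rfl fun e he =>
        indepOf_matFactor J hG (Finset.ne_of_mem_erase he) z z' hz]
      push_cast
      rw [mul_comm (κ : ℂ), mul_assoc]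
      congr 2
      refine Finset.sum_congr rfl fun z _ => ?_
      rw [← prod_vertices hA]
      rfl
    · refine Finset.prod_congr rfl fun f _ => ?_
      congr 1
      unfold legIndex
      have : ∀ i, z (G.start f.1, i) = z' (G.start f.1, i) := fun i => hz _ fun h => by
        obtain ⟨x, hx, h | h⟩ := h
        · have hfx : f.1 = x.1 := hG.start_injective h
          exact x.2 (by rw [← hfx]; exact f.2)
        · exact hG.start_ne_finish f.1 (ht x) h
      rw [this, this]
  have hι : Function.Injective fun f : G.Free => G.start f.1 := fun f f' h =>
    Subtype.ext (hG.start_injective h)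
  have hfin := sum_norm_sq_free hι (F := fun x => F ((legEquiv J).symm x)) (D := D) ?_ hD
  · rw [← hF4]
    have h6 : ∑ x, ‖F ((legEquiv J).symm x)‖ ^ 2 = ∑ z, ‖F z‖ ^ 2 :=
      Equiv.sum_comp (legEquiv J).symm fun z => ‖F z‖ ^ 2
    rw [h6] at hfin
    rw [← hfin, EuclideanSpace.norm_sq_eq, Finset.mul_sum]
    refine Finset.sum_congr rfl fun b _ => ?_
    rw [← Equiv.sum_comp (legEquiv J)]
    simp only [Equiv.symm_apply_apply]
    rw [show ∑ z, F z * ∏ f, D f (b f) (legEquiv J z (G.start f.1)) =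
      ∑ z, F z * ∏ f, D f (b f) (legIndex J z (G.start f.1)) from rfl, ← hamp b, norm_mul,
      Complex.norm_real, Real.norm_eq_abs, mul_pow |κ * _|, sq_abs]
  · intro x x' hx
    refine hF1 _ _ fun w hw => ?_
    obtain ⟨e, he⟩ := hG.exists_edge w.1
    have hnone : G.finish e = none ∧ G.start e = w.1 := by
      by_contra hcon
      apply hw
      change w.1 ∈ T₀ ∪ ends s t S
      cases hfe : G.finish e with
      | none =>
        rcases he with he | he
        · exact absurd ⟨hfe, he⟩ hcon
        · rw [hfe] at he; cases he
      | some y =>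
        by_cases hee : e = e₀
        · subst hee
          have := hT₀ y hfe
          rcases he with he | he
          · rw [← he]; exact Or.inl this.1
          · rw [hfe] at he; cases he; exact Or.inl this.2
        · have hs : ¬ (G.finish e).isNone := by simp [hfe]
          refine Or.inr ⟨⟨e, hs⟩, by simp [S, hee], ?_⟩
          rcases he with he | he
          · exact Or.inl he.symm
          · have h7 := ht ⟨e, hs⟩
            rw [he] at h7
            exact Or.inr (Option.some.inj h7)
    have hxw : x w.1 = x' w.1 := by
      have := congrFun hx ⟨e, by simp [hnone.1]⟩
      simp only [Function.comp_apply, hnone.2] at this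
      exact this
    change (if w.2 then (J (x w.1)).1 else (J (x w.1)).2) =
      (if w.2 then (J (x' w.1)).1 else (J (x' w.1)).2)
    rw [hxw]

end Network

end SpinGraph

namespace SpinGraph

section Network

variable {q k : ℕ} [NeZero q] {Y : Type} [Fintype Y] {G : SpinGraph q}

theorem sum_norm_sq_vertexProduct_pos {J : Qudit k ≃ Y × Y} {E : Fin q → Y → Y → ℂ}
    {A : LegTensor (Fin q) k} (hA : IsWired J E A) : 0 < ∑ z, ‖G.vertexProduct E z‖ ^ 2 := by
  obtain ⟨x, hx⟩ := Function.ne_iff.1 hA.ne_zero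
  refine Finset.sum_pos' (fun _ _ => by positivity)
    ⟨(legEquiv J).symm fun h : G.V × Fin q => x h.2, Finset.mem_univ _, ?_⟩
  rw [← prod_vertices hA]
  have : legIndex J ((legEquiv J).symm fun h : G.V × Fin q => x h.2) = fun h => x h.2 :=
    (legEquiv J).apply_symm_apply _
  rw [this]
  have h2 : (∏ _v : G.V, A fun i => x i) ≠ 0 := Finset.prod_ne_zero_iff.2 fun _ _ => hx
  positivity

theorem sum_norm_sq_edgeWeight {J : Qudit k ≃ Y × Y} {c : ℝ} {B : LegTensor (Fin 2) k}
    (hB : IsDual c fun bl br tl tr => B ![J.symm (bl, br), J.symm (tl, tr)])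
    (X : EuclideanSpace ℂ (Qudit k × Qudit k)) :
    ∑ a, ∑ b, ∑ a', ∑ b', ‖edgeWeight J B (fun s t => X (s, t)) a b a' b'‖ ^ 2 = c * ‖X‖ ^ 2 := by
  have h1 : ∀ a b, ∑ a', ∑ b', ‖edgeWeight J B (fun s t => X (s, t)) a b a' b'‖ ^ 2 =
      c * ∑ s, ‖X (s, J.symm (a, b))‖ ^ 2 := by
    intro a b
    rw [← Equiv.sum_comp J.symm, Fintype.sum_prod_type,
      ← hB.start_finish fun sl sr => X (J.symm (sl, sr), J.symm (a, b))]
    refine Finset.sum_congr rfl fun a' _ => Finset.sum_congr rfl fun b' _ => ?_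
    unfold edgeWeight
    rw [← Equiv.sum_comp J.symm, Fintype.sum_prod_type]
  simp only [h1, ← Finset.mul_sum]
  rw [sum_norm_sq_curry, Finset.sum_comm (f := fun s t => ‖X (s, t)‖ ^ 2),
    ← Equiv.sum_comp J.symm (fun t => ∑ s, ‖X (s, t)‖ ^ 2), Fintype.sum_prod_type]

theorem ne_add_one (hq : 2 ≤ q) (i : Fin q) : i ≠ i + 1 := by
  intro h
  have h1 : (1 : Fin q) = 0 := by simpa using h.symm
  have h2 := congrArg Fin.val h1
  rw [Fin.val_one', Fin.val_zero, Nat.mod_eq_of_lt (by omega)] at h2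
  omega

theorem ne_sub_one (hq : 2 ≤ q) (i : Fin q) : i ≠ i - 1 := by
  intro h
  exact ne_add_one hq (i - 1) (by simpa using h.symm)

/-- The tensors at the vertices, contracted along the edge `e₀` with a matrix `X`, have a norm
proportional to that of `X`. -/
theorem exists_base (hq : 2 ≤ q) {J : Qudit k ≃ Y × Y} {E : Fin q → Y → Y → ℂ}
    {A : LegTensor (Fin q) k} (hA : IsWired J E A) {c : ℝ} (hc : 0 < c) {B : LegTensor (Fin 2) k}
    (hB : IsDual c fun bl br tl tr => B ![J.symm (bl, br), J.symm (tl, tr)])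
    (hG : G.IsProper) (e₀ : G.E) :
    ∃ (T₀ : Set (G.V × Fin q)) (κ K : ℝ), 0 < κ ∧ 0 < K ∧
      (∀ y, G.finish e₀ = some y → G.start e₀ ∈ T₀ ∧ y ∈ T₀) ∧
      ∀ X : EuclideanSpace ℂ (Qudit k × Qudit k), ∃ F₀ : ((G.V × Fin q) × Bool → Y) → ℂ,
        IndepOf (legs T₀) F₀ ∧
        (∀ L, Disjoint (wireEnds (nextLeg _) L) (legs (edgeLegs e₀)) →
          HasWires (nextLeg _) (fun h : G.V × Fin q => E h.2) L F₀) ∧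
        (∀ (b : G.Free → Qudit k) (M : ((G.V × Fin q) × Bool → Y) → ℂ),
          IndepOf (legs (edgeLegs e₀)) M → ∑ z, F₀ z * (M z * freeDelta J e₀ b z) =
            κ * ∑ z, G.vertexProduct E z * M z *
              G.matFactor B (fun s t => X (s, t)) (legIndex J z) b e₀) ∧
        ∑ z, ‖F₀ z‖ ^ 2 = K * ‖X‖ ^ 2 := by
  classical
  obtain ⟨x₀, -⟩ := Function.ne_iff.1 hA.ne_zero
  have hY : 0 < (Fintype.card Y : ℝ) := by
    have : Nonempty Y := ⟨(J (x₀ 0)).1⟩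
    exact_mod_cast Fintype.card_pos
  have hN := sum_norm_sq_vertexProduct_pos (G := G) hA
  set y₀ := G.start e₀ with hy₀
  have hwires : ∀ L, HasWires (nextLeg _) (fun h : G.V × Fin q => E h.2) L (G.vertexProduct E) :=
    fun L => hasWires_prod (nextLeg _) (fun h : G.V × Fin q => E h.2) L
  have hn0 : y₀ ≠ nextLeg _ y₀ := fun h => ne_add_one hq y₀.2 (congrArg Prod.snd h)
  have hp0 : y₀ ≠ (nextLeg _).symm y₀ := fun h =>
    ne_sub_one hq y₀.2 (by simpa using congrArg Prod.snd h)
  obtain ⟨c₁, h₁⟩ := hA.isIso y₀.2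
  obtain ⟨c₂, h₂⟩ := hA.isIso_swap ((nextLeg G.V).symm y₀).2
  cases hfin : G.finish e₀ with
  | some y =>
    have hlegs : edgeLegs e₀ = {y₀, y} := by
      ext h
      simp [edgeLegs, hfin, ← hy₀, eq_comm (a := y)]
    have hv : y₀.1 ≠ y.1 := hG.vertex_ne hfin
    have hny : y ≠ nextLeg _ y := fun h => ne_add_one hq y.2 (congrArg Prod.snd h)
    have hpy : y ≠ (nextLeg _).symm y := fun h =>
      ne_sub_one hq y.2 (by simpa using congrArg Prod.snd h)
    obtain ⟨c₃, h₃⟩ := hA.isIso y.2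
    obtain ⟨c₄, h₄⟩ := hA.isIso_swap ((nextLeg G.V).symm y).2
    refine ⟨{y₀, y}, Fintype.card Y ^ 4, c * ∑ z, ‖G.vertexProduct E z‖ ^ 2, by positivity,
      by positivity, ?_, fun X => ⟨contractLegs y₀ y (edgeWeight J B fun s t => X (s, t))
        (G.vertexProduct E), ?_, ?_, ?_, ?_⟩⟩
    · intro y' h
      cases h
      simp
    · refine (indepOf_contract (S := ∅) fun z z' h => ?_).mono ?_
      · rw [show z = z' from funext fun w => h w (Set.notMem_empty _)]
      · rintro ⟨h, i⟩ (rfl | rfl) <;> cases i <;> simp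
    · intro L hL
      exact (hwires L).contractLegs (by rwa [← hlegs]) _
    · intro b M hM
      have hsub : ({(y₀, true), (y₀, false), (y, true), (y, false)} :
          Set ((G.V × Fin q) × Bool)) ⊆ legs (edgeLegs e₀) := by
        rw [hlegs]
        rintro w (rfl | rfl | rfl | rfl) <;> simp [legs]
      have hyy : y₀ ≠ y := fun h => hv (congrArg Prod.fst h)
      have hδ : ∀ z, freeDelta J e₀ b z = 1 := fun z => by simp [freeDelta, hfin]
      simp only [hδ, mul_one]
      refine (sum_contract_mul (by simp) (by simpa using hyy) (by simp) (by simp)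
        (by simpa using hyy) (by simp) _ _ (hM.mono hsub)).trans ?_
      push_cast
      congr 1
      refine Finset.sum_congr rfl fun z _ => ?_
      rw [matFactor_legIndex_some J hfin]
      ring
    · have hcorner : ∀ i j : Fin q, ((y₀.1, i) : G.V × Fin q) ≠ (y.1, j) := fun i j h =>
        hv (Prod.ext_iff.1 h).1
      obtain ⟨F', hF', hFF⟩ := hwires {y₀, (nextLeg _).symm y₀, y, (nextLeg _).symm y}
      have e1 : y₀ ≠ y := hcorner y₀.2 y.2
      have e2 : y₀ ≠ (nextLeg _).symm y := by rw [nextLeg_symm_apply]; exact hcorner y₀.2 _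
      have e3 : (nextLeg _).symm y₀ ≠ y := by rw [nextLeg_symm_apply]; exact hcorner _ y.2
      have e4 : (nextLeg _).symm y₀ ≠ (nextLeg _).symm y := by
        rw [nextLeg_symm_apply, nextLeg_symm_apply]; exact hcorner _ _
      have e5 : y₀ ≠ nextLeg _ y := hcorner y₀.2 _
      have e6 : y ≠ nextLeg _ y₀ := (hcorner _ y.2).symm
      have e7 : nextLeg _ y₀ ≠ nextLeg _ y := hcorner _ _
      refine (sum_norm_sq_contract_four h₁ h₂ h₃ h₄ (p₁ := (nextLeg _ y₀, false))
        (p₂ := ((nextLeg _).symm y₀, true)) (p₃ := (nextLeg _ y, false))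
        (p₄ := ((nextLeg _).symm y, true)) (F' := F') ?_ _ (fun z => ?_) (hF'.mono ?_)).trans ?_
      · simp only [List.nodup_cons, List.mem_cons, List.not_mem_nil, or_false, not_or,
          List.nodup_nil, Prod.mk.injEq, reduceCtorEq, and_false, and_true, not_false_eq_true,
          true_and]
        exact ⟨⟨e1, hp0, e2⟩, ⟨e1, hn0, e5⟩, ⟨Ne.symm e3, hpy⟩, ⟨e6, hny⟩, e7, e4⟩
      · rw [hFF, Finset.prod_insert, Finset.prod_insert, Finset.prod_pair hpy]
        · simp only [Equiv.apply_symm_apply]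
          ring
        · simp [e3, e4, -nextLeg_symm_apply]
        · simp [e1, e2, hp0, -nextLeg_symm_apply]
      · intro w hw
        simp only [Set.mem_insert_iff, Set.mem_singleton_iff] at hw
        rcases hw with rfl | rfl | rfl | rfl | rfl | rfl | rfl | rfl
        · exact ⟨y₀, by simp, Or.inl rfl⟩
        · exact ⟨y₀, by simp, Or.inr rfl⟩
        · exact ⟨(nextLeg _).symm y₀, by simp, Or.inr (by rw [Equiv.apply_symm_apply])⟩
        · exact ⟨(nextLeg _).symm y₀, by simp, Or.inl rfl⟩
        · exact ⟨y, by simp, Or.inl rfl⟩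
        · exact ⟨y, by simp, Or.inr rfl⟩
        · exact ⟨(nextLeg _).symm y, by simp, Or.inr (by rw [Equiv.apply_symm_apply])⟩
        · exact ⟨(nextLeg _).symm y, by simp, Or.inl rfl⟩
      · rw [sum_norm_sq_edgeWeight hB]
        ring
  | none =>
    have hlegs : edgeLegs e₀ = {y₀} := by
      ext h
      simp [edgeLegs, hfin, ← hy₀]
    have hLR : ((y₀, true) : (G.V × Fin q) × Bool) ≠ (y₀, false) := by simp
    refine ⟨∅, 1, (Fintype.card Y ^ 2 : ℝ)⁻¹ * ∑ z, ‖G.vertexProduct E z‖ ^ 2, one_pos,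
      by positivity, by simp, fun X => ⟨fun z => ∑ a, ∑ b,
        X (J.symm (z (y₀, true), z (y₀, false)), J.symm (a, b)) * G.vertexProduct E
          (Function.update (Function.update z (y₀, true) a) (y₀, false) b), ?_, ?_, ?_, ?_⟩⟩
    · intro z z' h
      rw [show z = z' from funext fun w => h w fun hw => hw.elim]
    · intro L hL
      obtain ⟨F', hF', hFF⟩ := hwires L
      have hout : ∀ w ∈ wireEnds (nextLeg _) L, w.1 ≠ y₀ := fun w hw h =>
        Set.disjoint_left.1 hL hw (by rw [hlegs]; exact h)
      refine ⟨fun z => ∑ a, ∑ b, X (J.symm (z (y₀, true), z (y₀, false)), J.symm (a, b)) *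
        F' (Function.update (Function.update z (y₀, true) a) (y₀, false) b), fun z z' hz => ?_,
        fun z => ?_⟩
      · have h : ∀ i, z (y₀, i) = z' (y₀, i) := fun i => hz _ fun hw => hout _ hw rfl
        simp only [h]
        refine Finset.sum_congr rfl fun a _ => Finset.sum_congr rfl fun b _ =>
          congrArg _ (hF' _ _ fun w hw => ?_)
        simp only [Function.update_apply]
        split_ifs <;> try rfl
        exact hz w hw
      · simp only [Finset.mul_sum]
        refine Finset.sum_congr rfl fun a _ => Finset.sum_congr rfl fun b _ => ?_
        rw [hFF, mul_left_comm]
        congr 1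
        refine Finset.prod_congr rfl fun h hh => ?_
        have n1 : h ≠ y₀ := hout (h, true) ⟨h, hh, Or.inl rfl⟩
        have n2 : nextLeg _ h ≠ y₀ := hout (nextLeg _ h, false) ⟨h, hh, Or.inr rfl⟩
        rw [Function.update_of_ne (by simp), Function.update_of_ne (by simpa using n1),
          Function.update_of_ne (fun h' => n2 (congrArg Prod.fst h')), Function.update_of_ne (by simp)]
    · intro b M hM
      have hMu : ∀ z i a, M (Function.update z (y₀, i) a) = M z := fun z i a =>
        hM.update (by rw [hlegs]; exact rfl) z a
      have hδ : ∀ z, freeDelta J e₀ b z =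
          if b ⟨e₀, by simp [hfin]⟩ = J.symm (z (y₀, true), z (y₀, false)) then 1 else 0 := fun z => by
        simp [freeDelta, hfin, legIndex, ← hy₀]
      have hres : ∀ f : ((G.V × Fin q) × Bool → Y) → ℂ,
          ∑ z, ∑ a, ∑ b, f (Function.update (Function.update z (y₀, true) a) (y₀, false) b) =
            Fintype.card Y ^ 2 * ∑ z, f z := by
        intro f
        rw [sum_update_complex (y₀, true) fun z => ∑ b, f (Function.update z (y₀, false) b),
          sum_update_complex (y₀, false) f]
        ring
      have hY' : (Fintype.card Y : ℂ) ^ 2 ≠ 0 := by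
        have : (Fintype.card Y : ℂ) ≠ 0 := by exact_mod_cast hY.ne'
        positivity
      apply mul_left_cancel₀ hY'
      rw [← hres]
      simp only [Complex.ofReal_one, one_mul]
      rw [← hres]
      refine Finset.sum_congr rfl fun z _ => ?_
      -- the delta function selects the term of the sum over the indices at the free end
      set s₀ := b ⟨e₀, by simp [hfin]⟩ with hs₀
      have hup : ∀ a a' a'' b'', Function.update (Function.update (Function.update
          (Function.update z (y₀, true) a) (y₀, false) a') (y₀, true) a'') (y₀, false) b'' =
          Function.update (Function.update z (y₀, true) a'') (y₀, false) b'' := by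
        intro a a' a'' b''
        rw [Function.update_comm hLR, Function.update_idem, Function.update_comm hLR.symm,
          Function.update_idem, Function.update_comm hLR]
      simp only [hδ, hMu, hup, Function.update_self, Function.update_of_ne hLR]
      have hsel : ∀ f : Qudit k → ℂ, ∑ a, ∑ a', f (J.symm (a, a')) *
          (M z * if s₀ = J.symm (a, a') then 1 else 0) = f s₀ * M z := by
        intro f
        rw [← Fintype.sum_prod_type' (fun a a' => f (J.symm (a, a')) *
          (M z * if s₀ = J.symm (a, a') then 1 else 0)),
          Equiv.sum_comp J.symm (fun s => f s * (M z * if s₀ = s then 1 else 0))]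
        simp
      rw [hsel fun s => ∑ a, ∑ b, X (s, J.symm (a, b)) * G.vertexProduct E
          (Function.update (Function.update z (y₀, true) a) (y₀, false) b)]
      simp only [Finset.sum_mul]
      refine Finset.sum_congr rfl fun a _ => Finset.sum_congr rfl fun a' _ => ?_
      rw [matFactor_none hfin]
      simp only [legIndex, ← hy₀, Function.update_self, Function.update_of_ne hLR]
      ring
    · obtain ⟨F', hF', hFF⟩ := hwires {y₀, (nextLeg _).symm y₀}
      have h := sum_norm_sq_apply_matrix h₁ h₂ (o₁ := (y₀, true)) (o₂ := (y₀, false))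
        (p₁ := (nextLeg _ y₀, false)) (p₂ := ((nextLeg _).symm y₀, true)) (F' := F')
        (F := G.vertexProduct E) (by simp) (by simp) (by simp)
        (fun h => hp0 (congrArg Prod.fst h)) (fun h => hn0 (congrArg Prod.fst h)) (by simp)
        (fun x y a b => X (J.symm (x, y), J.symm (a, b))) (fun z => ?_) (hF'.mono ?_)
      · have hX : ∑ x, ∑ y, ∑ a, ∑ b, ‖X (J.symm (x, y), J.symm (a, b))‖ ^ 2 = ‖X‖ ^ 2 := by
          rw [sum_norm_sq_curry, ← Equiv.sum_comp J.symm, Fintype.sum_prod_type]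
          refine Finset.sum_congr rfl fun x _ => Finset.sum_congr rfl fun y _ => ?_
          rw [← Equiv.sum_comp J.symm, Fintype.sum_prod_type]
        rw [hX] at h
        rw [mul_assoc, mul_comm _ (‖X‖ ^ 2), ← h, inv_mul_cancel_left₀ (by positivity)]
      · rw [hFF, Finset.prod_pair hp0]
        simp only [Equiv.apply_symm_apply]
      · intro w hw
        simp only [Set.mem_insert_iff, Set.mem_singleton_iff] at hw
        rcases hw with rfl | rfl | rfl | rfl
        · exact ⟨y₀, by simp, Or.inl rfl⟩
        · exact ⟨y₀, by simp, Or.inr rfl⟩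
        · exact ⟨(nextLeg _).symm y₀, by simp, Or.inr (by rw [Equiv.apply_symm_apply])⟩
        · exact ⟨(nextLeg _).symm y₀, by simp, Or.inl rfl⟩

/-- If the edges can be ordered by a distance from `e₀`, then the boundary state of the network is an
isometric function of the matrix inserted on `e₀`. -/
theorem exists_isIsometricAt (hq : 2 ≤ q) {J : Qudit k ≃ Y × Y} {E : Fin q → Y → Y → ℂ}
    {A : LegTensor (Fin q) k} (hA : IsWired J E A) {c : ℝ} (hc : 0 < c) {B : LegTensor (Fin 2) k}
    (hB : IsDual c fun bl br tl tr => B ![J.symm (bl, br), J.symm (tl, tr)])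
    (hsplit : ∀ u, IsSplitUnitary J (strandRep (k := k) u))
    (hG : G.IsProper) {e₀ : G.E} {r : G.V × Fin q → ℝ} (hr : G.IsDistance e₀ r) :
    ∃ C, IsIsometricAt A B e₀ C := by
  obtain ⟨x₀, -⟩ := Function.ne_iff.1 hA.ne_zero
  have hY : 0 < (Fintype.card Y : ℝ) := by
    have : Nonempty Y := ⟨(J (x₀ 0)).1⟩
    exact_mod_cast Fintype.card_pos
  obtain ⟨T₀, κ, K, hκ, hK, hT₀, hF⟩ := exists_base (G := G) hq hA hc hB hG e₀
  classical
  set m := Fintype.card ({h // h ∉ Set.range fun f : G.Free => G.start f.1} → Qudit k) with hm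
  set n := (Finset.univ.filter fun x : {e : G.E // ¬ (G.finish e).isNone} => x.1 ≠ e₀).card with hn
  have hm0 : 0 < (m : ℝ) := by
    have : 0 < m := Fintype.card_pos
    exact_mod_cast this
  refine ⟨((κ * Fintype.card Y ^ (4 * n)) ^ 2)⁻¹ * (m * ((c * Fintype.card Y ^ 2) ^ n * K)),
    by positivity, fun g X => ?_⟩
  obtain ⟨F₀, h1, h2, h3, h4⟩ := hF X
  obtain ⟨m', n', hm', hn', h⟩ := norm_insertion_of_base hA hB hsplit hG hr g X hT₀ h1 h2 h3
  have e1 : m' = m := by rw [hm', hm]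
  have e2 : n' = n := by rw [hn', hn]
  rw [e1, e2, h4] at h
  rw [mul_assoc, eq_inv_mul_iff_mul_eq₀ (by positivity), h]
  ring

end Network

end SpinGraph

/-! ### Non-crossing Bell pairs connect adjacent legs -/

namespace BellTensor

theorem bellPair_ne_zero_iff {a b : Fin 2} : bellPair a b ≠ 0 ↔ a ≠ b := by
  fin_cases a <;> fin_cases b <;> simp [bellPair]

theorem bellPair_swap (a b : Fin 2) : bellPair b a = -bellPair a b := by
  fin_cases a <;> fin_cases b <;> simp [bellPair]

theorem sum_conj_bellPair (o o' : Fin 2) :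
    ∑ p, conj (bellPair o p) * bellPair o' p = if o = o' then 1 / 2 else 0 := by
  have h : ((Real.sqrt 2 : ℝ) : ℂ) ^ 2 = 2 := by
    rw [← Complex.ofReal_pow, Real.sq_sqrt (by norm_num)]; norm_num
  have h' : ((Real.sqrt 2 : ℝ) : ℂ)⁻¹ * ((Real.sqrt 2 : ℝ) : ℂ)⁻¹ = 2⁻¹ := by
    rw [← mul_inv, ← pow_two, h]
  fin_cases o <;> fin_cases o' <;> simp [bellPair, Fin.sum_univ_two, h']

variable {q k m : ℕ} (e : Fin m × Fin 2 ≃ Fin q × Fin k)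

/-- The qubit which forms a Bell pair with a given one. -/
def partner (a : Fin q × Fin k) : Fin q × Fin k := e ((e.symm a).1, 1 - (e.symm a).2)

theorem partner_apply (r : Fin m) (σ : Fin 2) : partner e (e (r, σ)) = e (r, 1 - σ) := by
  simp [partner]

theorem partner_partner (a : Fin q × Fin k) : partner e (partner e a) = a := by
  obtain ⟨⟨r, σ⟩, rfl⟩ := e.surjective a
  rw [partner_apply, partner_apply, sub_sub_cancel]

theorem bellTensor_ne_zero_iff (x : Fin q → Qudit k) :
    bellTensor e x ≠ 0 ↔ ∀ a, x a.1 a.2 ≠ x (partner e a).1 (partner e a).2 := by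
  unfold bellTensor
  rw [Finset.prod_ne_zero_iff]
  simp only [Finset.mem_univ, true_imp_iff, bellPair_ne_zero_iff]
  constructor
  · intro h a
    obtain ⟨⟨r, σ⟩, rfl⟩ := e.surjective a
    rw [partner_apply]
    fin_cases σ
    · exact h r
    · exact (h r).symm
  · intro h r
    have := h (e (r, 0))
    rw [partner_apply] at this
    exact this

/-- Qubits that do not form a Bell pair can take the same value. -/
theorem exists_bellTensor_ne_zero (u v : Fin q × Fin k) (huv : v ≠ partner e u) :
    ∃ x : Fin q → Qudit k, bellTensor e x ≠ 0 ∧ x u.1 u.2 = x v.1 v.2 := by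
  obtain ⟨⟨r, σ⟩, rfl⟩ := e.surjective u
  obtain ⟨⟨r', τ⟩, rfl⟩ := e.surjective v
  rw [partner_apply] at huv
  let f : Fin m → Fin 2 := fun s => if s = r then σ else τ
  refine ⟨fun i s => f (e.symm (i, s)).1 + (e.symm (i, s)).2, ?_, ?_⟩
  · rw [bellTensor_ne_zero_iff]
    intro a
    obtain ⟨⟨s, ρ⟩, rfl⟩ := e.surjective a
    rw [partner_apply]
    simp only [Prod.mk.eta, Equiv.symm_apply_apply]
    intro h
    have h2 : ∀ ρ : Fin 2, ρ ≠ 1 - ρ := by decide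
    exact h2 ρ (add_left_cancel h)
  · have h2 : ∀ ρ : Fin 2, ρ + ρ = 0 := by decide
    simp only [Prod.mk.eta, Equiv.symm_apply_apply, f, if_true]
    by_cases hr : r' = r
    · have h3 : ∀ σ τ : Fin 2, τ ≠ 1 - σ → τ = σ := by decide
      rw [if_pos hr, h3 σ τ fun h => huv (by rw [hr, h])]
    · rw [if_neg hr, h2, h2]

variable {e}

/-- A Bell pair within a leg would contradict the isometry from this leg to the other ones. -/
theorem partner_fst_ne (hiso : (bellTensor e).IsOneIsometric) (i : Fin q) (s : Fin k) :
    (partner e (i, s)).1 ≠ i := by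
  intro h
  obtain ⟨c, hc, hsum⟩ := hiso i
  have h1 := hsum (fun _ _ => 0) (fun _ _ => 0)
  rw [if_pos rfl, Finset.sum_eq_zero] at h1
  · exact hc.ne (by exact_mod_cast h1)
  · intro r _
    have : bellTensor e (LegTensor.glue {i} (fun _ _ => 0) r) = 0 := by
      by_contra hne
      refine (bellTensor_ne_zero_iff e _).1 hne (i, s) ?_
      have h0 : ∀ l, l = i → ∀ t : Fin k,
          LegTensor.glue (k := k) {i} (fun _ _ => 0) r l t = 0 := by
        rintro l rfl t
        simp [LegTensor.glue]
      rw [h0 _ rfl, h0 _ h]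
    rw [this, mul_zero]

variable [NeZero q]

theorem partner_shift (hcyc : ∀ x : Fin q → Qudit k, bellTensor e (fun i => x (i + 1)) =
    bellTensor e x) (i : Fin q) (s : Fin k) :
    partner e (i + 1, s) = ((partner e (i, s)).1 + 1, (partner e (i, s)).2) := by
  by_contra h
  obtain ⟨x, hx, hxx⟩ := exists_bellTensor_ne_zero e (i + 1, s)
    ((partner e (i, s)).1 + 1, (partner e (i, s)).2) (Ne.symm h)
  rw [← hcyc, bellTensor_ne_zero_iff] at hx
  exact hx (i, s) hxx

theorem partner_eq (hcyc : ∀ x : Fin q → Qudit k, bellTensor e (fun i => x (i + 1)) =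
    bellTensor e x) (i : Fin q) (s : Fin k) :
    partner e (i, s) = (i + (partner e (0, s)).1, (partner e (0, s)).2) := by
  have h : ∀ (n : ℕ) (hn : n < q), partner e (⟨n, hn⟩, s) =
      (⟨n, hn⟩ + (partner e (0, s)).1, (partner e (0, s)).2) := by
    intro n
    induction n with
    | zero =>
      intro hn
      rw [show (⟨0, hn⟩ : Fin q) = 0 from rfl, zero_add]
    | succ n ih =>
      intro hn
      have hsucc : (⟨n + 1, hn⟩ : Fin q) = ⟨n, by omega⟩ + 1 := by
        apply Fin.ext
        rw [Fin.val_add, Fin.val_one', Nat.add_mod_mod, Nat.mod_eq_of_lt hn]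
      rw [hsucc, partner_shift hcyc, ih (by omega)]
      simp only [Prod.mk.injEq, and_true]
      rw [add_right_comm]
  exact h i.1 i.2

/-- A pair of non-adjacent legs would cross its own image under a rotation by one leg. -/
theorem partner_adjacent (hq : 3 ≤ q) (hcyc : ∀ x : Fin q → Qudit k,
    bellTensor e (fun i => x (i + 1)) = bellTensor e x)
    (hiso : (bellTensor e).IsOneIsometric) (hnc : NonCrossing e) (s : Fin k) :
    (partner e (0, s)).1 = 1 ∨ (partner e (0, s)).1 = -1 := by
  have hd0 := partner_fst_ne hiso 0 s
  have hp1 := partner_eq hcyc 1 s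
  set d := (partner e (0, s)).1 with hd
  set t := (partner e (0, s)).2 with ht
  by_contra hcon
  push Not at hcon
  have v1 : ((1 : Fin q) : ℕ) = 1 := by rw [Fin.val_one', Nat.mod_eq_of_lt (by omega)]
  have hd0' : (d : ℕ) ≠ 0 := fun h => hd0 (Fin.ext (by simpa using h))
  have hd1 : (d : ℕ) ≠ 1 := fun h => hcon.1 (Fin.ext (by rw [h, v1]))
  have hdq : (d : ℕ) + 1 ≠ q := by
    intro h
    apply hcon.2
    rw [eq_neg_iff_add_eq_zero]
    apply Fin.ext
    rw [Fin.val_add, v1, h]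
    simp
  have hdlt := d.2
  have v2 : ((1 + d : Fin q) : ℕ) = d + 1 := by
    rw [Fin.val_add, v1, Nat.mod_eq_of_lt (by omega), add_comm]
  obtain ⟨⟨r, σ⟩, hr⟩ := e.surjective (0, s)
  obtain ⟨⟨r', τ⟩, hr'⟩ := e.surjective (1, s)
  have e1 : e (r, 1 - σ) = (d, t) := by rw [← partner_apply, hr]
  have e2 : e (r', 1 - τ) = (1 + d, t) := by rw [← partner_apply, hr', hp1]
  refine hnc r r' σ τ ?_
  rw [hr, hr', e1, e2]
  simp only [Fin.lt_def, v1, v2, Fin.val_zero]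
  omega

end BellTensor

/-! ### Splitting the legs into a left and a right half -/

section Split

variable {k : ℕ} {P : Fin k → Prop} [DecidablePred P] {π : Fin k → Fin k}

/-- Split the strands of a leg into those in `P`, which form its left part, and the other ones,
which form its right part and are labelled by their images under the involution `π`. -/
def splitEquiv (hπ : ∀ s, π (π s) = s) (hP : ∀ s, P (π s) ↔ ¬ P s) :
    Qudit k ≃ ({s // P s} → Fin 2) × ({s // P s} → Fin 2) where
  toFun x := (fun l => x l, fun l => x (π l))
  invFun p s := if h : P s then p.1 ⟨s, h⟩ else p.2 ⟨π s, (hP s).2 h⟩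
  left_inv x := by
    funext s
    by_cases h : P s <;> simp [h, hπ]
  right_inv p := by
    refine Prod.ext (funext fun l => ?_) (funext fun l => ?_)
    · simp [l.2]
    · have : ¬ P (π l) := by rw [hP]; simpa using l.2
      simp [this, hπ]

theorem splitEquiv_symm_left (hπ : ∀ s, π (π s) = s) (hP : ∀ s, P (π s) ↔ ¬ P s)
    (a b : {s // P s} → Fin 2) (l : {s // P s}) : (splitEquiv hπ hP).symm (a, b) l = a l :=
  congrFun (congrArg Prod.fst ((splitEquiv hπ hP).apply_symm_apply (a, b))) l

theorem splitEquiv_symm_right (hπ : ∀ s, π (π s) = s) (hP : ∀ s, P (π s) ↔ ¬ P s)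
    (a b : {s // P s} → Fin 2) (l : {s // P s}) : (splitEquiv hπ hP).symm (a, b) (π l) = b l :=
  congrFun (congrArg Prod.snd ((splitEquiv hπ hP).apply_symm_apply (a, b))) l

theorem prod_split (hπ : ∀ s, π (π s) = s) (hP : ∀ s, P (π s) ↔ ¬ P s) (f : Fin k → ℂ) :
    ∏ s, f s = (∏ l : {s // P s}, f l) * ∏ l : {s // P s}, f (π l) := by
  rw [← Fintype.prod_subtype_mul_prod_subtype P f]
  congr 1
  let ε : {s // P s} ≃ {s // ¬ P s} :=
    { toFun := fun l => ⟨π l, by rw [hP]; simpa using l.2⟩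
      invFun := fun l => ⟨π l, by rw [hP]; exact l.2⟩
      left_inv := fun l => Subtype.ext (hπ l)
      right_inv := fun l => Subtype.ext (hπ l) }
  exact (Equiv.prod_comp ε fun s : {s // ¬ P s} => f s).symm

/-- A product of matrices acting on single strands is an isometry if the matrices are. -/
theorem isIso_prod {S : Type*} [Fintype S] [DecidableEq S] {U : S → Fin 2 → Fin 2 → ℂ} {c : ℝ}
    (hU : ∀ l o o', ∑ p, conj (U l o p) * U l o' p = if o = o' then (c : ℂ) else 0) :
    IsIso (c ^ Fintype.card S) fun a b : S → Fin 2 => ∏ l, U l (a l) (b l) := by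
  refine isIso_of_orthogonal fun o o' => ?_
  simp only [map_prod, ← Finset.prod_mul_distrib]
  rw [← Fintype.prod_sum (fun l p => conj (U l (o l) p) * U l (o' l) p)]
  simp only [hU]
  rw [Finset.prod_ite_zero]
  simp [funext_iff]

theorem SU2.sum_conj_entry_right (u : SU2) (b b' : Fin 2) :
    ∑ a, conj (u.1 b a) * u.1 b' a = if b = b' then 1 else 0 := by
  have h := (Matrix.mem_unitaryGroup_iff).1 (Matrix.specialUnitaryGroup_le_unitaryGroup u.2)
  have := congrFun (congrFun h b') b
  simp only [Matrix.mul_apply, Matrix.one_apply, Matrix.star_apply] at this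
  simp only [eq_comm (a := b)]
  exact (Finset.sum_congr rfl fun a _ => mul_comm _ _).trans this

theorem isSplitUnitary_strandRep (hπ : ∀ s, π (π s) = s) (hP : ∀ s, P (π s) ↔ ¬ P s) (u : SU2) :
    IsSplitUnitary (splitEquiv hπ hP) (strandRep u) := by
  have h1 := isIso_prod (S := {s // P s}) (U := fun _ => fun a b => u.1 a b) (c := 1)
    fun _ o o' => by simpa using SU2.sum_conj_entry_right u o o'
  have h2 := isIso_prod (S := {s // P s}) (U := fun _ => fun b a => u.1 a b) (c := 1)
    fun _ o o' => by simpa using SU2.sum_conj_entry u o o'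
  rw [one_pow] at h1 h2
  refine ⟨_, _, h1, h2, h1, h2, fun a b a' b' => ?_⟩
  unfold strandRep
  rw [prod_split hπ hP]
  simp only [splitEquiv_symm_left, splitEquiv_symm_right]

end Split

namespace BellTensor

variable {q k m : ℕ} [NeZero q] {e : Fin m × Fin 2 ≃ Fin q × Fin k}

/-- A strand is on the left of its leg if its Bell pair connects it with the next leg. -/
def IsLeft (e : Fin m × Fin 2 ≃ Fin q × Fin k) (s : Fin k) : Prop := (partner e (0, s)).1 = 1

instance : DecidablePred (IsLeft e) := fun _ => inferInstanceAs (Decidable (_ = _))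

/-- The strand at the other end of a Bell pair. -/
def opposite (e : Fin m × Fin 2 ≃ Fin q × Fin k) (s : Fin k) : Fin k := (partner e (0, s)).2

section

variable (hcyc : ∀ x : Fin q → Qudit k, bellTensor e (fun i => x (i + 1)) = bellTensor e x)
include hcyc

theorem partner_zero_opposite (s : Fin k) :
    partner e (0, opposite e s) = (-(partner e (0, s)).1, s) := by
  have h := partner_partner e (0, s)
  rw [show partner e (0, s) = ((partner e (0, s)).1, opposite e s) from rfl,
    partner_eq hcyc] at h
  have h1 := congrArg Prod.fst h
  have h2 := congrArg Prod.snd h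
  exact Prod.ext (eq_neg_of_add_eq_zero_right h1) h2

theorem opposite_opposite (s : Fin k) : opposite e (opposite e s) = s := by
  unfold opposite
  rw [show (partner e (0, s)).2 = opposite e s from rfl, partner_zero_opposite hcyc]

theorem isLeft_opposite (hq : 3 ≤ q)
    (hadj : ∀ s, (partner e (0, s)).1 = 1 ∨ (partner e (0, s)).1 = -1) (s : Fin k) :
    IsLeft e (opposite e s) ↔ ¬ IsLeft e s := by
  have hne : (1 : Fin q) ≠ -1 := by
    intro h
    have h1 : (1 : Fin q) + 1 = 0 := by rw [← eq_neg_iff_add_eq_zero]; exact h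
    have h2 := congrArg Fin.val h1
    rw [Fin.val_add, Fin.val_one', Nat.mod_eq_of_lt (by omega : 1 < q),
      Nat.mod_eq_of_lt (by omega)] at h2
    simp at h2
  unfold IsLeft
  rw [partner_zero_opposite hcyc]
  rcases hadj s with h | h
  · simp [h, hne.symm]
  · simp [h, hne.symm]

theorem partner_of_isLeft {s : Fin k} (hs : IsLeft e s) (i : Fin q) :
    partner e (i, s) = (i + 1, opposite e s) := by
  rw [partner_eq hcyc, show (partner e (0, s)).1 = 1 from hs]
  rfl

/-- The product over the Bell pairs as a product over their left ends. -/
theorem bellTensor_eq_prod (hq : 3 ≤ q)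
    (hadj : ∀ s, (partner e (0, s)).1 = 1 ∨ (partner e (0, s)).1 = -1) (x : Fin q → Qudit k) :
    bellTensor e x = ∏ i, ∏ l : {s // IsLeft e s},
      (if (e.symm (i, l.1)).2 = 0 then 1 else -1) * bellPair (x i l) (x (i + 1) (opposite e l)) := by
  rw [← Fintype.prod_prod_type' (fun (i : Fin q) (l : {s // IsLeft e s}) =>
    (if (e.symm (i, l.1)).2 = 0 then 1 else -1) * bellPair (x i l) (x (i + 1) (opposite e l)))]
  have hP := isLeft_opposite hcyc hq hadj
  have hother : ∀ i (l : {s // IsLeft e s}), ∀ σ r, e (r, σ) = (i, l.1) →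
      e (r, 1 - σ) = (i + 1, opposite e l.1) := by
    intro i l σ r h
    rw [← partner_of_isLeft hcyc l.2, ← h, partner_apply]
  let ρ : Fin q × {s // IsLeft e s} → Fin m := fun p => (e.symm (p.1, p.2.1)).1
  have hρ : ∀ p : Fin q × {s // IsLeft e s}, e (ρ p, (e.symm (p.1, p.2.1)).2) = (p.1, p.2.1) :=
    fun p => e.apply_symm_apply _
  have hinj : Function.Injective ρ := by
    intro p p' h
    have hp := hρ p
    have hp' := hρ p'
    rw [← h] at hp'
    have h2 : ∀ σ τ : Fin 2, τ = σ ∨ τ = 1 - σ := by decide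
    rcases h2 (e.symm (p.1, p.2.1)).2 (e.symm (p'.1, p'.2.1)).2 with h3 | h3
    · rw [h3, hp] at hp'
      exact Prod.ext (Prod.ext_iff.1 hp').1 (Subtype.ext (Prod.ext_iff.1 hp').2)
    · rw [h3, hother p.1 p.2 _ _ hp] at hp'
      have h4 : opposite e p.2.1 = p'.2.1 := congrArg Prod.snd hp'
      exact absurd p.2.2 ((hP p.2.1).1 (by rw [h4]; exact p'.2.2))
  have hsurj : Function.Surjective ρ := by
    intro r
    have key : ∀ σ, IsLeft e (e (r, σ)).2 → ∃ p, ρ p = r := fun σ h =>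
      ⟨((e (r, σ)).1, ⟨(e (r, σ)).2, h⟩), by simp [ρ]⟩
    by_cases h : IsLeft e (e (r, 0)).2
    · exact key 0 h
    · refine key 1 ?_
      have h5 : e (r, 1) = partner e (e (r, 0)) := by rw [partner_apply]; rfl
      rw [h5, show e (r, 0) = ((e (r, 0)).1, (e (r, 0)).2) from rfl, partner_eq hcyc]
      exact (hP _).2 h
  unfold bellTensor
  refine (Fintype.prod_bijective ρ ⟨hinj, hsurj⟩ _ _ fun p => ?_).symm
  have h1 := hρ p
  have h2 := hother p.1 p.2 _ _ h1
  have hσ : ∀ σ : Fin 2, σ = 0 ∨ σ = 1 := by decide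
  rcases hσ (e.symm (p.1, p.2.1)).2 with h | h
  · rw [h] at h1 h2
    rw [sub_zero] at h2
    rw [if_pos h, one_mul, h1, h2]
  · rw [h] at h1 h2
    rw [sub_self] at h2
    rw [if_neg (by rw [h]; decide), h1, h2, bellPair_swap (x p.1 p.2.1)]
    ring

/-- A cyclic tensor of Bell pairs between adjacent legs is a product of wires. -/
theorem isWired_bellTensor (hq : 3 ≤ q)
    (hadj : ∀ s, (partner e (0, s)).1 = 1 ∨ (partner e (0, s)).1 = -1) :
    IsWired (splitEquiv (opposite_opposite hcyc) (isLeft_opposite hcyc hq hadj))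
      (fun i a b => ∏ l : {s // IsLeft e s},
        (if (e.symm (i, l.1)).2 = 0 then 1 else -1) * bellPair (a l) (b l)) (bellTensor e) where
  eq_prod x := bellTensor_eq_prod hcyc hq hadj x
  isIso i := ⟨_, isIso_prod (c := 1 / 2) (U := fun (l : {s // IsLeft e s}) a b =>
    (if (e.symm (i, l.1)).2 = 0 then 1 else -1) * bellPair a b) fun l o o' => by
      have := sum_conj_bellPair o o'
      split_ifs at this ⊢ <;> simpa using this⟩
  isIso_swap i := ⟨_, isIso_prod (c := 1 / 2) (U := fun (l : {s // IsLeft e s}) a b =>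
    (if (e.symm (i, l.1)).2 = 0 then 1 else -1) * bellPair b a) fun l o o' => by
      have := sum_conj_bellPair o o'
      simp only [bellPair_swap o, bellPair_swap o']
      split_ifs at this ⊢ <;> simpa using this⟩
  ne_zero := by
    intro h
    have h2 : bellTensor e (fun i s => (e.symm (i, s)).2) ≠ 0 := by
      rw [bellTensor_ne_zero_iff]
      intro a
      obtain ⟨⟨s, ρ⟩, rfl⟩ := e.surjective a
      rw [partner_apply]
      simp only [Prod.mk.eta, Equiv.symm_apply_apply]
      have h2 : ∀ ρ : Fin 2, ρ ≠ 1 - ρ := by decide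
      exact h2 ρ
    exact h2 (congrFun h _)

end

end BellTensor

/-! ### The edge tensor is dual-unitary -/

namespace WireNet

section

variable {Y : Type*} [Fintype Y]

theorem IsIso₂.sum_norm_sq {c : ℝ} {β : Y → Y → Y → Y → ℂ} (h : IsIso₂ c β) :
    ∑ i₁, ∑ i₂, ∑ o₁, ∑ o₂, ‖β i₁ i₂ o₁ o₂‖ ^ 2 = c * Fintype.card Y ^ 2 := by
  classical
  have h1 : ∀ i₁ i₂, ∑ o₁, ∑ o₂, ‖β i₁ i₂ o₁ o₂‖ ^ 2 = c := by
    intro i₁ i₂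
    have := h fun a b => if a = i₁ then if b = i₂ then 1 else 0 else 0
    simpa [apply_ite norm, ite_pow] using this
  simp [h1]
  ring

/-- If `β`, dressed with isometries `E₁` and `E₂` at its inputs, is an isometry up to a non-zero factor,
then so is `β`. -/
theorem exists_isIso₂_of_dressed [Nonempty Y] {c₁ c₂ K R : ℝ} {E₁ E₂ : Y → Y → ℂ}
    {β : Y → Y → Y → Y → ℂ} (h₁ : IsIso c₁ E₁) (h₂ : IsIso c₂ E₂) (hK : K ≠ 0)
    (h : ∀ w : Y → Y → ℂ, R * ∑ o₁, ∑ o₂, ‖∑ i₁, ∑ i₂, β i₁ i₂ o₁ o₂ *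
      ∑ a, ∑ b, E₁ a i₁ * E₂ b i₂ * w a b‖ ^ 2 = K * ∑ a, ∑ b, ‖w a b‖ ^ 2) :
    ∃ c, IsIso₂ c β := by
  classical
  let L : (Y → Y → ℂ) →ₗ[ℂ] Y → Y → ℂ :=
    { toFun := fun w i₁ i₂ => ∑ a, ∑ b, E₁ a i₁ * E₂ b i₂ * w a b
      map_add' := fun w w' => by
        funext i₁ i₂
        simp [mul_add, Finset.sum_add_distrib]
      map_smul' := fun x w => by
        funext i₁ i₂
        simp only [Pi.smul_apply, smul_eq_mul, RingHom.id_apply, Finset.mul_sum]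
        exact Finset.sum_congr rfl fun a _ => Finset.sum_congr rfl fun b _ => by ring }
  have hL : ∀ w : Y → Y → ℂ, ∑ i₁, ∑ i₂, ‖L w i₁ i₂‖ ^ 2 = c₁ * c₂ * ∑ a, ∑ b, ‖w a b‖ ^ 2 := by
    intro w
    have e1 : ∀ i₂ i₁, L w i₁ i₂ = ∑ a, E₁ a i₁ * ∑ b, E₂ b i₂ * w a b := by
      intro i₂ i₁
      change ∑ a, ∑ b, E₁ a i₁ * E₂ b i₂ * w a b = _
      simp only [Finset.mul_sum, mul_assoc]
    rw [Finset.sum_comm]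
    simp only [e1, h₁ _]
    rw [← Finset.mul_sum, Finset.sum_comm, mul_assoc, Finset.mul_sum Finset.univ _ c₂]
    congr 1
    exact Finset.sum_congr rfl fun a _ => h₂ _
  have h' : ∀ w : Y → Y → ℂ, R * ∑ o₁, ∑ o₂, ‖∑ i₁, ∑ i₂, β i₁ i₂ o₁ o₂ * L w i₁ i₂‖ ^ 2 =
    K * ∑ a, ∑ b, ‖w a b‖ ^ 2 := h
  have hzero : ∀ w : Y → Y → ℂ, ∑ a, ∑ b, ‖w a b‖ ^ 2 = 0 → w = 0 := by
    intro w hw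
    funext a b
    rw [Finset.sum_eq_zero_iff_of_nonneg fun a _ => by positivity] at hw
    have := hw a (Finset.mem_univ a)
    rw [Finset.sum_eq_zero_iff_of_nonneg fun b _ => by positivity] at this
    simpa using this b (Finset.mem_univ b)
  have hinj : Function.Injective L := by
    rw [injective_iff_map_eq_zero]
    intro w hw
    apply hzero
    have := h' w
    rw [hw] at this
    simp only [Pi.zero_apply, mul_zero, Finset.sum_const_zero, norm_zero, ne_eq, OfNat.ofNat_ne_zero,
      not_false_eq_true, zero_pow] at this
    exact (mul_eq_zero.1 this.symm).resolve_left hK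
  have hR : c₁ * c₂ * R ≠ 0 := by
    intro h0
    obtain ⟨y⟩ := ‹Nonempty Y›
    have hne : (1 : Y → Y → ℂ) ≠ 0 := fun hh => one_ne_zero (congrFun (congrFun hh y) y)
    have h1 := h' 1
    have h2 : R ≠ 0 := by
      rintro rfl
      rw [zero_mul] at h1
      exact hne (hzero _ ((mul_eq_zero.1 h1.symm).resolve_left hK))
    have h3 : c₁ * c₂ = 0 := (mul_eq_zero.1 h0).resolve_right h2
    have h4 := hL 1
    rw [h3, zero_mul] at h4
    exact hne (hinj ((hzero _ h4).trans (map_zero L).symm))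
  refine ⟨K / (c₁ * c₂ * R), fun v => ?_⟩
  obtain ⟨w, rfl⟩ := LinearMap.injective_iff_surjective.1 hinj v
  rw [div_mul_eq_mul_div, eq_div_iff hR, hL]
  linear_combination (c₁ * c₂) * h' w

end

end WireNet

section EdgeTensor

variable {q k : ℕ} {Y : Type} [Fintype Y] {J : Qudit k ≃ Y × Y} {B : LegTensor (Fin 2) k}

theorem exists_isIso₂_start_finish (hB : B.IsOneIsometric) : ∃ c, 0 < c ∧
    IsIso₂ c fun bl br tl tr => B ![J.symm (bl, br), J.symm (tl, tr)] := by
  classical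
  obtain ⟨c, hc, h⟩ := hB 0
  refine ⟨c, hc, fun v => ?_⟩
  let u : Unique {l : Fin 2 // l ∉ ({0} : Finset (Fin 2))} :=
    { default := ⟨1, by simp⟩
      uniq := by decide }
  have hglue : ∀ a (r : {l : Fin 2 // l ∉ ({0} : Finset (Fin 2))} → Qudit k),
      LegTensor.glue {0} a r = ![a ⟨0, by simp⟩, r default] := by
    intro a r
    funext l
    fin_cases l
    · rfl
    · simp [LegTensor.glue]; rfl
  have horth : ∀ p p' : Y × Y, ∑ t : Y × Y, conj (B ![J.symm p, J.symm t]) * B ![J.symm p', J.symm t] =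
      if p = p' then (c : ℂ) else 0 := by
    intro p p'
    have h1 := h (fun _ => J.symm p) (fun _ => J.symm p')
    simp only [hglue] at h1
    rw [← Equiv.sum_comp (Equiv.funUnique _ (Qudit k)).symm, ← Equiv.sum_comp J.symm] at h1
    have h2 : ((fun _ => J.symm p : {l : Fin 2 // l ∈ ({0} : Finset (Fin 2))} → Qudit k) =
        fun _ => J.symm p') ↔ p = p' :=
      ⟨fun hh => J.symm.injective (congrFun hh ⟨0, by simp⟩), fun hh => by rw [hh]⟩
    simp only [h2] at h1
    exact h1
  have := sum_norm_sq_of_orthogonal horth fun p => v p.1 p.2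
  simpa only [Fintype.sum_prod_type] using this

section Double

variable [NeZero q] {E : Fin q → Y → Y → ℂ} {A : LegTensor (Fin q) k}

theorem IsWired.eq_mul_mul (hA : IsWired J E A) {i j : Fin q} (hij : i ≠ j) (x : Fin q → Qudit k) :
    A x = E i (J (x i)).1 (J (x (i + 1))).2 * E j (J (x j)).1 (J (x (j + 1))).2 *
      ∏ l ∈ Finset.univ \ {i, j}, E l (J (x l)).1 (J (x (l + 1))).2 := by
  rw [hA.eq_prod, ← Finset.prod_sdiff (Finset.subset_univ {i, j}), Finset.prod_pair hij, mul_comm]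

/-- The double tensor is isometric from the legs `i₁` and `j₁`, and only the right half of `i₁` and the
left half of `j₁` are joined to the edge by wires. When the other two halves are fixed to an index `y₀`,
the isometry from the remaining indices is that of the edge tensor from one side to the other, dressed
with wires. -/
theorem exists_isIso₂_left_right [Nonempty Y] (hq : 3 ≤ q) (hA : IsWired J E A)
    (hAB : (doubleTensor A B).IsIsometricFrom
      (Finset.univ.filter fun l => Sum.elim (fun i => i.1) (fun j => j.1) l = 0)) :
    ∃ c, IsIso₂ c fun bl tr tl br => B ![J.symm (bl, br), J.symm (tl, tr)] := by
  classical
  obtain ⟨c, hc, h⟩ := hAB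
  have n1 : (1 : Fin q) ≠ 0 := by
    intro hh
    have := congrArg Fin.val hh
    rw [Fin.val_one', Nat.mod_eq_of_lt (by omega)] at this
    simp at this
  have n2 : (1 + 1 : Fin q) ≠ 0 := by
    intro hh
    have := congrArg Fin.val hh
    rw [Fin.val_add, Fin.val_one', Nat.mod_eq_of_lt (by omega : 1 < q),
      Nat.mod_eq_of_lt (by omega)] at this
    simp at this
  set I : Finset ({i : Fin q // i ≠ -1} ⊕ {j : Fin q // j ≠ 1}) :=
    Finset.univ.filter fun l => Sum.elim (fun i => i.1) (fun j => j.1) l = 0 with hI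
  obtain ⟨y₀⟩ := ‹Nonempty Y›
  let φ : Y × Y → {l // l ∈ I} → Qudit k := fun p l =>
    Sum.elim (fun _ => J.symm (y₀, p.1)) (fun _ => J.symm (p.2, y₀)) l.1
  have hφ : Function.Injective φ := by
    intro p p' hp
    have e1 := congrFun hp ⟨Sum.inl ⟨0, by simpa [eq_comm] using n1⟩, by simp [hI]⟩
    have e2 := congrFun hp ⟨Sum.inr ⟨0, n1.symm⟩, by simp [hI]⟩
    have e3 := J.symm.injective e1
    have e4 := J.symm.injective e2
    exact Prod.ext (congrArg Prod.snd e3) (congrArg Prod.fst e4)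
  let ι : {l // l ∉ I} → Fin q ⊕ Fin q := fun l => Sum.map (fun i => i.1) (fun j => j.1) l.1
  have hι : Function.Injective ι :=
    (Sum.map_injective.2 ⟨Subtype.val_injective, Subtype.val_injective⟩).comp
      Subtype.val_injective
  set T := doubleTensor A B with hT
  have hiso : ∀ w : Y → Y → ℂ, ∑ z : (Fin q ⊕ Fin q) × Bool → Y,
      ‖∑ p : Y × Y, T (LegTensor.glue I (φ p) (legIndex J z ∘ ι)) * w p.1 p.2‖ ^ 2 =
      Fintype.card ({h // h ∉ Set.range ι} → Qudit k) * c * ∑ a, ∑ b, ‖w a b‖ ^ 2 := by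
    intro w
    rw [show ∑ z : (Fin q ⊕ Fin q) × Bool → Y,
        ‖∑ p : Y × Y, T (LegTensor.glue I (φ p) (legIndex J z ∘ ι)) * w p.1 p.2‖ ^ 2 =
        ∑ x, ‖∑ p : Y × Y, T (LegTensor.glue I (φ p) (x ∘ ι)) * w p.1 p.2‖ ^ 2 from
      Equiv.sum_comp (legEquiv J) fun x => ‖∑ p : Y × Y,
        T (LegTensor.glue I (φ p) (x ∘ ι)) * w p.1 p.2‖ ^ 2, sum_comp_injective hι fun r =>
        ‖∑ p : Y × Y, T (LegTensor.glue I (φ p) r) * w p.1 p.2‖ ^ 2,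
      sum_norm_sq_of_orthogonal (E := fun p r => T (LegTensor.glue I (φ p) r)) (c := c)
        (fun p p' => by rw [h]; simp only [hφ.eq_iff]) fun p => w p.1 p.2, nsmul_eq_mul,
      Fintype.sum_prod_type, mul_assoc]
  let P₁ : ((Fin q ⊕ Fin q) × Bool → Y) → ℂ := fun z => ∏ l ∈ Finset.univ \ {-1, -1 - 1},
    E l (if l = 0 then y₀ else z (Sum.inl l, true)) (z (Sum.inl (l + 1), false))
  let P₂ : ((Fin q ⊕ Fin q) × Bool → Y) → ℂ := fun z => ∏ l ∈ Finset.univ \ {0, 1},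
    E l (z (Sum.inr l, true)) (if l + 1 = 0 then y₀ else z (Sum.inr (l + 1), false))
  let p₁ : (Fin q ⊕ Fin q) × Bool := (Sum.inl (-1 - 1), true)
  let p₂ : (Fin q ⊕ Fin q) × Bool := (Sum.inr (1 + 1), false)
  have m0 : (-1 : Fin q) ≠ 0 := neg_ne_zero.2 n1
  have m1 : (-1 - 1 : Fin q) ≠ 0 := by
    rw [show (-1 - 1 : Fin q) = -(1 + 1) by abel]
    exact neg_ne_zero.2 n2
  have m2 : (-1 : Fin q) ≠ -1 - 1 := by
    intro hh
    exact n1 (sub_eq_self.1 hh.symm)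
  have hA₁ : ∀ z (p : Y × Y) (s : Qudit k),
      A (fun i => if h : i = -1 then s else
        LegTensor.glue I (φ p) (legIndex J z ∘ ι) (Sum.inl ⟨i, h⟩)) =
      E (-1) (J s).1 p.1 * E (-1 - 1) (z p₁) (J s).2 * P₁ z := by
    intro z p s
    have hleg : ∀ i (hi : i ≠ -1), LegTensor.glue I (φ p) (legIndex J z ∘ ι) (Sum.inl ⟨i, hi⟩) =
        if i = 0 then J.symm (y₀, p.1) else legIndex J z (Sum.inl i) := by
      intro i hi
      unfold LegTensor.glue
      by_cases hi0 : i = 0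
      · rw [dif_pos (by simp [hI, hi0]), if_pos hi0]
        rfl
      · rw [dif_neg (by simp [hI, hi0]), if_neg hi0]
        rfl
    simp only [hleg]
    rw [hA.eq_mul_mul m2]
    refine congr_arg₂ _ (congr_arg₂ _ ?_ ?_) (Finset.prod_congr rfl fun l hl => ?_)
    · simp [m0.symm]
    · simp [m1, m2.symm, legIndex, p₁]
    · simp only [Finset.mem_sdiff, Finset.mem_univ, true_and, Finset.mem_insert,
        Finset.mem_singleton, not_or] at hl
      have l1 : l + 1 ≠ -1 := fun hh => hl.2 (eq_sub_of_add_eq hh)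
      have l0 : l + 1 ≠ 0 := fun hh => hl.1 (eq_neg_of_add_eq_zero_left hh)
      by_cases h0 : l = 0
      · simp only [dif_neg hl.1, dif_neg l1, if_pos h0, if_neg l0]
        simp [legIndex]
      · simp only [dif_neg hl.1, dif_neg l1, if_neg h0, if_neg l0]
        simp [legIndex]
  have hA₂ : ∀ z (p : Y × Y) (t : Qudit k),
      A (fun j => if h : j = 1 then t else
        LegTensor.glue I (φ p) (legIndex J z ∘ ι) (Sum.inr ⟨j, h⟩)) =
      E 0 p.2 (J t).2 * E 1 (J t).1 (z p₂) * P₂ z := by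
    intro z p t
    have hleg : ∀ j (hj : j ≠ 1), LegTensor.glue I (φ p) (legIndex J z ∘ ι) (Sum.inr ⟨j, hj⟩) =
        if j = 0 then J.symm (p.2, y₀) else legIndex J z (Sum.inr j) := by
      intro j hj
      unfold LegTensor.glue
      by_cases hj0 : j = 0
      · rw [dif_pos (by simp [hI, hj0]), if_pos hj0]
        rfl
      · rw [dif_neg (by simp [hI, hj0]), if_neg hj0]
        rfl
    simp only [hleg]
    rw [hA.eq_mul_mul n1.symm]
    refine congr_arg₂ _ (congr_arg₂ _ ?_ ?_) (Finset.prod_congr rfl fun l hl => ?_)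
    · simp [n1.symm]
    · simp [n1, n2, legIndex, p₂]
    · simp only [Finset.mem_sdiff, Finset.mem_univ, true_and, Finset.mem_insert,
        Finset.mem_singleton, not_or] at hl
      have l1 : l + 1 ≠ 1 := fun hh => hl.1 (by simpa using hh)
      by_cases h0 : l + 1 = 0
      · simp only [dif_neg hl.2, dif_neg l1, if_pos h0, if_neg hl.1]
        simp [legIndex]
      · simp only [dif_neg hl.2, dif_neg l1, if_neg h0, if_neg hl.1]
        simp [legIndex]
  obtain ⟨c₁, h₁⟩ := hA.isIso_swap (-1 - 1)
  obtain ⟨c₂, h₂⟩ := hA.isIso 1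
  obtain ⟨c₃, h₃⟩ := hA.isIso_swap (-1)
  obtain ⟨c₄, h₄⟩ := hA.isIso 0
  have hNpos : (0 : ℝ) < Fintype.card ({h // h ∉ Set.range ι} → Qudit k) := by
    exact_mod_cast Fintype.card_pos
  have hYpos : (0 : ℝ) < Fintype.card Y := by
    exact_mod_cast Fintype.card_pos_iff.2 ⟨y₀⟩
  have hne : Nonempty Y := ⟨y₀⟩
  refine exists_isIso₂_of_dressed (R := c₁ * c₂ * ∑ z, ‖P₁ z * P₂ z‖ ^ 2)
    (K := Fintype.card Y ^ 2 * (Fintype.card ({h // h ∉ Set.range ι} → Qudit k) * c)) h₃ h₄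
    (by positivity) fun w => ?_
  let γ : Y → Y → ℂ := fun br tl => ∑ bl, ∑ tr, B ![J.symm (bl, br), J.symm (tl, tr)] *
    ∑ a, ∑ b, E (-1) bl a * E 0 b tr * w a b
  have hsum : ∀ z, ∑ p : Y × Y, T (LegTensor.glue I (φ p) (legIndex J z ∘ ι)) * w p.1 p.2 =
      ∑ br, ∑ tl, E (-1 - 1) (z p₁) br * E 1 tl (z p₂) * (γ br tl * (P₁ z * P₂ z)) := by
    intro z
    have e1 : ∀ p : Y × Y, T (LegTensor.glue I (φ p) (legIndex J z ∘ ι)) * w p.1 p.2 =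
        ∑ br, ∑ tl, E (-1 - 1) (z p₁) br * E 1 tl (z p₂) * (P₁ z * P₂ z) *
          ∑ bl, ∑ tr, B ![J.symm (bl, br), J.symm (tl, tr)] *
            (E (-1) bl p.1 * E 0 p.2 tr * w p.1 p.2) := by
      intro p
      rw [hT]
      unfold doubleTensor
      simp only [hA₁, hA₂]
      rw [← Equiv.sum_comp J.symm, Fintype.sum_prod_type, Finset.sum_comm, Finset.sum_mul]
      refine Finset.sum_congr rfl fun br _ => ?_
      have e2 : ∀ bl, ∑ t, E (-1) (J (J.symm (bl, br))).1 p.1 *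
          E (-1 - 1) (z p₁) (J (J.symm (bl, br))).2 * P₁ z * B ![J.symm (bl, br), t] *
          (E 0 p.2 (J t).2 * E 1 (J t).1 (z p₂) * P₂ z) = ∑ tl, ∑ tr,
          E (-1) bl p.1 * E (-1 - 1) (z p₁) br * P₁ z * B ![J.symm (bl, br), J.symm (tl, tr)] *
          (E 0 p.2 tr * E 1 tl (z p₂) * P₂ z) := by
        intro bl
        rw [← Equiv.sum_comp J.symm, Fintype.sum_prod_type]
        simp only [Equiv.apply_symm_apply]
      simp only [e2]
      rw [Finset.sum_comm, Finset.sum_mul]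
      refine Finset.sum_congr rfl fun tl _ => ?_
      simp only [Finset.sum_mul, Finset.mul_sum]
      exact Finset.sum_congr rfl fun bl _ => Finset.sum_congr rfl fun tr _ => by ring
    simp only [e1]
    rw [Finset.sum_comm]
    refine Finset.sum_congr rfl fun br _ => ?_
    rw [Finset.sum_comm]
    refine Finset.sum_congr rfl fun tl _ => ?_
    rw [← Finset.mul_sum, mul_assoc, mul_comm (P₁ z * P₂ z)]
    congr 2
    rw [Finset.sum_comm]
    refine Finset.sum_congr rfl fun bl _ => ?_
    rw [Finset.sum_comm]
    refine Finset.sum_congr rfl fun tr _ => ?_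
    rw [← Finset.mul_sum, Fintype.sum_prod_type]
  have hnorm := sum_norm_sq_two_wires h₁ h₂ (p₁ := p₁) (p₂ := p₂) (by simp [p₁, p₂])
    (H := fun br tl z => γ br tl * (P₁ z * P₂ z)) fun br tl z z' hz => by
      have i1 : P₁ z = P₁ z' := Finset.prod_congr rfl fun l hl => by
        simp only [Finset.mem_sdiff, Finset.mem_univ, true_and, Finset.mem_insert,
          Finset.mem_singleton, not_or] at hl
        rw [hz (Sum.inl l, true) (by simp [p₁, p₂, hl.2]), hz (Sum.inl (l + 1), false)
          (by simp [p₁, p₂])]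
      have i2 : P₂ z = P₂ z' := Finset.prod_congr rfl fun l hl => by
        simp only [Finset.mem_sdiff, Finset.mem_univ, true_and, Finset.mem_insert,
          Finset.mem_singleton, not_or] at hl
        rw [hz (Sum.inr l, true) (by simp [p₁, p₂]), hz (Sum.inr (l + 1), false)
          (by simp [p₁, p₂, hl.2])]
      beta_reduce
      rw [i1, i2]
  have hK := hiso w
  simp only [hsum] at hK
  rw [hK] at hnorm
  have hγ : ∀ z, ∑ br, ∑ tl, ‖γ br tl * (P₁ z * P₂ z)‖ ^ 2 =
      (∑ br, ∑ tl, ‖γ br tl‖ ^ 2) * ‖P₁ z * P₂ z‖ ^ 2 := by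
    intro z
    simp only [norm_mul (γ _ _), mul_pow, Finset.sum_mul]
  simp only [hγ, ← Finset.mul_sum] at hnorm
  rw [mul_assoc (_ ^ 2 : ℝ), hnorm, Finset.sum_comm]
  ring

end Double

/-- The edge tensor of a hyperinvariant pair is dual-unitary. -/
theorem exists_isDual [NeZero q] [Nonempty Y] {E : Fin q → Y → Y → ℂ} {A : LegTensor (Fin q) k}
    (hq : 3 ≤ q) (hA : IsWired J E A) (hAB : IsHIT A B) :
    ∃ c, 0 < c ∧ IsDual c fun bl br tl tr => B ![J.symm (bl, br), J.symm (tl, tr)] := by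
  obtain ⟨c, hc, h₁⟩ := exists_isIso₂_start_finish (J := J) hAB.isometric_B
  obtain ⟨c', h₂⟩ := exists_isIso₂_left_right hq hA hAB.isometric_double
  have hY : (0 : ℝ) < Fintype.card Y := by exact_mod_cast Fintype.card_pos
  -- both constants are determined by the norm of `B`
  have hcc : c = c' := by
    have e₁ := h₁.sum_norm_sq
    have e₂ := h₂.sum_norm_sq
    have e₃ : ∑ bl, ∑ br, ∑ tl, ∑ tr, ‖B ![J.symm (bl, br), J.symm (tl, tr)]‖ ^ 2 =
        ∑ bl, ∑ tr, ∑ tl, ∑ br, ‖B ![J.symm (bl, br), J.symm (tl, tr)]‖ ^ 2 := by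
      refine Finset.sum_congr rfl fun bl _ => ?_
      rw [Finset.sum_congr rfl fun br _ => Finset.sum_comm, Finset.sum_comm]
      exact Finset.sum_congr rfl fun tr _ => Finset.sum_comm
    rw [e₁, e₂] at e₃
    exact mul_right_cancel₀ (by positivity) e₃
  subst hcc
  refine ⟨c, hc, h₁, ?_, h₂, ?_⟩
  · have : (fun tl br bl tr : Y => B ![J.symm (bl, br), J.symm (tl, tr)]) =
        fun tl br bl tr => B ![J.symm (tl, tr), J.symm (bl, br)] := by
      funext tl br bl tr
      exact hAB.symmetric _ _
    rw [this]
    exact h₂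
  · have : (fun tl tr bl br : Y => B ![J.symm (bl, br), J.symm (tl, tr)]) =
        fun tl tr bl br => B ![J.symm (tl, tr), J.symm (bl, br)] := by
      funext tl tr bl br
      exact hAB.symmetric _ _
    rw [this]
    exact h₁

end EdgeTensor

/-! ### Symmetries of the hyperbolic plane -/

namespace HyperbolicTiling

open Complex (normSq)

theorem one_sub_conj_mul_ne_zero (z w : 𝔻) : 1 - conj (z : ℂ) * w ≠ 0 :=
  halfTurn_denom_ne_zero z w

/-- `f` is an orientation-preserving isometry of the hyperbolic plane: it is induced by a linear map
preserving the Hermitian form `1 - z̄w`, where `l` is the factor by which the standard representatives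
of the points are rescaled. -/
def IsMobius (f : Equiv.Perm 𝔻) : Prop :=
  ∃ l : 𝔻 → ℂ, (∀ z, l z ≠ 0) ∧
    ∀ z w, 1 - conj (f z : ℂ) * f w = conj (l z) * l w * (1 - conj (z : ℂ) * w)

theorem IsMobius.mul {f g : Equiv.Perm 𝔻} (hf : IsMobius f) (hg : IsMobius g) :
    IsMobius (f * g) := by
  obtain ⟨l, hl, h⟩ := hf
  obtain ⟨l', hl', h'⟩ := hg
  refine ⟨fun z => l (g z) * l' z, fun z => mul_ne_zero (hl _) (hl' _), fun z w => ?_⟩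
  rw [Equiv.Perm.mul_apply, Equiv.Perm.mul_apply, h, h', map_mul]
  ring

theorem IsMobius.inv {f : Equiv.Perm 𝔻} (hf : IsMobius f) : IsMobius f⁻¹ := by
  obtain ⟨l, hl, h⟩ := hf
  refine ⟨fun z => (l (f⁻¹ z))⁻¹, fun z => inv_ne_zero (hl _), fun z w => ?_⟩
  have h1 := h (f⁻¹ z) (f⁻¹ w)
  have e0 : ∀ z, f (f⁻¹ z) = z := f.apply_symm_apply
  rw [e0, e0] at h1
  beta_reduce
  rw [h1, map_inv₀]
  have e1 : conj (l (f⁻¹ z)) ≠ 0 := by simpa using hl _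
  have e2 := hl (f⁻¹ w)
  field_simp

theorem isMobius_halfTurn (t : 𝔻) : IsMobius (halfTurn t) := by
  have ht : 0 < 1 - normSq (t : ℂ) := sub_pos.2 t.normSq_lt_one
  have hs : ((Real.sqrt (1 - normSq (t : ℂ)) : ℝ) : ℂ) ^ 2 = 1 - conj (t : ℂ) * t := by
    rw [← Complex.ofReal_pow, Real.sq_sqrt ht.le, ← Complex.normSq_eq_conj_mul_self]
    push_cast
    rfl
  refine ⟨fun z => (Real.sqrt (1 - normSq (t : ℂ)) : ℝ) / (1 - conj (t : ℂ) * z), fun z => ?_,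
    fun z w => ?_⟩
  · refine div_ne_zero ?_ (one_sub_conj_mul_ne_zero t z)
    exact_mod_cast (Real.sqrt_pos.2 ht).ne'
  · have hz := one_sub_conj_mul_ne_zero t z
    have hz' : 1 - conj (z : ℂ) * t ≠ 0 := one_sub_conj_mul_ne_zero z t
    have hw := one_sub_conj_mul_ne_zero t w
    change 1 - conj (((t : ℂ) - z) / (1 - conj (t : ℂ) * z)) *
      (((t : ℂ) - w) / (1 - conj (t : ℂ) * w)) = _
    simp only [map_div₀, map_sub, map_mul, map_one, Complex.conj_conj, Complex.conj_ofReal]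
    rw [div_mul_div_comm ((Real.sqrt _ : ℝ) : ℂ), ← pow_two, hs, mul_comm (t : ℂ) (conj (z : ℂ))]
    field_simp
    ring

theorem coe_rotation (q : ℕ) (z : 𝔻) :
    (rotation q z : ℂ) = Complex.exp (2 * Real.pi * Complex.I / q) * z := by
  change ((Circle.exp (2 * Real.pi / q) • z : 𝔻) : ℂ) = _
  rw [Complex.UnitDisc.coe_circle_smul, Circle.coe_exp]
  congr 2
  push_cast
  ring

theorem isMobius_rotation (q : ℕ) : IsMobius (rotation q) := by
  refine ⟨fun _ => (Circle.exp (2 * Real.pi / q) : ℂ), fun _ => Circle.coe_ne_zero _,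
    fun z w => ?_⟩
  change 1 - conj ((Circle.exp (2 * Real.pi / q) • z : 𝔻) : ℂ) *
    ((Circle.exp (2 * Real.pi / q) • w : 𝔻) : ℂ) = _
  have h : conj (Circle.exp (2 * Real.pi / q) : ℂ) * (Circle.exp (2 * Real.pi / q) : ℂ) = 1 := by
    rw [← Complex.normSq_eq_conj_mul_self, Circle.normSq_coe, Complex.ofReal_one]
  rw [Complex.UnitDisc.coe_circle_smul, Complex.UnitDisc.coe_circle_smul, map_mul]
  linear_combination -h

theorem isMobius_of_mem {p q : ℕ} {f : Equiv.Perm 𝔻} (hf : f ∈ symmetries p q) : IsMobius f := by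
  induction hf using Subgroup.closure_induction with
  | mem f hf =>
    rcases hf with rfl | rfl
    · exact isMobius_rotation q
    · exact isMobius_halfTurn _
  | one => exact ⟨fun _ => 1, fun _ => one_ne_zero, fun z w => by simp⟩
  | mul f g _ _ hf hg => exact hf.mul hg
  | inv f _ hf => exact hf.inv

/-- An orientation-preserving isometry is determined by its values at two points. -/
theorem IsMobius.eq_one {f : Equiv.Perm 𝔻} (hf : IsMobius f) (h0 : f 0 = 0) {t : 𝔻} (ht : t ≠ 0)
    (h1 : f t = t) : f = 1 := by
  obtain ⟨l, hl, h⟩ := hf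
  have e : ∀ w, conj (l 0) * l w = 1 := by
    intro w
    have := h 0 w
    rw [h0] at this
    simpa using this.symm
  have hconst : ∀ w, l w = l 0 := fun w =>
    mul_left_cancel₀ ((map_ne_zero (starRingEnd ℂ)).2 (hl 0)) ((e w).trans (e 0).symm)
  ext w
  have h2 := h t w
  rw [h1, hconst t, hconst w, e 0, one_mul] at h2
  have ht' : conj (t : ℂ) ≠ 0 := by simpa using ht
  have h3 : (f w : ℂ) = w := mul_left_cancel₀ ht' (by linear_combination -h2)
  exact congrArg _ (Complex.UnitDisc.coe_injective h3)

/-- The square of the hyperbolic cosine of half the hyperbolic distance. -/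
noncomputable def coshSq (z w : 𝔻) : ℝ :=
  normSq (1 - conj (z : ℂ) * w) / ((1 - normSq (z : ℂ)) * (1 - normSq (w : ℂ)))

theorem IsMobius.coshSq_eq {f : Equiv.Perm 𝔻} (hf : IsMobius f) (z w : 𝔻) :
    coshSq (f z) (f w) = coshSq z w := by
  obtain ⟨l, hl, h⟩ := hf
  have hself : ∀ z, 1 - normSq (f z : ℂ) = normSq (l z) * (1 - normSq (z : ℂ)) := by
    intro z
    have := h z z
    rw [← Complex.normSq_eq_conj_mul_self, ← Complex.normSq_eq_conj_mul_self,
      ← Complex.normSq_eq_conj_mul_self] at this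
    exact_mod_cast this
  have hz : normSq (l z) ≠ 0 := by simpa using hl z
  have hw : normSq (l w) ≠ 0 := by simpa using hl w
  unfold coshSq
  rw [hself, hself, h, Complex.normSq_mul, Complex.normSq_mul, Complex.normSq_conj,
    show normSq (l z) * (1 - normSq (z : ℂ)) * (normSq (l w) * (1 - normSq (w : ℂ))) =
      normSq (l z) * normSq (l w) * ((1 - normSq (z : ℂ)) * (1 - normSq (w : ℂ))) by ring,
    mul_div_mul_left _ _ (mul_ne_zero hz hw)]

theorem coshSq_self (z : 𝔻) : coshSq z z = 1 := by
  have hz : 0 < 1 - normSq (z : ℂ) := sub_pos.2 z.normSq_lt_one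
  have : normSq (1 - conj (z : ℂ) * z) = (1 - normSq (z : ℂ)) * (1 - normSq (z : ℂ)) := by
    rw [← Complex.normSq_eq_conj_mul_self, ← Complex.ofReal_one, ← Complex.ofReal_sub,
      Complex.normSq_ofReal]
  unfold coshSq
  rw [this, div_self (mul_pos hz hz).ne']

theorem one_le_coshSq (z w : 𝔻) : 1 ≤ coshSq z w := by
  have hz : 0 < 1 - normSq (z : ℂ) := sub_pos.2 z.normSq_lt_one
  have hw : 0 < 1 - normSq (w : ℂ) := sub_pos.2 w.normSq_lt_one
  unfold coshSq
  rw [one_le_div (mul_pos hz hw)]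
  have key : normSq (1 - conj (z : ℂ) * w) - normSq ((z : ℂ) - w) =
      (1 - normSq (z : ℂ)) * (1 - normSq (w : ℂ)) := by
    simp only [Complex.normSq_apply, Complex.sub_re, Complex.sub_im, Complex.mul_re,
      Complex.mul_im, Complex.conj_re, Complex.conj_im, Complex.one_re, Complex.one_im]
    ring
  linarith [Complex.normSq_nonneg ((z : ℂ) - w)]

/-- Of two points opposite to each other with respect to the origin, at least one is farther away
from any given point than the origin. -/
theorem coshSq_zero_lt (x : 𝔻) {y : 𝔻} (hy : y ≠ 0) :
    coshSq x 0 < coshSq x y ∨ coshSq x 0 < coshSq x (-y) := by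
  by_contra! hcon
  obtain ⟨h1, h2⟩ := hcon
  have hx : 0 < 1 - normSq (x : ℂ) := sub_pos.2 x.normSq_lt_one
  have hy1 : 0 < 1 - normSq (y : ℂ) := sub_pos.2 y.normSq_lt_one
  have hy0 : 0 < normSq (y : ℂ) := Complex.normSq_pos.2 (by simpa using hy)
  unfold coshSq at h1 h2
  rw [div_le_div_iff₀ (mul_pos hx (by simpa using hy1)) (mul_pos hx (by simp))] at h1 h2
  simp only [Complex.UnitDisc.coe_neg, Complex.normSq_neg, Complex.UnitDisc.coe_zero, mul_zero,
    sub_zero, map_one, map_zero, mul_one, one_mul] at h1 h2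
  rw [mul_comm, mul_le_mul_iff_right₀ hx] at h1 h2
  have key : normSq (1 - conj (x : ℂ) * y) + normSq (1 - conj (x : ℂ) * -y) =
      2 + 2 * (normSq (x : ℂ) * normSq (y : ℂ)) := by
    simp only [Complex.normSq_apply, Complex.sub_re, Complex.sub_im, Complex.mul_re,
      Complex.mul_im, Complex.conj_re, Complex.conj_im, Complex.one_re, Complex.one_im,
      Complex.neg_re, Complex.neg_im]
    ring
  nlinarith [mul_nonneg (Complex.normSq_nonneg (x : ℂ)) hy0.le]

/-- Of two points exchanged by the half-turn about `μ`, at least one is farther away from any given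
point than `μ`. -/
theorem coshSq_lt_of_halfTurn {t μ : 𝔻} (hμ : (t : ℂ) * (1 + conj (μ : ℂ) * μ) = 2 * μ)
    (x : 𝔻) {a : 𝔻} (ha : a ≠ μ) :
    coshSq x μ < coshSq x a ∨ coshSq x μ < coshSq x (halfTurn t a) := by
  have hm := isMobius_halfTurn μ
  have h0 : halfTurn μ μ = 0 := by
    apply Complex.UnitDisc.coe_injective
    change ((μ : ℂ) - μ) / (1 - conj (μ : ℂ) * μ) = (0 : 𝔻)
    simp
  have hneg : halfTurn μ (halfTurn t a) = -halfTurn μ a := by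
    apply Complex.UnitDisc.coe_injective
    have d1 := one_sub_conj_mul_ne_zero t a
    have d2 := one_sub_conj_mul_ne_zero μ a
    have d3 := one_sub_conj_mul_ne_zero μ (halfTurn t a)
    have hμ' : conj (t : ℂ) * (1 + conj (μ : ℂ) * μ) = 2 * conj (μ : ℂ) := by
      have := congrArg conj hμ
      simp only [map_mul, map_add, map_one, Complex.conj_conj, map_ofNat] at this
      linear_combination this
    rw [Complex.UnitDisc.coe_neg]
    change ((μ : ℂ) - halfTurn t a) / (1 - conj (μ : ℂ) * halfTurn t a) =
      -(((μ : ℂ) - a) / (1 - conj (μ : ℂ) * a))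
    have hh : (halfTurn t a : ℂ) * (1 - conj (t : ℂ) * a) = t - a := div_mul_cancel₀ _ d1
    rw [← neg_div, div_eq_div_iff d3 d2]
    apply mul_right_cancel₀ d1
    have hpos : 1 + conj (μ : ℂ) * μ ≠ 0 := by
      rw [← Complex.normSq_eq_conj_mul_self]
      have : (0 : ℝ) < 1 + normSq (μ : ℂ) := by linarith [Complex.normSq_nonneg (μ : ℂ)]
      exact_mod_cast this.ne'
    apply mul_right_cancel₀ hpos
    linear_combination (-(1 - conj (μ : ℂ) * a) * (1 + conj (μ : ℂ) * μ) -
      (μ - a) * conj (μ : ℂ) * (1 + conj (μ : ℂ) * μ)) * hh -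
      a * (μ * (1 - conj (μ : ℂ) * a) + (μ - a)) * hμ' -
      ((1 - conj (μ : ℂ) * a) + (μ - a) * conj (μ : ℂ)) * hμ
  have hne : halfTurn μ a ≠ 0 := fun h => ha ((halfTurn μ).injective (h.trans h0.symm))
  have key := coshSq_zero_lt (halfTurn μ x) hne
  rw [← hneg, ← h0] at key
  simpa only [hm.coshSq_eq] using key

end HyperbolicTiling

/-! ### Patches of the tiling -/

namespace HyperbolicTiling

open Complex (normSq)

theorem exists_midpoint (t : 𝔻) : ∃ μ : 𝔻, (t : ℂ) * (1 + conj (μ : ℂ) * μ) = 2 * μ := by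
  have ht : 0 < 1 - normSq (t : ℂ) := sub_pos.2 t.normSq_lt_one
  set s := Real.sqrt (1 - normSq (t : ℂ)) with hs
  have hs0 : 0 < s := Real.sqrt_pos.2 ht
  have hs2 : ((s : ℝ) : ℂ) ^ 2 = 1 - conj (t : ℂ) * t := by
    rw [← Complex.ofReal_pow, Real.sq_sqrt ht.le, ← Complex.normSq_eq_conj_mul_self]
    push_cast
    rfl
  have h1 : ‖(t : ℂ) / ((1 + s : ℝ) : ℂ)‖ < 1 := by
    rw [norm_div, Complex.norm_real, Real.norm_of_nonneg (by linarith), div_lt_one (by linarith)]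
    linarith [t.norm_lt_one]
  refine ⟨Complex.UnitDisc.mk _ h1, ?_⟩
  have h2 : ((1 + s : ℝ) : ℂ) ≠ 0 := by exact_mod_cast (by linarith : (1 + s : ℝ) ≠ 0)
  rw [Complex.UnitDisc.coe_mk, map_div₀, Complex.conj_ofReal]
  push_cast at h2 ⊢
  field_simp
  linear_combination (t : ℂ) * hs2

theorem halfTurn_midpoint {t μ : 𝔻} (hμ : (t : ℂ) * (1 + conj (μ : ℂ) * μ) = 2 * μ) :
    halfTurn t μ = μ := by
  apply Complex.UnitDisc.coe_injective
  change ((t : ℂ) - μ) / (1 - conj (t : ℂ) * μ) = μ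
  rw [div_eq_iff (one_sub_conj_mul_ne_zero t μ)]
  have hμ' : conj (t : ℂ) * (1 + conj (μ : ℂ) * μ) = 2 * conj (μ : ℂ) := by
    have := congrArg conj hμ
    simp only [map_mul, map_add, map_one, Complex.conj_conj, map_ofNat] at this
    linear_combination this
  have hpos : 1 + conj (μ : ℂ) * μ ≠ 0 := by
    rw [← Complex.normSq_eq_conj_mul_self]
    have : (0 : ℝ) < 1 + normSq (μ : ℂ) := by linarith [Complex.normSq_nonneg (μ : ℂ)]
    exact_mod_cast this.ne'
  apply mul_right_cancel₀ hpos
  linear_combination hμ + (μ : ℂ) ^ 2 * hμ'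

theorem halfTurn_zero (t : 𝔻) : halfTurn t 0 = t := by
  apply Complex.UnitDisc.coe_injective
  change ((t : ℂ) - (0 : 𝔻)) / (1 - conj (t : ℂ) * (0 : 𝔻)) = t
  simp

theorem halfTurn_self (t : 𝔻) : halfTurn t t = 0 := by
  apply Complex.UnitDisc.coe_injective
  change ((t : ℂ) - t) / (1 - conj (t : ℂ) * t) = (0 : 𝔻)
  simp

section

variable {p q : ℕ}

theorem baseNeighbor_ne_zero (hpq : 2 * (p + q) < p * q) : baseNeighbor p q ≠ 0 := by
  have hp : 3 ≤ p := by
    by_contra! h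
    interval_cases p <;> omega
  have hq : 3 ≤ q := by
    by_contra! h
    interval_cases q <;> omega
  have hp' : (3 : ℝ) ≤ p := by exact_mod_cast hp
  have hq' : (3 : ℝ) ≤ q := by exact_mod_cast hq
  have hpq' : (2 : ℝ) * (p + q) < p * q := by exact_mod_cast hpq
  have hpi := Real.pi_pos
  have hsin : 0 < Real.sin (Real.pi / q) := Real.sin_pos_of_pos_of_lt_pi (by positivity)
    (by rw [div_lt_iff₀ (by linarith)]; nlinarith)
  have hlt : Real.sin (Real.pi / q) < Real.cos (Real.pi / p) := by
    rw [← Real.sin_pi_div_two_sub]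
    have h1 : Real.pi / q < Real.pi / 2 - Real.pi / p := by
      rw [← sub_pos]
      have : Real.pi / 2 - Real.pi / p - Real.pi / q =
          Real.pi * (p * q - 2 * (p + q)) / (2 * p * q) := by
        field_simp
        ring
      rw [this]
      exact div_pos (mul_pos hpi (by linarith)) (by positivity)
    have h2 : 0 < Real.pi / p := by positivity
    have h3 : 0 < Real.pi / q := by positivity
    exact Real.sin_lt_sin_of_lt_of_le_pi_div_two (by linarith) (by linarith) h1
  have hratio : Real.sin (Real.pi / q) / Real.cos (Real.pi / p) < 1 := by
    rw [div_lt_one (hsin.trans hlt)]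
    exact hlt
  have hratio0 : 0 < Real.sin (Real.pi / q) / Real.cos (Real.pi / p) :=
    div_pos hsin (hsin.trans hlt)
  have hpos : 0 < edgeRadius p q := Real.sqrt_pos.2 (by nlinarith)
  have hlt1 : ‖(edgeRadius p q : ℂ)‖ < 1 := by
    rw [Complex.norm_real, Real.norm_of_nonneg hpos.le]
    unfold edgeRadius
    rw [Real.sqrt_lt' one_pos]
    nlinarith
  unfold baseNeighbor
  rw [dif_pos hlt1, ne_eq, Complex.UnitDisc.mk_eq_zero]
  exact_mod_cast hpos.ne'

theorem rotation_pow_apply (n : ℕ) (z : 𝔻) :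
    (((rotation q ^ n) z : 𝔻) : ℂ) = Complex.exp (2 * Real.pi * Complex.I / q) ^ n * z := by
  induction n with
  | zero => simp
  | succ n ih => rw [pow_succ', Equiv.Perm.mul_apply, coe_rotation, ih]; ring

theorem rotation_pow_eq_one [NeZero q] : rotation q ^ q = 1 := by
  refine Equiv.ext fun z => Complex.UnitDisc.coe_injective ?_
  rw [rotation_pow_apply, (Complex.isPrimitiveRoot_exp q (NeZero.ne q)).pow_eq_one, one_mul]
  rfl

theorem rotation_pow_injective [NeZero q] {z : 𝔻} (hz : z ≠ 0) {i j : Fin q}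
    (h : (rotation q ^ (i : ℕ)) z = (rotation q ^ (j : ℕ)) z) : i = j := by
  have h1 := congrArg (fun w : 𝔻 => (w : ℂ)) h
  simp only [rotation_pow_apply] at h1
  have hz' : (z : ℂ) ≠ 0 := by simpa using hz
  exact Fin.ext ((Complex.isPrimitiveRoot_exp q (NeZero.ne q)).pow_inj i.2 j.2
    (mul_right_cancel₀ hz' h1))

theorem rotation_apply_ne (hq : 2 ≤ q) {z : 𝔻} (hz : z ≠ 0) : rotation q z ≠ z := by
  intro h
  have : NeZero q := ⟨by omega⟩
  have h1 := rotation_pow_injective (q := q) hz (i := ⟨1, by omega⟩) (j := ⟨0, by omega⟩) (by simpa using h)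
  simp at h1

theorem rotation_pow_zero (n : ℕ) : (rotation q ^ n) 0 = 0 := by
  apply Complex.UnitDisc.coe_injective
  rw [rotation_pow_apply]
  simp

namespace Patch

variable (P : Patch p q)

theorem legFrame_mem (y : {v // v ∈ P.verts} × Fin q) : P.legFrame y ∈ symmetries p q :=
  mul_mem (P.frame_mem _) (pow_mem (Subgroup.subset_closure (by simp)) _)

theorem legFrame_zero (y : {v // v ∈ P.verts} × Fin q) : P.legFrame y 0 = y.1.1 := by
  unfold legFrame
  rw [Equiv.Perm.mul_apply, rotation_pow_zero, P.frame_zero]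

theorem edgeOf_start (x : P.Edge) : P.edgeOf (P.start x) = x.1 := by
  unfold start
  split_ifs with h
  · exact h
  · exact x.2.choose_spec

theorem finish_spec {x : P.Edge} {y : {v // v ∈ P.verts} × Fin q} (h : P.finish x = some y) :
    y ≠ P.start x ∧ P.edgeOf y = x.1 := by
  unfold finish at h
  split_ifs at h with h1
  cases h
  exact h1.choose_spec

variable [NeZero q]

theorem legFrame_next (y : {v // v ∈ P.verts} × Fin q) :
    P.legFrame (SpinGraph.nextLeg _ y) = P.legFrame y * rotation q := by
  unfold legFrame
  rw [SpinGraph.nextLeg_apply, mul_assoc, ← pow_succ, Fin.val_add, Fin.val_one',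
    Nat.add_mod_mod, ← pow_eq_pow_mod _ rotation_pow_eq_one]

theorem legFrame_prev (y : {v // v ∈ P.verts} × Fin q) :
    P.legFrame ((SpinGraph.nextLeg _).symm y) = P.legFrame y * (rotation q)⁻¹ := by
  rw [eq_mul_inv_iff_mul_eq, ← legFrame_next, Equiv.apply_symm_apply]

variable {P}

theorem eq_of_edgeOf_eq (ht : baseNeighbor p q ≠ 0) {y y' : {v // v ∈ P.verts} × Fin q}
    (h : P.edgeOf y = P.edgeOf y') (hv : y.1 = y'.1) : y = y' := by
  have h1 : P.legFrame y (baseNeighbor p q) = P.legFrame y' (baseNeighbor p q) := by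
    unfold edgeOf at h
    rw [Sym2.eq_iff, hv] at h
    rcases h with h | h
    · exact h.2
    · exact h.2.trans h.1
  refine Prod.ext hv (rotation_pow_injective ht ((P.frame y.1).injective ?_))
  unfold legFrame at h1
  rw [Equiv.Perm.mul_apply, Equiv.Perm.mul_apply, ← hv] at h1
  exact h1

/-- Two different half-edges of an edge start at different ends. -/
theorem edgeOf_eq_swap (ht : baseNeighbor p q ≠ 0) {y y' : {v // v ∈ P.verts} × Fin q}
    (h : P.edgeOf y = P.edgeOf y') (hne : y ≠ y') :
    y.1.1 = P.legFrame y' (baseNeighbor p q) ∧ P.legFrame y (baseNeighbor p q) = y'.1.1 := by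
  have h1 := h
  unfold edgeOf at h1
  rw [Sym2.eq_iff] at h1
  exact h1.resolve_left fun h2 => hne (eq_of_edgeOf_eq ht h (Subtype.ext h2.1))

theorem eq_of_edgeOf_eq_of_ne (ht : baseNeighbor p q ≠ 0)
    {y y' y'' : {v // v ∈ P.verts} × Fin q} (h' : P.edgeOf y = P.edgeOf y')
    (h'' : P.edgeOf y = P.edgeOf y'') (hne' : y ≠ y') (hne'' : y ≠ y'') : y' = y'' :=
  eq_of_edgeOf_eq ht (h'.symm.trans h'') (Subtype.ext
    ((edgeOf_eq_swap ht h' hne').2.symm.trans (edgeOf_eq_swap ht h'' hne'').2))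

/-- The frames at the two ends of an edge differ by a half-turn. -/
theorem legFrame_eq_mul_halfTurn (ht : baseNeighbor p q ≠ 0)
    {y y' : {v // v ∈ P.verts} × Fin q} (h : P.edgeOf y = P.edgeOf y') (hne : y ≠ y') :
    P.legFrame y' = P.legFrame y * halfTurn (baseNeighbor p q) := by
  obtain ⟨h1, h2⟩ := edgeOf_eq_swap ht h hne
  set g := P.legFrame y * halfTurn (baseNeighbor p q) with hg
  have hmem : g⁻¹ * P.legFrame y' ∈ symmetries p q :=
    mul_mem (inv_mem (mul_mem (P.legFrame_mem y) (Subgroup.subset_closure (by simp))))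
      (P.legFrame_mem y')
  have h3 : g⁻¹ * P.legFrame y' = 1 := by
    refine (isMobius_of_mem hmem).eq_one ?_ ht ?_
    · rw [Equiv.Perm.mul_apply, Equiv.Perm.inv_eq_iff_eq, hg, Equiv.Perm.mul_apply, halfTurn_zero,
        h2, P.legFrame_zero]
    · rw [Equiv.Perm.mul_apply, Equiv.Perm.inv_eq_iff_eq, hg, Equiv.Perm.mul_apply, halfTurn_self,
        P.legFrame_zero, h1]
  exact (inv_mul_eq_one.1 h3).symm

theorem isProper_graph (ht : baseNeighbor p q ≠ 0) : P.graph.IsProper where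
  start_injective x x' h := Subtype.ext ((P.edgeOf_start x).symm.trans
    ((congrArg P.edgeOf h).trans (P.edgeOf_start x')))
  finish_injective {x x' y} h h' := Subtype.ext
    ((P.finish_spec h).2.symm.trans (P.finish_spec h').2)
  start_ne_finish x x' y h hxy := by
    obtain ⟨h1, h2⟩ := P.finish_spec h
    have : x = x' := Subtype.ext ((P.edgeOf_start x).symm.trans ((congrArg P.edgeOf hxy).trans h2))
    subst this
    exact h1 hxy.symm
  exists_edge y := by
    refine ⟨⟨P.edgeOf y, y, rfl⟩, ?_⟩
    change P.start _ = y ∨ P.finish _ = some y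
    by_cases hs : P.start ⟨P.edgeOf y, y, rfl⟩ = y
    · exact Or.inl hs
    · right
      have hex : ∃ z, z ≠ P.start ⟨P.edgeOf y, y, rfl⟩ ∧ P.edgeOf z = P.edgeOf y :=
        ⟨y, Ne.symm hs, rfl⟩
      have hf : P.finish ⟨P.edgeOf y, y, rfl⟩ = some hex.choose := dif_pos hex
      have hst := P.edgeOf_start ⟨P.edgeOf y, y, rfl⟩
      rw [hf, eq_of_edgeOf_eq_of_ne ht (hst.trans hex.choose_spec.2.symm) hst
        hex.choose_spec.1.symm hs]
      rfl
  vertex_ne {x y} h hv := by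
    obtain ⟨h1, h2⟩ := P.finish_spec h
    exact h1 (eq_of_edgeOf_eq ht (h2.trans (P.edgeOf_start x).symm) hv.symm)

/-- The distance of the midpoints of the edges from the midpoint of a given edge: at an edge `x`, the
midpoints of the next edges at its two ends are exchanged by the half-turn about the midpoint of `x`,
so that one of them is farther away from the centre. -/
theorem exists_isDistance (hq : 2 ≤ q) (ht : baseNeighbor p q ≠ 0) (x₀ : P.graph.E) :
    ∃ r, P.graph.IsDistance x₀ r := by
  obtain ⟨μ, hμ⟩ := exists_midpoint (baseNeighbor p q)
  have hμ0 : μ ≠ 0 := by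
    rintro rfl
    simp at hμ
    exact ht hμ
  have hrot : rotation q μ ≠ μ := rotation_apply_ne hq hμ0
  have hrot' : (rotation q)⁻¹ μ ≠ μ := fun h => hrot (by rw [Equiv.Perm.inv_eq_iff_eq] at h; exact h.symm)
  set o := P.legFrame (P.start x₀) μ with ho
  have hswap : ∀ {x : P.Edge} {y}, P.finish x = some y →
      P.legFrame y = P.legFrame (P.start x) * halfTurn (baseNeighbor p q) := fun {x y} h =>
    legFrame_eq_mul_halfTurn ht ((P.edgeOf_start x).trans (P.finish_spec h).2.symm)
      (P.finish_spec h).1.symm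
  -- the half-turn is applied after moving the edge `x` to the base edge
  have key : ∀ (y : {v // v ∈ P.verts} × Fin q) {a : 𝔻}, a ≠ μ →
      coshSq o (P.legFrame y μ) < coshSq o (P.legFrame y a) ∨
      coshSq o (P.legFrame y μ) < coshSq o (P.legFrame y (halfTurn (baseNeighbor p q) a)) := by
    intro y a ha
    have h1 := coshSq_lt_of_halfTurn hμ ((P.legFrame y)⁻¹ o) ha
    have hm := isMobius_of_mem (P.legFrame_mem y)
    have e : P.legFrame y ((P.legFrame y)⁻¹ o) = o := (P.legFrame y).apply_symm_apply o
    simp only [← hm.coshSq_eq ((P.legFrame y)⁻¹ o), e] at h1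
    exact h1
  have hnext : ∀ {x : P.Edge} {y : {v // v ∈ P.verts} × Fin q}, P.finish x = some y →
      coshSq o (P.legFrame (P.start x) μ) <
        coshSq o (P.legFrame (SpinGraph.nextLeg _ (P.start x)) μ) ∨
      coshSq o (P.legFrame (P.start x) μ) < coshSq o (P.legFrame (SpinGraph.nextLeg _ y) μ) := by
    intro x y h
    rw [legFrame_next, legFrame_next, hswap h]
    exact key (P.start x) hrot
  have hprev : ∀ {x : P.Edge} {y : {v // v ∈ P.verts} × Fin q}, P.finish x = some y →
      coshSq o (P.legFrame (P.start x) μ) <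
        coshSq o (P.legFrame ((SpinGraph.nextLeg _).symm (P.start x)) μ) ∨
      coshSq o (P.legFrame (P.start x) μ) <
        coshSq o (P.legFrame ((SpinGraph.nextLeg _).symm y) μ) := by
    intro x y h
    rw [legFrame_prev, legFrame_prev, hswap h]
    exact key (P.start x) hrot'
  refine ⟨fun y => coshSq o (P.legFrame y μ), fun y => ?_, fun {x y} h => ?_, fun {x y} h => hnext h,
    fun {x y} h => hprev h⟩
  · change coshSq o (P.legFrame (P.start x₀) μ) ≤ _
    rw [← ho, coshSq_self]
    exact one_le_coshSq _ _
  · change coshSq o (P.legFrame y μ) = coshSq o (P.legFrame (P.start x) μ)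
    rw [hswap h, Equiv.Perm.mul_apply, halfTurn_midpoint hμ]

end Patch

end

end HyperbolicTiling

/-! ### Expectation values -/

namespace SpinGraph

variable {q k : ℕ} {G : SpinGraph q} {A : LegTensor (Fin q) k} {B : LegTensor (Fin 2) k} {e : G.E}

/-- The weight of spin `n/2` in the reducible representation carried by a leg. -/
noncomputable def spinWeight (k n : ℕ) : ℝ := (spinOverlap k n).re / 2 ^ k

theorem IsIsometricAt.inner_spinProj_eq_spinWeight {c : ℝ} (h : IsIsometricAt A B e c) (n : ℕ) :
    inner ℂ (G.state A B) (G.spinProj k n e (G.state A B)) =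
      ((‖G.state A B‖ ^ 2 * spinWeight k n : ℝ) : ℂ) := by
  have h1 := h.inner_spinProj n
  have hreal : conj (inner ℂ (G.state A B) (G.spinProj k n e (G.state A B))) =
      inner ℂ (G.state A B) (G.spinProj k n e (G.state A B)) := by
    rw [inner_conj_symm]
    exact Submodule.inner_starProjection_left_eq_right _ _ _
  have him : (spinOverlap k n).im = 0 := by
    rw [Complex.conj_eq_iff_im, h1, Complex.im_ofReal_mul] at hreal
    exact (mul_eq_zero.1 hreal).resolve_left h.1.ne'
  have h2 : spinOverlap k n = ((spinOverlap k n).re : ℂ) := Complex.ext rfl (by simpa using him)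
  rw [h1, h.norm_state_sq, h2, ← Complex.ofReal_mul]
  congr 1
  unfold spinWeight
  field_simp

theorem state_ne_zero_of_isEmpty [NeZero q] [IsEmpty G.E] (hG : G.IsProper) (A : LegTensor (Fin q) k)
    (B : LegTensor (Fin 2) k) : G.state A B ≠ 0 := by
  have hV : IsEmpty G.V := ⟨fun v => IsEmpty.elim ‹_› (hG.exists_edge (v, 0)).choose⟩
  have hamp : ∀ g b, G.amplitude A B g b = 1 := by
    intro g b
    unfold amplitude
    simp
  have h1 : inner ℂ (G.state A B) (G.state A B) = 1 := by
    rw [state, inner_embed]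
    have hval : ∀ g, inner ℂ (G.wave A B g) (G.wave A B g) = (1 : ℂ) := by
      intro g
      rw [PiLp.inner_apply]
      have : ∀ b, G.wave A B g b = 1 := hamp g
      simp [this]
    rw [integral_congr_ae (Filter.Eventually.of_forall hval)]
    simp
  intro h
  rw [h, inner_zero_left] at h1
  exact zero_ne_one h1

theorem isProper_starGraph (q : ℕ) : (starGraph q).IsProper where
  start_injective _ _ h := congrArg Prod.snd h
  finish_injective h := by cases h
  start_ne_finish _ _ _ h := by cases h
  exists_edge y := ⟨y.2, Or.inl rfl⟩
  vertex_ne h := by cases h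

theorem isDistance_starGraph [NeZero q] (i : Fin q) : (starGraph q).IsDistance i fun _ => 0 where
  center_le _ := le_rfl
  finish_eq h := by cases h
  next h := by cases h
  prev h := by cases h

/-- A single vertex has no inner edges. -/
theorem vertexState_eq (A : LegTensor (Fin q) k) (B : LegTensor (Fin 2) k) :
    vertexState A = (starGraph q).state A B := by
  unfold vertexState state
  congr 1

end SpinGraph

open SpinGraph

/-- The network state of a hyperinvariant pair of Bell pairs, with one edge cut, is isometric from the
cut edge to the boundary. -/
theorem exists_isIsometricAt_bellTensor {q k m : ℕ} [NeZero q] (hq : 3 ≤ q)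
    {e : Fin m × Fin 2 ≃ Fin q × Fin k} {B : LegTensor (Fin 2) k} (hHIT : IsHIT (bellTensor e) B)
    (hnc : NonCrossing e) {G : SpinGraph q} (hG : G.IsProper) {e₀ : G.E} {r : G.V × Fin q → ℝ}
    (hr : G.IsDistance e₀ r) : ∃ c, IsIsometricAt (bellTensor e) B e₀ c := by
  have hadj := BellTensor.partner_adjacent hq hHIT.cyclic hHIT.isometric_A hnc
  have hA := BellTensor.isWired_bellTensor hHIT.cyclic hq hadj
  obtain ⟨c, hc, hB⟩ := exists_isDual hq hA hHIT
  exact exists_isIsometricAt (by omega) hA hc hB (fun u => isSplitUnitary_strandRep _ _ u) hG hr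

theorem three_le_of_hyperbolic {p q : ℕ} (hpq : 2 * (p + q) < p * q) : 3 ≤ q := by
  by_contra! h
  interval_cases q <;> omega

theorem spinLength_eq_zero {q k : ℕ} (A : LegTensor (Fin q) k) (i : Fin q) {n : ℕ} (hn : k < n) :
    spinLength A i n = 0 := by
  have h : (starGraph q).spinProj k n i (vertexState A) = 0 :=
    spinProj_state_eq_zero _ _ _ hn
  unfold spinLength
  rw [h]
  simp

section

variable {q k m : ℕ} [NeZero q] {e : Fin m × Fin 2 ≃ Fin q × Fin k} {B : LegTensor (Fin 2) k}

theorem spinLength_bellTensor (hq : 3 ≤ q) (hHIT : IsHIT (bellTensor e) B) (hnc : NonCrossing e)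
    (i : Fin q) (n : ℕ) :
    spinLength (bellTensor e) i n = lengthEigenvalue n * spinWeight k n := by
  obtain ⟨c, hc⟩ := exists_isIsometricAt_bellTensor hq hHIT hnc (isProper_starGraph q)
    (isDistance_starGraph i)
  have hne : 0 < ‖(starGraph q).state (bellTensor e) B‖ ^ 2 := by
    rw [hc.norm_state_sq]
    exact mul_pos hc.1 (by positivity)
  unfold spinLength
  rw [vertexState_eq (bellTensor e) B, hc.inner_spinProj_eq_spinWeight, Complex.ofReal_re,
    mul_div_cancel_left₀ _ hne.ne']

end

namespace HyperbolicTiling.Patch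

variable {p q k : ℕ} (P : Patch p q)

theorem lengthTerm_state_eq_zero (A : LegTensor (Fin q) k) (B : LegTensor (Fin 2) k) (c : Set 𝔻)
    {n : ℕ} (hn : k < n) : P.lengthTerm k c n (P.graph.state A B) = 0 := by
  unfold lengthTerm
  simp [spinProj_state_eq_zero A B _ hn]

theorem inner_lengthTerm {c : Set 𝔻} (hfin : (P.support ∩ c).Finite) (n : ℕ)
    {f : P.graph.HilbertSpace k} {a : ℝ}
    (h : ∀ x, inner ℂ f (P.graph.spinProj k n x f) = (a : ℂ)) :
    inner ℂ f (P.lengthTerm k c n f) =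
      ((lengthEigenvalue n * (P.graphLength c * a) : ℝ) : ℂ) := by
  have hcard : Nat.card {z : {z // z ∈ P.support} // z.1 ∈ c} = P.graphLength c :=
    Nat.card_congr (Equiv.subtypeSubtypeEquivSubtypeInter (· ∈ P.support) (· ∈ c))
  have : Finite {z : {z // z ∈ P.support} // z.1 ∈ c} :=
    have : Finite {z // z ∈ P.support ∧ z ∈ c} := hfin.to_subtype
    Finite.of_equiv _ (Equiv.subtypeSubtypeEquivSubtypeInter (· ∈ P.support) (· ∈ c)).symm
  have := Fintype.ofFinite {z : {z // z ∈ P.support} // z.1 ∈ c}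
  unfold lengthTerm
  rw [finsum_eq_sum_of_fintype, inner_smul_right, inner_sum, ← hcard, Nat.card_eq_fintype_card]
  simp [h]

end HyperbolicTiling.Patch

theorem mainTheorem5 (p q k m : ℕ) [NeZero q] (hpq : 2 * (p + q) < p * q)
    (e : Fin m × Fin 2 ≃ Fin q × Fin k) (B : LegTensor (Fin 2) k)
    (hHIT : IsHIT (bellTensor e) B) (hnc : NonCrossing e)
    (P : HyperbolicTiling.Patch p q)
    (J : Set ℝ) (hJ : J.OrdConnected) (γ : ℝ → Complex.UnitDisc)
    (hγ : ContinuousOn γ J) (hinj : Set.InjOn γ J)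
    (hfin : (P.support ∩ γ '' J).Finite)
    (hvert : ∀ z ∈ P.support ∩ γ '' J, z ∉ HyperbolicTiling.vertices p q)
    (i : Fin q) :
    P.graph.state (bellTensor e) B ≠ 0 ∧
    Summable (spinLength (bellTensor e) i) ∧
    P.InLengthDomain k (γ '' J) (P.graph.state (bellTensor e) B) ∧
    inner ℂ (P.graph.state (bellTensor e) B)
        (P.lengthOp k (γ '' J) (P.graph.state (bellTensor e) B)) /
        ((‖P.graph.state (bellTensor e) B‖ ^ 2 : ℝ) : ℂ) =
      (((∑' n, spinLength (bellTensor e) i n) * P.graphLength (γ '' J) : ℝ) : ℂ) := by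
  have hq := three_le_of_hyperbolic hpq
  have ht := HyperbolicTiling.baseNeighbor_ne_zero hpq
  have hG := HyperbolicTiling.Patch.isProper_graph (P := P) ht
  have hiso : ∀ x : P.graph.E, ∃ c, IsIsometricAt (bellTensor e) B x c := fun x =>
    have ⟨_, hr⟩ := HyperbolicTiling.Patch.exists_isDistance (P := P) (by omega) ht x
    exists_isIsometricAt_bellTensor hq hHIT hnc hG hr
  set ψ := P.graph.state (bellTensor e) B with hψ
  have hne : ψ ≠ 0 := by
    rcases isEmpty_or_nonempty P.graph.E with hE | ⟨⟨x⟩⟩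
    · exact state_ne_zero_of_isEmpty hG _ _
    · obtain ⟨c, hc⟩ := hiso x
      intro h
      have h1 := hc.norm_state_sq
      rw [← hψ, h, norm_zero] at h1
      have := mul_pos hc.1 (pow_pos two_pos k)
      rw [← h1, zero_pow two_ne_zero] at this
      exact lt_irrefl _ this
  have hzero : ∀ n ∉ Finset.range (k + 1), P.lengthTerm k (γ '' J) n ψ = 0 := fun n hn =>
    P.lengthTerm_state_eq_zero _ _ _ (by simpa using hn)
  have hzero' : ∀ n ∉ Finset.range (k + 1), spinLength (bellTensor e) i n = 0 := fun n hn =>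
    spinLength_eq_zero _ i (by simpa using hn)
  refine ⟨hne, summable_of_ne_finset_zero hzero', summable_of_ne_finset_zero hzero, ?_⟩
  have hterm : ∀ n, inner ℂ ψ (P.lengthTerm k (γ '' J) n ψ) =
      ((spinLength (bellTensor e) i n * P.graphLength (γ '' J) * ‖ψ‖ ^ 2 : ℝ) : ℂ) := by
    intro n
    rw [P.inner_lengthTerm hfin n (a := ‖ψ‖ ^ 2 * spinWeight k n) fun x => by
      obtain ⟨c, hc⟩ := hiso x
      exact hc.inner_spinProj_eq_spinWeight n, spinLength_bellTensor hq hHIT hnc]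
    congr 1
    ring
  have hnorm : ‖ψ‖ ^ 2 ≠ 0 := pow_ne_zero 2 (norm_ne_zero_iff.2 hne)
  unfold HyperbolicTiling.Patch.lengthOp
  rw [tsum_eq_sum hzero, tsum_eq_sum hzero', inner_sum, Finset.sum_congr rfl fun n _ => hterm n,
    ← Complex.ofReal_sum, ← Complex.ofReal_div, ← Finset.sum_mul, ← Finset.sum_mul,
    mul_div_cancel_right₀ _ hnorm]
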